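/- **Setting.** Let $d\ge 1$, $n\ge 1$, $\bar d=\binom{d+2}{2}$. Draw $x_1,\dots,x_n,x_{n+1}=x_{\mathrm{query}}\sim\mathcal N(0,I_d)$ i.i.d. and, independently, i.i.d. $\mathcal N(0,1)$ coefficients $w_{ij}$ ($0\le i\le j\le d$); put $f(x)=w_{00}+\sum_{i} w_{0i}x[i]+\sum_{1\le i\le j\le d} w_{ij}x[i]x[j]$ and $y_i=f(x_i)$. The prompt $Z\in\mathbb R^{(\bar d+1)\times(n+1)}$ has columns $(1,x_i,\mathbf 0,y_i)$ for $i\le n$ and last column $(1,x_{\mathrm{query}},\mathbf 0,0)$. For $W_0,W_1\in\mathbb R^{\bar d\times\bar d}$ and $P,Q\in\mathbb R^{(\bar d+1)\times(\bar d+1)}$ let $$\mathrm{bilin}(Z)=Z+(\mathrm{diag}(W_0,0)Z)\odot(\mathrm{diag}(W_1,0)Z),\qquad \mathrm{attn}(Z)=Z+\tfrac1n PZ\,\mathrm{diag}(I_n,0)\,(Z^\top QZ).$$ The prediction $\hat y$ of the bilinear Transformer block $\mathrm{attn}\circ\mathrm{bilin}$ is the bottom right entry of its output, and its in-context learning loss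 is $\mathcal L=\mathbb E[(\hat y+y_{\mathrm{query}})^2]$ (so $\hat y$ is meant to approximate $-y_{\mathrm{query}}$). The bilinear layer leaves the label row unchanged and applies a feature map $x\mapsto\widetilde x\in\mathbb R^{\bar d}$ to the other part of each column. Let $v=v(x)\in\mathbb R^{\bar d}$ be the vector of orthonormal quadratic features $1$, $x[j]$, $(x[i]^2-1)/\sqrt2$, and $x[i]x[j]$ ($i<j$). **Two-stage procedure.** Fix a diagonal matrix $\Gamma_0\in\mathbb R^{\bar d\times\bar d}$ with strictly negative diagonal entries. Stage 1: with $P=\mathrm{diag}(0,1)$ and $Q=\mathrm{diag}(\Gamma_0,0)$ frozen, let $(W_0,W_1)$ be a global minimiser of $\mathcal L$ over all bilinear weights. Stage 2: with these $W_0,W_1$ frozen, let $(P,Q)$ be a global minimiser of $\mathcal L$ over all attention weights. **Statement.** There are a universal constant $C>0$ and constants $K_d$ depending only on $d$ such that for all $d\ge1$, all $n\ge Cd^3$ and all $\Gamma_0$ as above, Stage 1 has a minimiser, and for every Stage 1 minimiser Stage 2 has a minimiser, and every outcome of the procedure satisfies the following. 1. The feature map of the bilinear layer is $\widetilde x=Mv(x)$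 for all $x\in\mathbb R^d$, with an invertible matrix $M$. 2. The attention weights approximately solve ordinary least squares on the features $\widetilde x$: the last row of $P$ is $(0,\dots,0,p)$ with $p\ne0$, the first $\bar d$ columns of $Q$ are $\begin{bmatrix}\Gamma\\0\end{bmatrix}$ with $\Gamma\in\mathbb R^{\bar d\times\bar d}$ (no other entries of $P,Q$ influence $\hat y$, so that $\hat y=\frac1n\sum_i y_i\,\widetilde x_i^\top\Gamma^\star\widetilde x_{\mathrm{query}}$ with $\Gamma^\star=p\,\Gamma$), $\mathbb E[\widetilde x\widetilde x^\top]$ is invertible, and $$\|\Gamma^\star+\mathbb E[\widetilde x\widetilde x^\top]^{-1}\|_F\le C\,\|\Gamma_0\|_{\mathrm{op}}\frac{d^{3/2}}{\sqrt n},\qquad \|M^\top\Gamma^\star M+I\|_F\le C\,\frac{d^{3/2}}{\sqrt n}.$$ Moreover, the Gram matrix $\sum_{i\le n}\widetilde x_i\widetilde x_i^\top$ is almost surely invertible, and the ordinary least squares prediction $\hat y_{\mathrm{OLS}}=\big\langle(\sum_i\widetilde x_i\widetilde x_i^\top)^{-1}\sum_i y_i\widetilde x_i,\ \widetilde x_{\mathrm{query}}\big\rangle$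 satisfies $\mathbb E[(\hat y+\hat y_{\mathrm{OLS}})^2]\le K_d/n$. 3. The in-context learning loss satisfies $\mathcal L\le K_d/n$. -/

import Mathlib

open MeasureTheory ProbabilityTheory

namespace QuadICL

noncomputable section

/-- The index pairs `0 ≤ i ≤ j ≤ d`. There are `(d+2).choose 2` of them, the embedding dimension;
they label the quadratic features, the coefficients of a quadratic function, and the first
(non-label) rows of the prompt matrix. -/
abbrev Idx (d : ℕ) : Type := {p : Fin (d + 1) × Fin (d + 1) // p.1 ≤ p.2}

/-- Columns of the prompt: the `n` examples, followed by the query. -/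
abbrev Col (n : ℕ) : Type := Fin n ⊕ Unit

/-- Rows of the prompt: the feature rows, followed by the label row. -/
abbrev Row (d : ℕ) : Type := Idx d ⊕ Unit

theorem card_Idx (d : ℕ) : Fintype.card (Idx d) = (d + 2).choose 2 := by
  have e : Idx d ≃ Sym2 (Fin (d + 1)) := (Sym2.sortEquiv (α := Fin (d + 1))).symm
  rw [Fintype.card_congr e, Sym2.card]
  simp

/-- The homogenised input `(1, x[1], …, x[d])`. -/
def homog {d : ℕ} (x : Fin d → ℝ) : Fin (d + 1) → ℝ := Fin.cons 1 x

/-- The quadratic function `w₀₀ + ∑ w₀ᵢ x[i] + ∑_{i ≤ j} wᵢⱼ x[i] x[j]`. -/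
def target {d : ℕ} (w : Idx d → ℝ) (x : Fin d → ℝ) : ℝ :=
  ∑ p : Idx d, w p * (homog x p.1.1 * homog x p.1.2)

/-- The orthonormal quadratic features: `1`, `x[j]`, `(x[i]² - 1)/√2`, and `x[i] x[j]` for `i < j`. -/
def basisFeature {d : ℕ} (x : Fin d → ℝ) (p : Idx d) : ℝ :=
  if p.1.1 = p.1.2 ∧ p.1.1 ≠ 0 then (homog x p.1.1 ^ 2 - 1) / √2
  else homog x p.1.1 * homog x p.1.2

/-- The input column `(1, x[1], …, x[d], 0, …, 0)`: row `(0,0)` holds `1`, row `(0,j)` holds `x[j]`,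
and all the other rows hold `0`. -/
def embed {d : ℕ} (x : Fin d → ℝ) (p : Idx d) : ℝ :=
  if p.1.1 = 0 then homog x p.1.2 else 0

/-- The prompt matrix; the label of the query is hidden by a zero. -/
def prompt {d n : ℕ} (x : Col n → Fin d → ℝ) (w : Idx d → ℝ) : Matrix (Row d) (Col n) ℝ :=
  Matrix.fromBlocks
    (Matrix.of fun p i => embed (x (Sum.inl i)) p) (Matrix.of fun p _ => embed (x (Sum.inr ())) p)
    (Matrix.of fun _ i => target w (x (Sum.inl i))) 0

/-- Law of the inputs and the coefficients: all are independent standard Gaussians. -/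
def promptLaw (d n : ℕ) : Measure ((Col n → Fin d → ℝ) × (Idx d → ℝ)) :=
  (Measure.pi fun _ => Measure.pi fun _ => gaussianReal 0 1).prod
    (Measure.pi fun _ => gaussianReal 0 1)

/-- The mask `diag(Iₙ, 0)`. -/
def mask (n : ℕ) : Matrix (Col n) (Col n) ℝ := Matrix.fromBlocks 1 0 0 0

/-- Linear self-attention `Z + (1/n) P Z M (Zᵀ Q Z)`. -/
def attn {d n : ℕ} (P Q : Matrix (Row d) (Row d) ℝ) (Z : Matrix (Row d) (Col n) ℝ) :
    Matrix (Row d) (Col n) ℝ :=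
  Z + (1 / (n : ℝ)) • (P * Z * mask n * (Z.transpose * Q * Z))

/-- The masked feed-forward weight `diag(W, 0)`. -/
def padWeight {d : ℕ} (W : Matrix (Idx d) (Idx d) ℝ) : Matrix (Row d) (Row d) ℝ :=
  Matrix.fromBlocks W 0 0 0

/-- The bilinear feed-forward layer `Z + (diag(W₀, 0) Z) ⊙ (diag(W₁, 0) Z)`. -/
def bilin {d n : ℕ} (W₀ W₁ : Matrix (Idx d) (Idx d) ℝ) (Z : Matrix (Row d) (Col n) ℝ) :
    Matrix (Row d) (Col n) ℝ :=
  Z + Matrix.hadamard (padWeight W₀ * Z) (padWeight W₁ * Z)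

/-- The bilinear Transformer block. -/
def btfb {d n : ℕ} (W₀ W₁ : Matrix (Idx d) (Idx d) ℝ) (P Q : Matrix (Row d) (Row d) ℝ)
    (Z : Matrix (Row d) (Col n) ℝ) : Matrix (Row d) (Col n) ℝ :=
  attn P Q (bilin W₀ W₁ Z)

/-- The prediction of the block: the bottom right entry of its output. -/
def prediction {d n : ℕ} (W₀ W₁ : Matrix (Idx d) (Idx d) ℝ) (P Q : Matrix (Row d) (Row d) ℝ)
    (Z : Matrix (Row d) (Col n) ℝ) : ℝ :=
  btfb W₀ W₁ P Q Z (Sum.inr ()) (Sum.inr ())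

/-- The in-context learning loss `𝔼 (ŷ + y_query)²`. The integrand is a polynomial in independent
Gaussians, hence always integrable. -/
def loss (d n : ℕ) (W₀ W₁ : Matrix (Idx d) (Idx d) ℝ) (P Q : Matrix (Row d) (Row d) ℝ) : ℝ :=
  ∫ ω, (prediction W₀ W₁ P Q (prompt ω.1 ω.2) + target ω.2 (ω.1 (Sum.inr ()))) ^ 2 ∂promptLaw d n

/-- The initial attention weight `P₀`. -/
def initP (d : ℕ) : Matrix (Row d) (Row d) ℝ := Matrix.fromBlocks 0 0 0 1

/-- The initial attention weight `Q₀ = diag(Γ, 0)` for the diagonal matrix `Γ = diag(γ)`. -/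
def initQ {d : ℕ} (γ : Idx d → ℝ) : Matrix (Row d) (Row d) ℝ :=
  Matrix.fromBlocks (Matrix.diagonal γ) 0 0 0

/-- `(W₀, W₁)` is an output of the first stage: with the attention weights frozen at their initial
values, it is a global minimiser of the loss over all bilinear weights. -/
def IsStageOne (d n : ℕ) (γ : Idx d → ℝ) (W₀ W₁ : Matrix (Idx d) (Idx d) ℝ) : Prop :=
  ∀ V₀ V₁ : Matrix (Idx d) (Idx d) ℝ,
    loss d n W₀ W₁ (initP d) (initQ γ) ≤ loss d n V₀ V₁ (initP d) (initQ γ)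

/-- `(P, Q)` is an output of the second stage: with the bilinear weights frozen, it is a global
minimiser of the loss over all attention weights. -/
def IsStageTwo (d n : ℕ) (W₀ W₁ : Matrix (Idx d) (Idx d) ℝ) (P Q : Matrix (Row d) (Row d) ℝ) :
    Prop :=
  ∀ P' Q' : Matrix (Row d) (Row d) ℝ, loss d n W₀ W₁ P Q ≤ loss d n W₀ W₁ P' Q'

/-- The feature map `x ↦ x̃` implemented by the bilinear layer (see `bilin_prompt`). -/
def bilinFeature {d : ℕ} (W₀ W₁ : Matrix (Idx d) (Idx d) ℝ) (x : Fin d → ℝ) : Idx d → ℝ :=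
  fun p => embed x p + (W₀.mulVec (embed x)) p * (W₁.mulVec (embed x)) p

/-- On prompts, the bilinear layer applies `bilinFeature` to every input column and keeps the
label row. -/
theorem bilin_prompt {d n : ℕ} (W₀ W₁ : Matrix (Idx d) (Idx d) ℝ) (x : Col n → Fin d → ℝ)
    (w : Idx d → ℝ) :
    bilin W₀ W₁ (prompt x w) = Matrix.fromBlocks
      (Matrix.of fun p i => bilinFeature W₀ W₁ (x (Sum.inl i)) p)
      (Matrix.of fun p _ => bilinFeature W₀ W₁ (x (Sum.inr ())) p)
      (Matrix.of fun _ i => target w (x (Sum.inl i))) 0 := by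
  have h : ∀ V : Matrix (Idx d) (Idx d) ℝ,
      padWeight V * prompt x w = Matrix.fromBlocks
        (Matrix.of fun p i => V.mulVec (embed (x (Sum.inl i))) p)
        (Matrix.of fun p _ => V.mulVec (embed (x (Sum.inr ()))) p) 0 0 := by
    intro V
    rw [prompt, padWeight, Matrix.fromBlocks_multiply]
    simp only [Matrix.zero_mul, Matrix.mul_zero, add_zero]
    rfl
  rw [bilin, h, h]
  ext r c
  rcases r with p | u <;> rcases c with i | v <;> simp [prompt, bilinFeature]

/-- The second moment matrix `𝔼[x̃ x̃ᵀ]` of a feature map under a standard Gaussian input. -/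
def secondMoment {d : ℕ} (φ : (Fin d → ℝ) → Idx d → ℝ) : Matrix (Idx d) (Idx d) ℝ :=
  Matrix.of fun p q => ∫ x, φ x p * φ x q ∂(Measure.pi fun _ => gaussianReal 0 1)

/-- The empirical Gram matrix `∑ᵢ x̃ᵢ x̃ᵢᵀ` of the examples. -/
def gram {d n : ℕ} (φ : (Fin d → ℝ) → Idx d → ℝ) (x : Col n → Fin d → ℝ) :
    Matrix (Idx d) (Idx d) ℝ :=
  ∑ i : Fin n, Matrix.vecMulVec (φ (x (Sum.inl i))) (φ (x (Sum.inl i)))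

/-- The ordinary least squares coefficients `(∑ᵢ x̃ᵢ x̃ᵢᵀ)⁻¹ ∑ᵢ yᵢ x̃ᵢ`. -/
def olsCoeff {d n : ℕ} (φ : (Fin d → ℝ) → Idx d → ℝ) (x : Col n → Fin d → ℝ) (w : Idx d → ℝ) :
    Idx d → ℝ :=
  (gram φ x)⁻¹.mulVec (∑ i : Fin n, target w (x (Sum.inl i)) • φ (x (Sum.inl i)))

/-- The ordinary least squares prediction at the query. -/
def olsPrediction {d n : ℕ} (φ : (Fin d → ℝ) → Idx d → ℝ) (x : Col n → Fin d → ℝ)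
    (w : Idx d → ℝ) : ℝ :=
  dotProduct (olsCoeff φ x w) (φ (x (Sum.inr ())))

/-- The Frobenius norm. -/
def frob {d : ℕ} (A : Matrix (Idx d) (Idx d) ℝ) : ℝ := √(∑ p, ∑ q, A p q ^ 2)

end

end QuadICL

namespace QuadICL

noncomputable section

/-! Every row of the bilinear layer is a coordinate of the embedding plus a product of two linear
forms in `(1, x)`, so the features are always `M v` with `M = featureMat W₀ W₁`. The error `ŷ +
y_query` splits into a part odd in the coefficients `w` (`oddPart`) and a part even in `w`
(`evenPart`). The law of `w` is symmetric, so the cross term vanishes and `loss_eq` gives the loss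
as `popLoss B + 𝔼[even²]`. Here `B = effective M P Q` is the matrix of the odd part in the
orthonormal features.

Let `A = monoMat d` express the monomials in these features. Expanding in the orthonormal `w` and in
the orthonormal features of the query leaves one empirical mean per entry. Its squared bias and its
variance add up to `popLoss B = ‖A(B + 1)‖² + tr(Bᵀ T B)`, where `T = excess d n` is positive
semidefinite because it collects variances (`integral_oddPart_sq`). This is a strictly convex
quadratic with Hessian matrix `H = AᵀA + T`. Its minimiser is `B⋆ = optimum d n = -H⁻¹AᵀA`, and `B⋆
+ 1 = H⁻¹T`.

All dimension dependence comes from the entries of `T`. With `θ` of order `d²/n`, the diagonal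
entries are at most `θ`. The off-diagonal ones vanish by parity unless both indices are pairs `(i,
i)`, and are then at most `θ/d`. Since `|z|² ≤ 3d |Az|²`, an energy estimate on the roughly `d`
coupled columns gives `‖B⋆ + 1‖ ≤ 8dθ`, of order `d³/n`, hence at most of order `d^{3/2}/√n` when
`n` dominates `d³`.

In the first stage the even part is zero and `B = MᵀΓ₀M` is symmetric. Every diagonal feature matrix
can be implemented, so a minimiser does at least as well as the best diagonal `-diag(h)`. The
first-order gap at `-diag(h)` then forces `-B` within `25dθ` of `diag(h)` (`frobSq_sub_diagOpt_le`),
which in turn lies within `θ` of the identity entrywise. Hence `-B ≥ 1/2`, which makes `M`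
invertible and bounds `M⁻¹` through `‖Γ₀‖`. No further description of the minimiser is needed.
Existence follows by compactness: the loss controls `M` because the entries of `Γ₀` all have the
same strict sign, and two factors of a product can be rescaled to equal length.

In the second stage invertibility of `M` makes `B⋆` attainable with zero even part. Every minimiser
therefore has `B = B⋆` and an even part that vanishes identically, and the sparsity of `P` and `Q`
follows (`IsStageTwo.structure`). The loss is at most `popLoss (-1) = tr T`, of order `1/n` for
fixed `d`. The labels are noiseless and linear in the features, so least squares almost surely
returns the query label, and its distance to `-ŷ` in mean square is the loss itself. -/

/-! ### Functions with finite moments of all orders -/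

/-- A function all of whose absolute moments are finite. -/
def HasMoments {Ω : Type*} [MeasurableSpace Ω] (f : Ω → ℝ) (μ : Measure Ω) : Prop :=
  AEStronglyMeasurable f μ ∧ ∀ k : ℕ, Integrable (fun x => |f x| ^ k) μ

namespace HasMoments

variable {Ω Ω' : Type*} [MeasurableSpace Ω] [MeasurableSpace Ω'] {μ : Measure Ω} {ν : Measure Ω'}
  {f g : Ω → ℝ}

theorem integrable (hf : HasMoments f μ) : Integrable f μ := by
  have := hf.2 1
  simp only [pow_one] at this
  exact (integrable_norm_iff hf.1).1 (by simpa using this)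

theorem const [IsFiniteMeasure μ] (c : ℝ) : HasMoments (fun _ => c) μ :=
  ⟨aestronglyMeasurable_const, fun _ => integrable_const _⟩

theorem add (hf : HasMoments f μ) (hg : HasMoments g μ) : HasMoments (fun x => f x + g x) μ := by
  refine ⟨hf.1.add hg.1, fun k => ?_⟩
  refine (((hf.2 k).add (hg.2 k)).const_mul (2 ^ k)).mono' ?_ (ae_of_all _ fun x => ?_)
  · exact ((hf.1.add hg.1).norm.pow k)
  · simp only [norm_pow, Real.norm_eq_abs, abs_abs, Pi.add_apply]
    have h0 := abs_nonneg (f x)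
    have h1 := abs_nonneg (g x)
    calc |f x + g x| ^ k ≤ (2 * max |f x| |g x|) ^ k := by
          gcongr
          have := abs_add_le (f x) (g x)
          have := le_max_left |f x| |g x|
          have := le_max_right |f x| |g x|
          linarith
      _ = 2 ^ k * max |f x| |g x| ^ k := mul_pow _ _ _
      _ ≤ 2 ^ k * (|f x| ^ k + |g x| ^ k) := by
          gcongr
          rcases le_total |f x| |g x| with h | h
          · rw [max_eq_right h]; linarith [pow_nonneg h0 k]
          · rw [max_eq_left h]; linarith [pow_nonneg h1 k]

theorem mul (hf : HasMoments f μ) (hg : HasMoments g μ) : HasMoments (fun x => f x * g x) μ := by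
  refine ⟨hf.1.mul hg.1, fun k => ?_⟩
  refine ((hf.2 (2 * k)).add (hg.2 (2 * k))).mono' ((hf.1.mul hg.1).norm.pow k)
    (ae_of_all _ fun x => ?_)
  simp only [norm_pow, Real.norm_eq_abs, abs_abs, Pi.add_apply]
  rw [abs_mul, mul_pow, pow_mul', pow_mul']
  -- Arithmetic–geometric mean inequality for `|f|^k` and `|g|^k`.
  nlinarith [sq_nonneg (|f x| ^ k - |g x| ^ k), sq_nonneg (|f x| ^ k + |g x| ^ k)]

theorem const_mul [IsFiniteMeasure μ] (c : ℝ) (hf : HasMoments f μ) :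
    HasMoments (fun x => c * f x) μ := (HasMoments.const c).mul hf

theorem sum [IsFiniteMeasure μ] {ι : Type*} {s : Finset ι} {F : ι → Ω → ℝ}
    (h : ∀ i ∈ s, HasMoments (F i) μ) : HasMoments (fun x => ∑ i ∈ s, F i x) μ := by
  classical
  induction s using Finset.induction_on with
  | empty => simpa using HasMoments.const 0
  | insert a s ha ih =>
    simp only [Finset.sum_insert ha]
    exact (h _ (Finset.mem_insert_self _ _)).add
      (ih fun i hi => h i (Finset.mem_insert_of_mem hi))

theorem prod [IsFiniteMeasure μ] {ι : Type*} {s : Finset ι} {F : ι → Ω → ℝ}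
    (h : ∀ i ∈ s, HasMoments (F i) μ) : HasMoments (fun x => ∏ i ∈ s, F i x) μ := by
  classical
  induction s using Finset.induction_on with
  | empty => simpa using HasMoments.const 1
  | insert a s ha ih =>
    simp only [Finset.prod_insert ha]
    exact (h _ (Finset.mem_insert_self _ _)).mul
      (ih fun i hi => h i (Finset.mem_insert_of_mem hi))

theorem pow [IsFiniteMeasure μ] (hf : HasMoments f μ) (k : ℕ) :
    HasMoments (fun x => f x ^ k) μ := by
  induction k with
  | zero => simpa using HasMoments.const 1
  | succ k ih => simpa only [pow_succ] using ih.mul hf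

theorem comp {φ : Ω' → Ω} (hf : HasMoments f μ) (hφ : MeasurePreserving φ ν μ) :
    HasMoments (fun x => f (φ x)) ν :=
  ⟨hf.1.comp_measurePreserving hφ, fun k => (hφ.integrable_comp (hf.2 k).1).2 (hf.2 k)⟩

theorem memLp_two [IsFiniteMeasure μ] (hf : HasMoments f μ) : MemLp f 2 μ :=
  (memLp_two_iff_integrable_sq hf.1).2 (hf.pow 2).integrable

end HasMoments

/-! ### One-dimensional Gaussian moments -/

/-- The standard Gaussian on the line. -/
abbrev stdG : Measure ℝ := gaussianReal 0 1

theorem hasMoments_id : HasMoments (fun t : ℝ => t) stdG := by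
  refine ⟨aestronglyMeasurable_id, fun k => ?_⟩
  have h := (memLp_id_gaussianReal (μ := 0) (v := 1) (k : NNReal)).integrable_norm_pow' 
  simpa using h

theorem integral_odd {f : ℝ → ℝ} (hf : ∀ t, f (-t) = -f t) : ∫ t, f t ∂stdG = 0 := by
  have h : MeasurePreserving (fun x : ℝ => -x) stdG stdG :=
    ⟨measurable_neg, by rw [gaussianReal_map_neg, neg_zero]⟩
  have h2 := h.integral_comp (MeasurableEquiv.neg ℝ).measurableEmbedding f
  simp only [hf, integral_neg] at h2
  linarith

theorem integral_sq_stdG : ∫ t, t ^ 2 ∂stdG = 1 := by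
  have h := variance_fun_id_gaussianReal (μ := 0) (v := 1)
  rw [variance_eq_integral (by fun_prop)] at h
  simpa [integral_id_gaussianReal] using h

/-- The fourth moment is the fourth derivative at `0` of the moment generating function `exp (t² /
2)`; each derivative is this exponential times an explicit polynomial. -/
theorem integral_pow_four_stdG : ∫ t, t ^ 4 ∂stdG = 3 := by
  have h := iteratedDeriv_mgf_zero (X := fun t : ℝ => t) (μ := stdG)
    (by rw [integrableExpSet_fun_id_gaussianReal]; simp) 4
  have e : mgf (fun t : ℝ => t) stdG = fun t => Real.exp (t ^ 2 / 2) := by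
    rw [mgf_fun_id_gaussianReal]; simp
  have d0 : ∀ t : ℝ, HasDerivAt (fun t : ℝ => Real.exp (t ^ 2 / 2)) (Real.exp (t ^ 2 / 2) * t) t := by
    intro t
    have := ((hasDerivAt_pow 2 t).div_const 2).exp
    convert this using 1
    simp
  have dp : ∀ (p : ℝ → ℝ) (p' : ℝ → ℝ), (∀ t, HasDerivAt p (p' t) t) →
      deriv (fun t : ℝ => Real.exp (t ^ 2 / 2) * p t)
        = fun t => Real.exp (t ^ 2 / 2) * (t * p t + p' t) := by
    intro p p' hp
    funext t
    rw [((d0 t).fun_mul (hp t)).deriv]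
    ring
  have h1 : deriv (fun t : ℝ => Real.exp (t ^ 2 / 2)) = fun t => Real.exp (t ^ 2 / 2) * t := by
    funext t; exact (d0 t).deriv
  have h2 := dp (fun t => t) (fun _ => 1) (fun t => hasDerivAt_id t)
  have h3 := dp (fun t => t * t + 1) (fun t => 1 * t + t * 1)
    (fun t => ((hasDerivAt_id t).mul (hasDerivAt_id t)).add_const 1)
  have h4 := dp (fun t => t * (t * t + 1) + (1 * t + t * 1))
    (fun t => (1 * (t * t + 1) + t * (1 * t + t * 1)) + (1 * 1 + 1 * 1))
    (fun t => ((hasDerivAt_id t).mul (((hasDerivAt_id t).mul (hasDerivAt_id t)).add_const 1)).add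
      (((hasDerivAt_id t).const_mul 1).add ((hasDerivAt_id t).mul_const 1)))
  rw [e] at h
  simp only [iteratedDeriv_succ, iteratedDeriv_zero, h1, h2, h3, h4] at h
  rw [show (∫ t, t ^ 4 ∂stdG) = ∫ t, ((fun t : ℝ => t) ^ 4) t ∂stdG from rfl, ← h]
  norm_num

/-- The normalised Hermite polynomials of degree `0`, `1`, `2`. -/
def herm (k : ℕ) (t : ℝ) : ℝ := if k = 0 then 1 else if k = 1 then t else (t ^ 2 - 1) / √2

@[simp] theorem herm_zero (t : ℝ) : herm 0 t = 1 := by simp [herm]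
@[simp] theorem herm_one (t : ℝ) : herm 1 t = t := by simp [herm]
@[simp] theorem herm_two (t : ℝ) : herm 2 t = (t ^ 2 - 1) / √2 := by simp [herm]

theorem hasMoments_herm (k : ℕ) : HasMoments (herm k) stdG := by
  unfold herm
  split_ifs
  · exact HasMoments.const 1
  · exact hasMoments_id
  · have := (((hasMoments_id.pow 2).add (HasMoments.const (-1)))).mul (HasMoments.const (√2)⁻¹)
    simpa [div_eq_mul_inv, sub_eq_add_neg] using this

/-- The one-dimensional moments entering the products of features. -/
def hermMoment (a b k : ℕ) : ℝ := ∫ t, herm a t * herm b t * t ^ (2 * k) ∂stdG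

theorem hermMoment_comm (a b k : ℕ) : hermMoment a b k = hermMoment b a k := by
  simp [hermMoment, mul_comm]

theorem hermMoment_self {a : ℕ} (ha : a ≤ 2) : hermMoment a a 0 = 1 := by
  have h2 : √2 * √2 = (2 : ℝ) := Real.mul_self_sqrt (by norm_num)
  interval_cases a
  · simp [hermMoment]
  · simp only [hermMoment, herm_one, mul_zero, pow_zero, mul_one, ← sq, integral_sq_stdG]
  · have e : ∀ t : ℝ, herm 2 t * herm 2 t * t ^ (2 * 0) = 2⁻¹ * (t ^ 4 + ((-2) * t ^ 2 + 1)) := by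
      intro t
      simp only [herm_two, mul_zero, pow_zero, mul_one, div_mul_div_comm, h2]
      ring
    simp only [hermMoment, e]
    rw [integral_const_mul, integral_add, integral_add, integral_const_mul, integral_sq_stdG,
      integral_pow_four_stdG]
    · norm_num
    · exact ((hasMoments_id.pow 2).const_mul _).integrable
    · exact integrable_const _
    · exact (hasMoments_id.pow 4).integrable
    · exact (((hasMoments_id.pow 2).const_mul _).add (HasMoments.const 1)).integrable

theorem hermMoment_one_left {b : ℕ} (hb : b ≤ 2) (hb1 : b ≠ 1) (k : ℕ) : hermMoment 1 b k = 0 := by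
  apply integral_odd
  intro t
  have : b = 0 ∨ b = 2 := by omega
  rcases this with rfl | rfl <;> simp [pow_mul]

theorem hermMoment_two_zero : hermMoment 2 0 0 = 0 := by
  simp only [hermMoment, herm_two, herm_zero, mul_one, mul_zero, pow_zero]
  rw [integral_div, integral_sub, integral_sq_stdG]
  · simp
  · exact (hasMoments_id.pow 2).integrable
  · exact integrable_const _

theorem hermMoment_ne {a b : ℕ} (ha : a ≤ 2) (hb : b ≤ 2) (hab : a ≠ b) :
    hermMoment a b 0 = 0 := by
  by_cases h1 : a = 1
  · subst h1; exact hermMoment_one_left hb (Ne.symm hab) 0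
  by_cases h2 : b = 1
  · subst h2; rw [hermMoment_comm]; exact hermMoment_one_left ha hab 0
  have : (a = 2 ∧ b = 0) ∨ (a = 0 ∧ b = 2) := by omega
  rcases this with ⟨rfl, rfl⟩ | ⟨rfl, rfl⟩
  · exact hermMoment_two_zero
  · rw [hermMoment_comm]; exact hermMoment_two_zero

/-- A bound for all the one-dimensional moments. -/
def momentBound : ℝ :=
  1 + ∑ a ∈ Finset.range 3, ∑ b ∈ Finset.range 3, ∑ k ∈ Finset.range 3, |hermMoment a b k|

theorem one_le_momentBound : 1 ≤ momentBound := by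
  unfold momentBound
  have : 0 ≤ ∑ a ∈ Finset.range 3, ∑ b ∈ Finset.range 3, ∑ k ∈ Finset.range 3,
    |hermMoment a b k| := by positivity
  linarith

/-- The exponent makes the bound equal to `1` at coordinates not involved in any of the three
features. Products over all `d` coordinates thus stay bounded independently of `d`. -/
theorem abs_hermMoment_le {a b k : ℕ} (ha : a ≤ 2) (hb : b ≤ 2) (hk : k ≤ 2) :
    |hermMoment a b k| ≤ momentBound ^ (a + b + k) := by
  by_cases h0 : a + b + k = 0
  · have : a = 0 ∧ b = 0 ∧ k = 0 := by omega
    rcases this with ⟨rfl, rfl, rfl⟩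
    simp [hermMoment_self]
  have h1 : |hermMoment a b k| ≤ momentBound := by
    unfold momentBound
    have e1 : |hermMoment a b k| ≤ ∑ k ∈ Finset.range 3, |hermMoment a b k| :=
      Finset.single_le_sum (f := fun k => |hermMoment a b k|) (fun _ _ => abs_nonneg _)
        (Finset.mem_range.2 (by omega))
    have e2 : ∑ k ∈ Finset.range 3, |hermMoment a b k| ≤
        ∑ b ∈ Finset.range 3, ∑ k ∈ Finset.range 3, |hermMoment a b k| :=
      Finset.single_le_sum (f := fun b => ∑ k ∈ Finset.range 3, |hermMoment a b k|)
        (fun _ _ => by positivity) (Finset.mem_range.2 (by omega))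
    have e3 : ∑ b ∈ Finset.range 3, ∑ k ∈ Finset.range 3, |hermMoment a b k| ≤
        ∑ a ∈ Finset.range 3, ∑ b ∈ Finset.range 3, ∑ k ∈ Finset.range 3, |hermMoment a b k| :=
      Finset.single_le_sum
        (f := fun a => ∑ b ∈ Finset.range 3, ∑ k ∈ Finset.range 3, |hermMoment a b k|)
        (fun _ _ => by positivity) (Finset.mem_range.2 (by omega))
    linarith
  exact h1.trans (le_self_pow₀ one_le_momentBound h0)

/-! ### The features as products of Hermite polynomials -/

/-- The standard Gaussian on the input space. -/
abbrev inputLaw (d : ℕ) : Measure (Fin d → ℝ) := Measure.pi fun _ => stdG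

/-- The number of occurrences of the coordinate `c` in the index pair `p`. -/
def mult {d : ℕ} (p : Idx d) (c : Fin (d + 1)) : ℕ :=
  (if p.1.1 = c then 1 else 0) + (if p.1.2 = c then 1 else 0)

/-- The monomial `h i * h j` belonging to the index pair `(i, j)`. -/
def mono {d : ℕ} (x : Fin d → ℝ) (p : Idx d) : ℝ := homog x p.1.1 * homog x p.1.2

/-- The index pair of the constant feature. -/
def origin (d : ℕ) : Idx d := ⟨(0, 0), le_rfl⟩

/-- The index pairs `(i, i)` with `1 ≤ i`. -/
def IsDiag {d : ℕ} (p : Idx d) : Prop := p.1.1 = p.1.2 ∧ p.1.1 ≠ 0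

instance {d : ℕ} (p : Idx d) : Decidable (IsDiag p) := inferInstanceAs (Decidable (_ ∧ _))

theorem mult_le_two {d : ℕ} (p : Idx d) (c : Fin (d + 1)) : mult p c ≤ 2 := by
  unfold mult; split_ifs <;> simp

theorem sum_mult_le {d : ℕ} (p : Idx d) : ∑ c : Fin d, mult p c.succ ≤ 2 := by
  have h : ∑ c : Fin (d + 1), mult p c = 2 := by
    simp [mult, Finset.sum_add_distrib]
  rw [Fin.sum_univ_succ] at h
  omega

/-- The multiplicities over `0, …, d` sum to `2`, so those at the positive coordinates determine the
one at `0`, and with it the pair. -/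
theorem exists_mult_ne {d : ℕ} {p q : Idx d} (h : p ≠ q) :
    ∃ c : Fin d, mult p c.succ ≠ mult q c.succ := by
  suffices H : ∃ c : Fin (d + 1), c ≠ 0 ∧ mult p c ≠ mult q c by
    obtain ⟨c, hc, H⟩ := H
    obtain ⟨k, rfl⟩ := Fin.exists_succ_eq.2 hc
    exact ⟨k, H⟩
  obtain ⟨⟨i, j⟩, hij⟩ := p
  obtain ⟨⟨k, l⟩, hkl⟩ := q
  have h' : ¬ (i = k ∧ j = l) := fun e => h (by simp [e.1, e.2])
  simp only [mult]
  rcases lt_trichotomy j l with hjl | hjl | hjl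
  · exact ⟨l, by grind, by grind⟩
  · rcases lt_trichotomy i k with hik | hik | hik
    · exact ⟨k, by grind, by grind⟩
    · grind
    · exact ⟨i, by grind, by grind⟩
  · exact ⟨j, by grind, by grind⟩

/-- Multiplicities are at most `2`, so being different from `1` means being even. If the parities
agreed at all positive coordinates, they would agree at `0` too, the total being `2`; and an
off-diagonal pair is the set of its odd coordinates. -/
theorem exists_mult_odd {d : ℕ} {p q : Idx d} (h : p ≠ q) (hp : p.1.1 ≠ p.1.2) :
    ∃ c : Fin d, (mult p c.succ = 1 ∧ mult q c.succ ≠ 1) ∨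
      (mult p c.succ ≠ 1 ∧ mult q c.succ = 1) := by
  suffices H : ∃ c : Fin (d + 1), c ≠ 0 ∧ ((mult p c = 1 ∧ mult q c ≠ 1) ∨
      (mult p c ≠ 1 ∧ mult q c = 1)) by
    obtain ⟨c, hc, H⟩ := H
    obtain ⟨k, rfl⟩ := Fin.exists_succ_eq.2 hc
    exact ⟨k, H⟩
  obtain ⟨⟨i, j⟩, hij⟩ := p
  obtain ⟨⟨k, l⟩, hkl⟩ := q
  have h' : ¬ (i = k ∧ j = l) := fun e => h (by simp [e.1, e.2])
  simp only [mult]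
  simp only at hp hij hkl
  rcases lt_trichotomy j l with hjl | hjl | hjl
  · by_cases hkl' : k = l
    · exact ⟨j, by grind, by grind⟩
    · exact ⟨l, by grind, by grind⟩
  · by_cases hkj : k = j
    · exact ⟨j, by grind, by grind⟩
    · rcases lt_trichotomy i k with hik | hik | hik
      · exact ⟨k, by grind, by grind⟩
      · grind
      · exact ⟨i, by grind, by grind⟩
  · exact ⟨j, by grind, by grind⟩

theorem homog_eq_prod {d : ℕ} (x : Fin d → ℝ) (i : Fin (d + 1)) :
    homog x i = ∏ c : Fin d, x c ^ (if i = c.succ then 1 else 0) := by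
  refine Fin.cases ?_ (fun k => ?_) i
  · simp [homog, (Fin.succ_ne_zero _).symm]
  · simp [homog, Finset.prod_ite_eq, pow_ite]

theorem mono_eq_prod {d : ℕ} (x : Fin d → ℝ) (p : Idx d) :
    mono x p = ∏ c : Fin d, x c ^ mult p c.succ := by
  simp only [mono, homog_eq_prod, mult, pow_add, Finset.prod_mul_distrib]

theorem basisFeature_eq_prod {d : ℕ} (x : Fin d → ℝ) (p : Idx d) :
    basisFeature x p = ∏ c : Fin d, herm (mult p c.succ) (x c) := by
  by_cases h : p.1.1 = p.1.2 ∧ p.1.1 ≠ 0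
  · rw [basisFeature, if_pos h]
    obtain ⟨k, hk⟩ := Fin.exists_succ_eq.2 h.2
    rw [Finset.prod_eq_single k]
    · simp [mult, ← h.1, ← hk, homog]
    · intro b _ hb
      have : k ≠ b := fun h => hb h.symm
      simp [mult, ← h.1, ← hk, this]
    · simp
  · rw [basisFeature, if_neg h]
    change mono x p = _
    rw [mono_eq_prod]
    refine Finset.prod_congr rfl fun c _ => ?_
    have : mult p c.succ = 0 ∨ mult p c.succ = 1 := by
      unfold mult
      split_ifs with h1 h2
      · exact absurd ⟨h1.trans h2.symm, h1 ▸ Fin.succ_ne_zero c⟩ h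
      all_goals simp
    rcases this with h | h <;> simp [h]

theorem hasMoments_coord {d : ℕ} (c : Fin d) :
    HasMoments (fun x : Fin d → ℝ => x c) (inputLaw d) :=
  hasMoments_id.comp (measurePreserving_eval _ c)

theorem hasMoments_basisFeature {d : ℕ} (p : Idx d) :
    HasMoments (fun x : Fin d → ℝ => basisFeature x p) (inputLaw d) := by
  simp only [basisFeature_eq_prod]
  exact HasMoments.prod fun c _ => (hasMoments_herm _).comp (measurePreserving_eval _ c)

theorem hasMoments_mono {d : ℕ} (p : Idx d) :
    HasMoments (fun x : Fin d → ℝ => mono x p) (inputLaw d) := by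
  simp only [mono_eq_prod]
  exact HasMoments.prod fun c _ => (hasMoments_coord c).pow _

theorem integral_features {d : ℕ} (p q r : Idx d) :
    ∫ x, basisFeature x p * basisFeature x q * mono x r ^ 2 ∂inputLaw d
      = ∏ c : Fin d, hermMoment (mult p c.succ) (mult q c.succ) (mult r c.succ) := by
  simp only [basisFeature_eq_prod, mono_eq_prod, ← Finset.prod_mul_distrib, ← Finset.prod_pow,
    ← pow_mul, mul_comm _ 2]
  exact integral_fintype_prod_eq_prod
    (f := fun (c : Fin d) (t : ℝ) => herm (mult p c.succ) t * herm (mult q c.succ) t * t ^ (2 * mult r c.succ))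

theorem integral_basisFeature {d : ℕ} (p q : Idx d) :
    ∫ x, basisFeature x p * basisFeature x q ∂inputLaw d = if p = q then 1 else 0 := by
  have h := integral_features p q (origin d)
  have h0 : ∀ c : Fin d, mult (origin d) c.succ = 0 := by
    intro c; simp [mult, origin, (Fin.succ_ne_zero _).symm]
  have h1 : ∀ x : Fin d → ℝ, mono x (origin d) = 1 := by
    intro x; simp [mono, origin, homog]
  simp only [h0, h1, one_pow, mul_one] at h
  rw [h]
  split_ifs with hpq
  · subst hpq
    exact Finset.prod_eq_one fun c _ => hermMoment_self (mult_le_two _ _)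
  · obtain ⟨c, hc⟩ := exists_mult_ne hpq
    exact Finset.prod_eq_zero (Finset.mem_univ c)
      (hermMoment_ne (mult_le_two _ _) (mult_le_two _ _) hc)

theorem integral_features_eq_zero_of_odd {d : ℕ} {p q : Idx d} (r : Idx d) (h : p ≠ q)
    (hp : p.1.1 ≠ p.1.2) :
    ∫ x, basisFeature x p * basisFeature x q * mono x r ^ 2 ∂inputLaw d = 0 := by
  rw [integral_features]
  obtain ⟨c, hc⟩ := exists_mult_odd h hp
  refine Finset.prod_eq_zero (Finset.mem_univ c) ?_
  rcases hc with ⟨h1, h2⟩ | ⟨h1, h2⟩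
  · rw [h1]; exact hermMoment_one_left (mult_le_two _ _) h2 _
  · rw [h2, hermMoment_comm]; exact hermMoment_one_left (mult_le_two _ _) h1 _

/-- When `r` avoids the coordinate of `p`, that coordinate contributes `∫ h₂ h₀ = 0`. Only about `d`
of the roughly `d²` monomials survive, which gains a factor `d` for the off-diagonal entries of
`weightedMoment`. -/
theorem integral_features_eq_zero_of_mult {d : ℕ} {p q : Idx d} (r : Idx d) (h : p ≠ q)
    (hp : IsDiag p) (hq : q.1.1 = q.1.2) (hr : mult r p.1.1 = 0) :
    ∫ x, basisFeature x p * basisFeature x q * mono x r ^ 2 ∂inputLaw d = 0 := by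
  rw [integral_features]
  obtain ⟨c, hc⟩ := Fin.exists_succ_eq.2 hp.2
  refine Finset.prod_eq_zero (Finset.mem_univ c) ?_
  have e1 : mult p c.succ = 2 := by simp [mult, ← hp.1, hc]
  have hne : q.1.1 ≠ p.1.1 := by
    intro e
    apply h
    ext1
    exact Prod.ext e.symm (by rw [← hp.1, ← hq, e])
  have e2 : mult q c.succ = 0 := by simp [mult, ← hq, hc, hne]
  rw [← hc] at hr
  rw [e1, e2, hr, hermMoment_two_zero]

/-- The exponents add up over the coordinates to at most `2 + 2 + 2`, whatever the dimension. -/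
theorem abs_integral_features_le {d : ℕ} (p q r : Idx d) :
    |∫ x, basisFeature x p * basisFeature x q * mono x r ^ 2 ∂inputLaw d| ≤ momentBound ^ 6 := by
  rw [integral_features, Finset.abs_prod]
  calc ∏ c : Fin d, |hermMoment (mult p c.succ) (mult q c.succ) (mult r c.succ)|
      ≤ ∏ c : Fin d, momentBound ^ (mult p c.succ + mult q c.succ + mult r c.succ) :=
        Finset.prod_le_prod (fun _ _ => abs_nonneg _) fun c _ =>
          abs_hermMoment_le (mult_le_two _ _) (mult_le_two _ _) (mult_le_two _ _)
    _ = momentBound ^ (∑ c : Fin d, (mult p c.succ + mult q c.succ + mult r c.succ)) :=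
        Finset.prod_pow_eq_pow_sum _ _ _
    _ ≤ momentBound ^ 6 := by
        refine pow_le_pow_right₀ one_le_momentBound ?_
        simp only [Finset.sum_add_distrib]
        have := sum_mult_le p
        have := sum_mult_le q
        have := sum_mult_le r
        omega

/-! ### The change of basis from the orthonormal features to the monomials -/

/-- The matrix expressing the monomials through the orthonormal features. -/
def monoMat (d : ℕ) : Matrix (Idx d) (Idx d) ℝ := Matrix.of fun p q =>
  if IsDiag p then (if q = p then √2 else 0) + (if q = origin d then 1 else 0)
  else if q = p then 1 else 0

theorem monoMat_mulVec_of_isDiag {d : ℕ} {p : Idx d} (hp : IsDiag p) (z : Idx d → ℝ) :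
    (monoMat d).mulVec z p = √2 * z p + z (origin d) := by
  simp [Matrix.mulVec, dotProduct, monoMat, hp, add_mul, Finset.sum_add_distrib]

theorem monoMat_mulVec_of_not_isDiag {d : ℕ} {p : Idx d} (hp : ¬ IsDiag p) (z : Idx d → ℝ) :
    (monoMat d).mulVec z p = z p := by
  simp [Matrix.mulVec, dotProduct, monoMat, hp]

theorem monoMat_mulVec_basisFeature {d : ℕ} (x : Fin d → ℝ) :
    (monoMat d).mulVec (basisFeature x) = mono x := by
  funext p
  by_cases hp : IsDiag p
  · rw [monoMat_mulVec_of_isDiag hp]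
    have hp' : p.1.1 = p.1.2 ∧ p.1.1 ≠ 0 := hp
    have h2 : √2 ≠ 0 := by positivity
    simp only [basisFeature, if_pos hp', mono, origin]
    simp only [ne_eq, not_true_eq_false, and_false, if_false, ← hp.1]
    simp only [homog, Fin.cons_zero]
    field_simp
    ring
  · rw [monoMat_mulVec_of_not_isDiag hp]
    have hp' : ¬ (p.1.1 = p.1.2 ∧ p.1.1 ≠ 0) := hp
    simp only [basisFeature, if_neg hp', mono]

theorem not_isDiag_origin (d : ℕ) : ¬ IsDiag (origin d) := fun h => h.2 rfl

theorem integral_mono_mul_basisFeature {d : ℕ} (p q : Idx d) :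
    ∫ x, mono x p * basisFeature x q ∂inputLaw d = monoMat d p q := by
  simp only [← monoMat_mulVec_basisFeature, Matrix.mulVec, dotProduct, Finset.sum_mul, mul_assoc]
  rw [integral_finsetSum]
  · simp [integral_const_mul, integral_basisFeature]
  · intro r _
    exact (((hasMoments_basisFeature r).mul (hasMoments_basisFeature q)).const_mul _).integrable

/-! ### The covariance of the label-weighted features -/

/-- The matrix `∑ₚ 𝔼[mₚ² v vᵀ]`. -/
def weightedMoment (d : ℕ) : Matrix (Idx d) (Idx d) ℝ := Matrix.of fun q s =>
  ∑ r, ∫ x, basisFeature x q * basisFeature x s * mono x r ^ 2 ∂inputLaw d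

theorem weightedMoment_comm {d : ℕ} (q s : Idx d) :
    weightedMoment d q s = weightedMoment d s q := by
  simp only [weightedMoment, Matrix.of_apply, mul_comm (basisFeature _ q)]

theorem card_Idx_le {d : ℕ} (hd : 1 ≤ d) : (Fintype.card (Idx d) : ℝ) ≤ 3 * (d : ℝ) ^ 2 := by
  have h : Fintype.card (Idx d) ≤ 3 * d ^ 2 := by
    rw [card_Idx, Nat.choose_two_right]
    simp only [show d + 2 - 1 = d + 1 by omega]
    apply Nat.div_le_of_le_mul
    nlinarith
  exact_mod_cast h

/-- A pair containing `c` is determined by its other member. -/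
theorem card_mult_ne_zero_le {d : ℕ} (c : Fin (d + 1)) :
    (Finset.univ.filter fun r : Idx d => mult r c ≠ 0).card ≤ d + 1 := by
  have h := Finset.card_le_card_of_injOn
    (s := Finset.univ.filter fun r : Idx d => mult r c ≠ 0) (t := (Finset.univ : Finset (Fin (d + 1))))
    (fun r => if r.1.1 = c then r.1.2 else r.1.1) (fun _ _ => Finset.mem_univ _) ?_
  · simpa using h
  · rintro ⟨⟨i, j⟩, hij⟩ hp ⟨⟨k, l⟩, hkl⟩ hq h
    have hp' := (Finset.mem_filter.1 hp).2
    have hq' := (Finset.mem_filter.1 hq).2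
    simp only [mult] at hp' hq' h hij hkl
    simp only [Subtype.mk.injEq, Prod.mk.injEq]
    grind

theorem abs_weightedMoment_le {d : ℕ} (hd : 1 ≤ d) (q s : Idx d) :
    |weightedMoment d q s| ≤ 3 * momentBound ^ 6 * (d : ℝ) ^ 2 := by
  calc |weightedMoment d q s| ≤ ∑ _r : Idx d, momentBound ^ 6 :=
        (Finset.abs_sum_le_sum_abs _ _).trans
          (Finset.sum_le_sum fun r _ => abs_integral_features_le q s r)
    _ = Fintype.card (Idx d) * momentBound ^ 6 := by simp
    _ ≤ 3 * (d : ℝ) ^ 2 * momentBound ^ 6 := by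
        have := one_le_momentBound
        gcongr
        exact card_Idx_le hd
    _ = _ := by ring

theorem abs_weightedMoment_le_of_isDiag {d : ℕ} (hd : 1 ≤ d) {p q : Idx d} (h : p ≠ q)
    (hp : IsDiag p) (hq : q.1.1 = q.1.2) :
    |weightedMoment d p q| ≤ 2 * momentBound ^ 6 * (d : ℝ) := by
  have hm := one_le_momentBound
  calc |weightedMoment d p q|
      = |∑ r ∈ Finset.univ.filter (fun r : Idx d => mult r p.1.1 ≠ 0),
          ∫ x, basisFeature x p * basisFeature x q * mono x r ^ 2 ∂inputLaw d| := by
        rw [Finset.sum_filter_of_ne]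
        · rfl
        · intro r _ hr h0
          exact hr (integral_features_eq_zero_of_mult r h hp hq h0)
    _ ≤ ∑ _r ∈ Finset.univ.filter (fun r : Idx d => mult r p.1.1 ≠ 0), momentBound ^ 6 :=
        (Finset.abs_sum_le_sum_abs _ _).trans
          (Finset.sum_le_sum fun r _ => abs_integral_features_le p q r)
    _ = (Finset.univ.filter (fun r : Idx d => mult r p.1.1 ≠ 0)).card * momentBound ^ 6 := by simp
    _ ≤ (2 * d) * momentBound ^ 6 := by
        gcongr
        have h1 := card_mult_ne_zero_le p.1.1
        have h2 : (Finset.univ.filter (fun r : Idx d => mult r p.1.1 ≠ 0)).card ≤ 2 * d := by omega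
        exact_mod_cast h2
    _ = _ := by ring

theorem weightedMoment_eq_zero {d : ℕ} {p q : Idx d} (h : p ≠ q) (hp : p.1.1 ≠ p.1.2) :
    weightedMoment d p q = 0 :=
  Finset.sum_eq_zero fun r _ => integral_features_eq_zero_of_odd r h hp

/-! ### Second moments of linear statistics -/

/-- Expansion in an orthonormal system of the second factor of a product space. -/
theorem integral_sq_sum_mul_orthonormal {α β ι : Type*} [MeasurableSpace α] [MeasurableSpace β]
    [Fintype ι] [DecidableEq ι] {μ : Measure α} {ν : Measure β} [IsProbabilityMeasure μ]
    [IsProbabilityMeasure ν] {L : ι → α → ℝ} {e : ι → β → ℝ}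
    (hL : ∀ p, HasMoments (L p) μ) (he : ∀ p, HasMoments (e p) ν)
    (ho : ∀ p q, ∫ y, e p y * e q y ∂ν = if p = q then 1 else 0) :
    ∫ z, (∑ p, L p z.1 * e p z.2) ^ 2 ∂μ.prod ν = ∑ p, ∫ x, L p x ^ 2 ∂μ := by
  have h1 : ∀ z : α × β, (∑ p, L p z.1 * e p z.2) ^ 2
      = ∑ p, ∑ q, (L p z.1 * L q z.1) * (e p z.2 * e q z.2) := by
    intro z
    rw [sq, Finset.sum_mul_sum]
    exact Finset.sum_congr rfl fun p _ => Finset.sum_congr rfl fun q _ => by ring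
  simp only [h1]
  have hi : ∀ p q, Integrable (fun z : α × β => (L p z.1 * L q z.1) * (e p z.2 * e q z.2))
      (μ.prod ν) := fun p q =>
    ((hL p).mul (hL q)).integrable.mul_prod ((he p).mul (he q)).integrable
  rw [integral_finsetSum _ fun p _ => integrable_finsetSum _ fun q _ => hi p q]
  refine Finset.sum_congr rfl fun p _ => ?_
  rw [integral_finsetSum _ fun q _ => hi p q]
  have h2 : ∀ q, ∫ z : α × β, (L p z.1 * L q z.1) * (e p z.2 * e q z.2) ∂μ.prod ν
      = (∫ x, L p x * L q x ∂μ) * (if p = q then 1 else 0) := by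
    intro q
    rw [← ho p q]
    exact integral_prod_mul (fun x => L p x * L q x) (fun y => e p y * e q y)
  simp [h2, sq]

/-- Second moment of a shifted empirical mean of independent samples. -/
theorem integral_sq_empirical_mean {X : Type*} [MeasurableSpace X] {μ : Measure X}
    [IsProbabilityMeasure μ] {n : ℕ} (hn : 0 < n) {Y : X → ℝ} (hY : HasMoments Y μ) (k : ℝ) :
    ∫ x : Fin n → X, ((1 / (n : ℝ)) * ∑ i, Y (x i) + k) ^ 2 ∂(Measure.pi fun _ => μ)
      = (∫ t, Y t ∂μ + k) ^ 2 + (1 / (n : ℝ)) * (∫ t, Y t ^ 2 ∂μ - (∫ t, Y t ∂μ) ^ 2) := by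
  have hn' : (n : ℝ) ≠ 0 := by positivity
  have hmp : ∀ i : Fin n, MeasurePreserving (fun x : Fin n → X => x i)
    (Measure.pi fun _ => μ) μ := fun i => measurePreserving_eval _ i
  have hYi : ∀ i : Fin n, HasMoments (fun x : Fin n → X => Y (x i)) (Measure.pi fun _ => μ) :=
    fun i => hY.comp (hmp i)
  have hint : ∀ {f : X → ℝ} (_ : HasMoments f μ) (i : Fin n),
      ∫ x : Fin n → X, f (x i) ∂(Measure.pi fun _ => μ) = ∫ t, f t ∂μ := fun hf i =>
    integral_comp_eval (μ := fun _ : Fin n => μ) (i := i) hf.1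
  have hS : HasMoments (fun x : Fin n → X => ∑ i, Y (x i)) (Measure.pi fun _ => μ) :=
    HasMoments.sum fun i _ => hYi i
  have hmean : ∫ x : Fin n → X, ∑ i, Y (x i) ∂(Measure.pi fun _ => μ) = n * ∫ t, Y t ∂μ := by
    rw [integral_finsetSum _ fun i _ => (hYi i).integrable]
    simp [hint hY]
  have hvar : Var[fun x : Fin n → X => ∑ i, Y (x i); Measure.pi fun _ => μ]
      = n * (∫ t, Y t ^ 2 ∂μ - (∫ t, Y t ∂μ) ^ 2) := by
    have hind : iIndepFun (fun (i : Fin n) (x : Fin n → X) => Y (x i)) (Measure.pi fun _ => μ) :=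
      iIndepFun_pi (X := fun _ => Y) fun _ => hY.1.aemeasurable
    have h := IndepFun.variance_sum (μ := Measure.pi fun _ : Fin n => μ)
      (X := fun (i : Fin n) (x : Fin n → X) => Y (x i)) (s := Finset.univ)
      (fun i _ => (hYi i).memLp_two) (fun i _ j _ hij => hind.indepFun hij)
    have e : (∑ i : Fin n, fun x : Fin n → X => Y (x i)) = fun x => ∑ i, Y (x i) := by
      funext x; simp
    rw [e] at h
    rw [h]
    have h2 : ∀ i : Fin n, Var[fun x : Fin n → X => Y (x i); Measure.pi fun _ => μ]
        = ∫ t, Y t ^ 2 ∂μ - (∫ t, Y t ∂μ) ^ 2 := by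
      intro i
      rw [variance_eq_sub (hYi i).memLp_two, hint hY i]
      congr 1
      exact hint (hY.pow 2) i
    simp [h2, mul_sub]
  rw [variance_eq_sub hS.memLp_two, hmean] at hvar
  have hsq : ∫ x : Fin n → X, (∑ i, Y (x i)) ^ 2 ∂(Measure.pi fun _ => μ)
      = n * (∫ t, Y t ^ 2 ∂μ - (∫ t, Y t ∂μ) ^ 2) + (n * ∫ t, Y t ∂μ) ^ 2 := by
    rw [← hvar]; simp
  have hexp : ∀ x : Fin n → X, ((1 / (n : ℝ)) * ∑ i, Y (x i) + k) ^ 2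
      = (1 / (n : ℝ)) ^ 2 * (∑ i, Y (x i)) ^ 2 + (2 * k / n * ∑ i, Y (x i) + k ^ 2) := by
    intro x; field_simp; ring
  simp only [hexp]
  rw [integral_add ((hS.pow 2).const_mul _).integrable
      ((hS.const_mul _).add (HasMoments.const _)).integrable,
    integral_add (hS.const_mul _).integrable (integrable_const _), integral_const_mul,
    integral_const_mul, hsq, hmean]
  simp only [integral_const, probReal_univ, smul_eq_mul, one_mul]
  field_simp
  ring

/-! ### The population loss of the reduced predictor -/

open Matrix

/-- The sum of the squares of the entries. -/
def frobSq {ι κ : Type*} [Fintype ι] [Fintype κ] (X : Matrix ι κ ℝ) : ℝ := ∑ p, ∑ q, X p q ^ 2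

/-- The covariance correction `(K - AᵀA) / n`. -/
def excess (d n : ℕ) : Matrix (Idx d) (Idx d) ℝ :=
  (1 / (n : ℝ)) • (weightedMoment d - (monoMat d)ᵀ * monoMat d)

/-- The loss as a function of the matrix `Mᵀ Γ M` of the predictor in the orthonormal features. -/
def popLoss (d n : ℕ) (B : Matrix (Idx d) (Idx d) ℝ) : ℝ :=
  frobSq (monoMat d * (B + 1)) + trace (Bᵀ * excess d n * B)

/-- The quadratic form of the loss decouples over the columns of `B`. -/
theorem trace_transpose_mul_mul {ι : Type*} [Fintype ι] (B X : Matrix ι ι ℝ) :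
    trace (Bᵀ * X * B) = ∑ q, Bᵀ q ⬝ᵥ X *ᵥ Bᵀ q := by
  refine Finset.sum_congr rfl fun q _ => ?_
  rw [diag_apply, Matrix.mul_assoc]
  rfl

theorem hasMoments_dotProduct {d : ℕ} (z : Idx d → ℝ) :
    HasMoments (fun x : Fin d → ℝ => basisFeature x ⬝ᵥ z) (inputLaw d) :=
  HasMoments.sum fun p _ => (hasMoments_basisFeature p).mul (HasMoments.const _)

theorem integral_mono_mul_dotProduct {d : ℕ} (p : Idx d) (z : Idx d → ℝ) :
    ∫ x, mono x p * (basisFeature x ⬝ᵥ z) ∂inputLaw d = (monoMat d *ᵥ z) p := by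
  simp only [dotProduct, Finset.mul_sum, ← mul_assoc]
  rw [integral_finsetSum]
  · simp [integral_mul_const, integral_mono_mul_basisFeature, Matrix.mulVec, dotProduct]
  · intro q _
    exact (((hasMoments_mono p).mul (hasMoments_basisFeature q)).mul (HasMoments.const _)).integrable

theorem dotProduct_weightedMoment_mulVec {d : ℕ} (z : Idx d → ℝ) :
    z ⬝ᵥ weightedMoment d *ᵥ z
      = ∑ p, ∫ x, (mono x p * (basisFeature x ⬝ᵥ z)) ^ 2 ∂inputLaw d := by
  have hi : ∀ p r s, Integrable (fun x : Fin d → ℝ =>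
      (z r * z s) * (basisFeature x r * basisFeature x s * mono x p ^ 2)) (inputLaw d) :=
    fun p r s => ((((hasMoments_basisFeature r).mul (hasMoments_basisFeature s)).mul
      ((hasMoments_mono p).pow 2)).const_mul _).integrable
  have h : ∀ p, ∫ x, (mono x p * (basisFeature x ⬝ᵥ z)) ^ 2 ∂inputLaw d
      = ∑ r, ∑ s, (z r * z s) *
        ∫ x, basisFeature x r * basisFeature x s * mono x p ^ 2 ∂inputLaw d := by
    intro p
    have e : ∀ x : Fin d → ℝ, (mono x p * (basisFeature x ⬝ᵥ z)) ^ 2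
        = ∑ r, ∑ s, (z r * z s) * (basisFeature x r * basisFeature x s * mono x p ^ 2) := by
      intro x
      rw [mul_pow, sq (_ ⬝ᵥ _), dotProduct, Finset.sum_mul_sum, Finset.mul_sum]
      refine Finset.sum_congr rfl fun r _ => ?_
      rw [Finset.mul_sum]
      exact Finset.sum_congr rfl fun s _ => by ring
    simp only [e]
    rw [integral_finsetSum _ fun r _ => integrable_finsetSum _ fun s _ => hi p r s]
    refine Finset.sum_congr rfl fun r _ => ?_
    rw [integral_finsetSum _ fun s _ => hi p r s]
    simp [integral_const_mul]
  simp only [h]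
  rw [Finset.sum_comm]
  simp only [dotProduct, Matrix.mulVec, weightedMoment, Matrix.of_apply, Finset.mul_sum]
  refine Finset.sum_congr rfl fun r _ => ?_
  rw [Finset.sum_comm]
  refine Finset.sum_congr rfl fun p _ => ?_
  simp only [Finset.sum_mul, Finset.mul_sum]
  exact Finset.sum_congr rfl fun s _ => by ring

theorem dotProduct_transpose_mul_mulVec {ι : Type*} [Fintype ι] (A : Matrix ι ι ℝ) (z : ι → ℝ) :
    z ⬝ᵥ (Aᵀ * A) *ᵥ z = ∑ p, (A *ᵥ z) p ^ 2 := by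
  rw [← mulVec_mulVec, dotProduct_mulVec, vecMul_transpose]
  simp [dotProduct, sq]

/-- The summands are the variances of the label-weighted features `mₚ ⟨v, z⟩`, since `A z` is their
mean. Positive semidefiniteness of `excess` follows. -/
theorem dotProduct_excess_mulVec {d : ℕ} (n : ℕ) (z : Idx d → ℝ) :
    z ⬝ᵥ excess d n *ᵥ z = (1 / (n : ℝ)) * ∑ p,
      (∫ x, (mono x p * (basisFeature x ⬝ᵥ z)) ^ 2 ∂inputLaw d - (monoMat d *ᵥ z) p ^ 2) := by
  rw [excess, smul_mulVec, dotProduct_smul, sub_mulVec, dotProduct_sub,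
    dotProduct_weightedMoment_mulVec, dotProduct_transpose_mul_mulVec, Finset.sum_sub_distrib,
    smul_eq_mul]

theorem dotProduct_excess_mulVec_nonneg {d : ℕ} (n : ℕ) (z : Idx d → ℝ) :
    0 ≤ z ⬝ᵥ excess d n *ᵥ z := by
  rw [dotProduct_excess_mulVec]
  refine mul_nonneg (by positivity) (Finset.sum_nonneg fun p _ => ?_)
  rw [← integral_mono_mul_dotProduct]
  have hm := ((hasMoments_mono p).mul (hasMoments_dotProduct z))
  have h := variance_nonneg (fun x : Fin d → ℝ => mono x p * (basisFeature x ⬝ᵥ z)) (inputLaw d)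
  rw [variance_eq_sub hm.memLp_two] at h
  simpa using h

theorem excess_comm {d : ℕ} (n : ℕ) (p q : Idx d) : excess d n p q = excess d n q p := by
  have : ((monoMat d)ᵀ * monoMat d) p q = ((monoMat d)ᵀ * monoMat d) q p := by
    simp [Matrix.mul_apply, mul_comm]
  simp [excess, weightedMoment_comm p q, this]

/-- The part of the prediction error that is linear in the coefficients. -/
def oddPart {d n : ℕ} (B : Matrix (Idx d) (Idx d) ℝ) (x : Col n → Fin d → ℝ) (w : Idx d → ℝ) : ℝ :=
  (1 / (n : ℝ)) * ∑ i : Fin n, target w (x (Sum.inl i)) *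
    (basisFeature (x (Sum.inl i)) ⬝ᵥ B *ᵥ basisFeature (x (Sum.inr ()))) + target w (x (Sum.inr ()))

/-- The part of the prediction that is even in the coefficients. -/
def evenPart {d n : ℕ} (a : Idx d → ℝ) (p : ℝ) (G : Matrix (Idx d) (Idx d) ℝ) (b : Idx d → ℝ)
    (x : Col n → Fin d → ℝ) (w : Idx d → ℝ) : ℝ :=
  (1 / (n : ℝ)) * ∑ i : Fin n, ((a ⬝ᵥ basisFeature (x (Sum.inl i))) *
    (basisFeature (x (Sum.inl i)) ⬝ᵥ G *ᵥ basisFeature (x (Sum.inr ()))) +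
    p * target w (x (Sum.inl i)) ^ 2 * (b ⬝ᵥ basisFeature (x (Sum.inr ()))))

/-- The law of the coefficients. -/
abbrev coeffLaw (d : ℕ) : Measure (Idx d → ℝ) := Measure.pi fun _ => stdG

/-- The law of the columns. -/
abbrev colLaw (d n : ℕ) : Measure (Col n → Fin d → ℝ) := Measure.pi fun _ => inputLaw d

theorem integral_coeff {ι : Type*} [Fintype ι] [DecidableEq ι] (p q : ι) :
    ∫ w : ι → ℝ, w p * w q ∂(Measure.pi fun _ => stdG) = if p = q then 1 else 0 := by
  have h : ∀ w : ι → ℝ, w p * w q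
      = ∏ r, w r ^ ((if p = r then 1 else 0) + (if q = r then 1 else 0)) := by
    intro w
    simp only [pow_add, Finset.prod_mul_distrib]
    simp [pow_ite]
  simp only [h]
  rw [integral_fintype_prod_eq_prod (f := fun (r : ι) (t : ℝ) =>
    t ^ ((if p = r then 1 else 0) + (if q = r then 1 else 0)))]
  split_ifs with hpq
  · subst hpq
    refine Finset.prod_eq_one fun r _ => ?_
    split_ifs <;> simp [integral_sq_stdG]
  · refine Finset.prod_eq_zero (Finset.mem_univ p) ?_
    have : q ≠ p := fun h => hpq h.symm
    simp [this, integral_id_gaussianReal]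

theorem hasMoments_col {d n : ℕ} {f : (Fin d → ℝ) → ℝ} (hf : HasMoments f (inputLaw d))
    (c : Col n) : HasMoments (fun x : Col n → Fin d → ℝ => f (x c)) (colLaw d n) :=
  hf.comp (measurePreserving_eval (fun _ : Col n => inputLaw d) c)

/-- The expected square of the linear part of the error is the population loss. -/
theorem integral_oddPart_sq {d n : ℕ} (hn : 0 < n) (B : Matrix (Idx d) (Idx d) ℝ) :
    ∫ ω, oddPart (n := n) B ω.1 ω.2 ^ 2 ∂promptLaw d n = popLoss d n B := by
  classical
  have hv := fun q => hasMoments_basisFeature (d := d) q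
  -- `L p` is the coefficient of `w p` in the odd part; the coefficients `w p` are orthonormal.
  let L : Idx d → (Col n → Fin d → ℝ) → ℝ := fun p x =>
    (1 / (n : ℝ)) * ∑ i : Fin n, mono (x (Sum.inl i)) p *
      (basisFeature (x (Sum.inl i)) ⬝ᵥ B *ᵥ basisFeature (x (Sum.inr ()))) + mono (x (Sum.inr ())) p
  have hLm : ∀ p, HasMoments (L p) (colLaw d n) := by
    intro p
    refine HasMoments.add (HasMoments.const_mul _ (HasMoments.sum fun i _ =>
      (hasMoments_col (hasMoments_mono p) _).mul ?_)) (hasMoments_col (hasMoments_mono p) _)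
    refine HasMoments.sum fun q _ => (hasMoments_col (hv q) (Sum.inl i)).mul ?_
    exact HasMoments.sum fun r _ => (hasMoments_col (hv r) (Sum.inr ())).const_mul _
  have h1 : ∀ ω : (Col n → Fin d → ℝ) × (Idx d → ℝ),
      oddPart (n := n) B ω.1 ω.2 = ∑ p, L p ω.1 * ω.2 p := by
    rintro ⟨x, w⟩
    simp only [oddPart, L, target, add_mul, Finset.sum_add_distrib, Finset.mul_sum, Finset.sum_mul]
    rw [Finset.sum_comm]
    congr 1
    · refine Finset.sum_congr rfl fun p _ => Finset.sum_congr rfl fun i _ => ?_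
      simp only [mono]; ring
    · exact Finset.sum_congr rfl fun p _ => by simp only [mono]; ring
  have h2 : ∫ ω, oddPart (n := n) B ω.1 ω.2 ^ 2 ∂promptLaw d n
      = ∑ p, ∫ x, L p x ^ 2 ∂colLaw d n := by
    simp only [h1]
    exact integral_sq_sum_mul_orthonormal (e := fun p (w : Idx d → ℝ) => w p) hLm
      (fun p => hasMoments_id.comp (measurePreserving_eval _ p)) integral_coeff
  -- A second orthonormal expansion, now in the features of the query: `c p q` depends on the
  -- examples alone and is a shifted empirical mean.
  let c : Idx d → Idx d → (Fin n → Fin d → ℝ) → ℝ := fun p q y =>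
    (1 / (n : ℝ)) * ∑ i : Fin n, mono (y i) p * (basisFeature (y i) ⬝ᵥ Bᵀ q) + monoMat d p q
  have hcY : ∀ p q, HasMoments (fun y : Fin d → ℝ => mono y p * (basisFeature y ⬝ᵥ Bᵀ q))
      (inputLaw d) := fun p q => (hasMoments_mono p).mul (hasMoments_dotProduct _)
  have hcm : ∀ p q, HasMoments (c p q) (Measure.pi fun _ : Fin n => inputLaw d) := fun p q =>
    (HasMoments.const_mul _ (HasMoments.sum fun i _ =>
      (hcY p q).comp (measurePreserving_eval _ i))).add (HasMoments.const _)
  have h3 : ∀ p, ∫ x, L p x ^ 2 ∂colLaw d n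
      = ∑ q, ∫ y, c p q y ^ 2 ∂(Measure.pi fun _ : Fin n => inputLaw d) := by
    intro p
    have hmp := measurePreserving_sumPiEquivProdPi (X := fun _ : Fin n ⊕ Unit => Fin d → ℝ)
      (fun _ => inputLaw d)
    let F : (Fin n → Fin d → ℝ) × (Unit → Fin d → ℝ) → ℝ := fun z =>
      (∑ q, c p q z.1 * basisFeature (z.2 ()) q) ^ 2
    have h4 : ∀ x : Col n → Fin d → ℝ, L p x ^ 2 = F (MeasurableEquiv.sumPiEquivProdPi (fun _ : Fin n ⊕ Unit => Fin d → ℝ) x) := by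
      intro x
      have e1 : MeasurableEquiv.sumPiEquivProdPi (fun _ : Fin n ⊕ Unit => Fin d → ℝ) x
        = (fun i => x (Sum.inl i), fun i => x (Sum.inr i)) := rfl
      rw [e1]
      dsimp only [F]
      congr 1
      simp only [L, c, add_mul, Finset.sum_add_distrib]
      congr 1
      · simp only [mul_assoc, ← Finset.mul_sum, Finset.sum_mul]
        congr 1
        rw [Finset.sum_comm]
        refine Finset.sum_congr rfl fun i _ => ?_
        rw [← Finset.mul_sum, dotProduct_mulVec]
        rfl
      · exact (congrFun (monoMat_mulVec_basisFeature (x (Sum.inr ()))) p).symm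
    simp only [h4]
    refine (hmp.integral_comp' F).trans ?_
    refine integral_sq_sum_mul_orthonormal (e := fun q (z : Unit → Fin d → ℝ) =>
      basisFeature (z ()) q) (hcm p) (fun q => (hv q).comp (measurePreserving_eval _ ())) ?_
    intro q r
    rw [← integral_basisFeature q r]
    exact integral_comp_eval (μ := fun _ : Unit => inputLaw d) (i := ())
      (f := fun y => basisFeature y q * basisFeature y r) ((hv q).mul (hv r)).1
  -- Bias–variance decomposition: the mean is the `(p, q)` entry of `A B`, and the shift supplies
  -- `A`.
  have h5 : ∀ p q, ∫ y, c p q y ^ 2 ∂(Measure.pi fun _ : Fin n => inputLaw d)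
      = ((monoMat d * (B + 1)) p q) ^ 2 + (1 / (n : ℝ)) *
        (∫ x, (mono x p * (basisFeature x ⬝ᵥ Bᵀ q)) ^ 2 ∂inputLaw d
          - (monoMat d *ᵥ Bᵀ q) p ^ 2) := by
    intro p q
    rw [integral_sq_empirical_mean hn (hcY p q), integral_mono_mul_dotProduct, mul_add, mul_one,
      Matrix.add_apply]
    rfl
  rw [h2]
  simp only [h3, h5, Finset.sum_add_distrib]
  rw [popLoss, frobSq, trace_transpose_mul_mul]
  congr 1
  rw [Finset.sum_comm]
  refine Finset.sum_congr rfl fun q _ => ?_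
  rw [dotProduct_excess_mulVec, Finset.mul_sum]

/-! ### The prediction and the loss in the orthonormal features -/

/-- The label row of a weight matrix, restricted to the feature rows. -/
def labelRow {d : ℕ} (P : Matrix (Row d) (Row d) ℝ) : Idx d → ℝ := fun k => P (Sum.inr ()) (Sum.inl k)

/-- The mask removes the query column from the sum and the hidden query label is zero, so only the
last row of `P` and the first columns of `Q` survive. -/
theorem prediction_eq {d n : ℕ} (W₀ W₁ : Matrix (Idx d) (Idx d) ℝ) (P Q : Matrix (Row d) (Row d) ℝ)
    (x : Col n → Fin d → ℝ) (w : Idx d → ℝ) :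
    prediction W₀ W₁ P Q (prompt x w) = (1 / (n : ℝ)) * ∑ i : Fin n,
      (labelRow P ⬝ᵥ bilinFeature W₀ W₁ (x (Sum.inl i))
        + P (Sum.inr ()) (Sum.inr ()) * target w (x (Sum.inl i))) *
      (bilinFeature W₀ W₁ (x (Sum.inl i)) ⬝ᵥ Q.toBlocks₁₁ *ᵥ bilinFeature W₀ W₁ (x (Sum.inr ()))
        + target w (x (Sum.inl i)) * (labelRow Q ⬝ᵥ bilinFeature W₀ W₁ (x (Sum.inr ())))) := by
  rw [prediction, btfb, attn, bilin_prompt]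
  generalize bilinFeature W₀ W₁ = φ
  set Z : Matrix (Row d) (Col n) ℝ := Matrix.fromBlocks
      (Matrix.of fun p i => φ (x (Sum.inl i)) p) (Matrix.of fun p _ => φ (x (Sum.inr ())) p)
      (Matrix.of fun _ i => target w (x (Sum.inl i))) 0 with hZ
  have z1 : ∀ p i, Z (Sum.inl p) (Sum.inl i) = φ (x (Sum.inl i)) p := fun _ _ => rfl
  have z2 : ∀ p, Z (Sum.inl p) (Sum.inr ()) = φ (x (Sum.inr ())) p := fun _ => rfl
  have z3 : ∀ i, Z (Sum.inr ()) (Sum.inl i) = target w (x (Sum.inl i)) := fun _ => rfl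
  have z4 : Z (Sum.inr ()) (Sum.inr ()) = 0 := rfl
  rw [Matrix.add_apply, Matrix.smul_apply, z4, zero_add, smul_eq_mul, Matrix.mul_apply]
  congr 1
  have hmask : ∀ Y : Matrix (Row d) (Col n) ℝ, (∀ i, (Y * mask n) (Sum.inr ()) (Sum.inl i)
      = Y (Sum.inr ()) (Sum.inl i)) ∧ (Y * mask n) (Sum.inr ()) (Sum.inr ()) = 0 := by
    intro Y
    constructor
    · intro i
      simp [Matrix.mul_apply, mask, Matrix.one_apply]
    · simp [Matrix.mul_apply, mask]
  rw [Fintype.sum_sum_type]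
  simp only [(hmask _).1, Finset.univ_unique, Finset.sum_singleton, PUnit.default_eq_unit,
    (hmask _).2, zero_mul, add_zero]
  refine Finset.sum_congr rfl fun i _ => ?_
  congr 1
  · rw [Matrix.mul_apply, Fintype.sum_sum_type]
    simp [z1, z3, labelRow, dotProduct]
  · rw [Matrix.mul_assoc, Matrix.mul_apply, Fintype.sum_sum_type]
    simp only [Finset.univ_unique, Finset.sum_singleton, PUnit.default_eq_unit,
      Matrix.transpose_apply, z1, z3]
    congr 1
    · refine Finset.sum_congr rfl fun k _ => ?_
      rw [Matrix.mul_apply, Fintype.sum_sum_type]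
      simp [z2, z4, Matrix.mulVec, dotProduct, Matrix.toBlocks₁₁]
    · rw [Matrix.mul_apply, Fintype.sum_sum_type]
      simp [z2, z4, labelRow, dotProduct]

/-- The matrix of the part of the predictor that is linear in the coefficients. -/
def effective {d : ℕ} (M : Matrix (Idx d) (Idx d) ℝ) (P Q : Matrix (Row d) (Row d) ℝ) :
    Matrix (Idx d) (Idx d) ℝ :=
  P (Sum.inr ()) (Sum.inr ()) • (Mᵀ * Q.toBlocks₁₁ * M)
    + vecMulVec (labelRow P ᵥ* M) (labelRow Q ᵥ* M)

/-- Of the four products in each summand, two are linear in the label: the `p Q₁₁` term and the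
rank-one term from the two label rows. The other two have degree `0` and `2` in the label and form
the even part. -/
theorem prediction_add_target {d n : ℕ} {W₀ W₁ M : Matrix (Idx d) (Idx d) ℝ}
    (hM : ∀ x, bilinFeature W₀ W₁ x = M *ᵥ basisFeature x) (P Q : Matrix (Row d) (Row d) ℝ)
    (x : Col n → Fin d → ℝ) (w : Idx d → ℝ) :
    prediction W₀ W₁ P Q (prompt x w) + target w (x (Sum.inr ()))
      = oddPart (effective M P Q) x w + evenPart (labelRow P ᵥ* M) (P (Sum.inr ()) (Sum.inr ()))
          (Mᵀ * Q.toBlocks₁₁ * M) (labelRow Q ᵥ* M) x w := by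
  rw [prediction_eq, oddPart, evenPart, effective]
  simp only [hM]
  rw [add_right_comm, ← mul_add, ← Finset.sum_add_distrib]
  congr 2
  refine Finset.sum_congr rfl fun i _ => ?_
  have e : ∀ u v : Idx d → ℝ, M *ᵥ u ⬝ᵥ Q.toBlocks₁₁ *ᵥ M *ᵥ v = u ⬝ᵥ (Mᵀ * Q.toBlocks₁₁ * M) *ᵥ v := by
    intro u v
    rw [← mulVec_mulVec, ← mulVec_mulVec, dotProduct_mulVec u, vecMul_transpose]
  rw [e, dotProduct_mulVec (labelRow P), dotProduct_mulVec (labelRow Q), add_mulVec, dotProduct_add,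
    smul_mulVec, dotProduct_smul, vecMulVec_mulVec, dotProduct_smul, smul_eq_mul,
    dotProduct_comm _ (labelRow P ᵥ* M)]
  simp only [MulOpposite.smul_eq_mul_unop, MulOpposite.unop_op]
  ring

theorem target_neg {d : ℕ} (w : Idx d → ℝ) (x : Fin d → ℝ) : target (-w) x = -target w x := by
  simp [target]

theorem oddPart_neg {d n : ℕ} (B : Matrix (Idx d) (Idx d) ℝ) (x : Col n → Fin d → ℝ)
    (w : Idx d → ℝ) : oddPart B x (-w) = -oddPart B x w := by
  simp only [oddPart, target_neg, neg_mul, Finset.sum_neg_distrib]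
  ring

theorem evenPart_neg {d n : ℕ} (a : Idx d → ℝ) (p : ℝ) (G : Matrix (Idx d) (Idx d) ℝ)
    (b : Idx d → ℝ) (x : Col n → Fin d → ℝ) (w : Idx d → ℝ) :
    evenPart a p G b x (-w) = evenPart a p G b x w := by
  simp only [evenPart, target_neg, neg_sq]

instance instIsProbabilityMeasurePromptLaw (d n : ℕ) : IsProbabilityMeasure (promptLaw d n) := by
  unfold promptLaw; infer_instance

theorem hasMoments_feature_prompt {d n : ℕ} (c : Col n) (p : Idx d) :
    HasMoments (fun ω : (Col n → Fin d → ℝ) × (Idx d → ℝ) => basisFeature (ω.1 c) p)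
      (promptLaw d n) :=
  (hasMoments_col (hasMoments_basisFeature p) c).comp measurePreserving_fst

theorem hasMoments_target_prompt {d n : ℕ} (c : Col n) :
    HasMoments (fun ω : (Col n → Fin d → ℝ) × (Idx d → ℝ) => target ω.2 (ω.1 c))
      (promptLaw d n) := by
  refine HasMoments.sum fun p _ => HasMoments.mul ?_ ?_
  · exact (hasMoments_id.comp (measurePreserving_eval (fun _ : Idx d => stdG) p)).comp
      measurePreserving_snd
  · exact (hasMoments_col (hasMoments_mono p) c).comp measurePreserving_fst

theorem hasMoments_bilinear_prompt {d n : ℕ} (B : Matrix (Idx d) (Idx d) ℝ) (c c' : Col n) :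
    HasMoments (fun ω : (Col n → Fin d → ℝ) × (Idx d → ℝ) =>
      basisFeature (ω.1 c) ⬝ᵥ B *ᵥ basisFeature (ω.1 c')) (promptLaw d n) :=
  HasMoments.sum fun q _ => (hasMoments_feature_prompt c q).mul
    (HasMoments.sum fun r _ => (hasMoments_feature_prompt c' r).const_mul _)

theorem hasMoments_dotProduct_prompt {d n : ℕ} (a : Idx d → ℝ) (c : Col n) :
    HasMoments (fun ω : (Col n → Fin d → ℝ) × (Idx d → ℝ) =>
      a ⬝ᵥ basisFeature (ω.1 c)) (promptLaw d n) :=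
  HasMoments.sum fun q _ => (hasMoments_feature_prompt c q).const_mul _

theorem hasMoments_oddPart {d n : ℕ} (B : Matrix (Idx d) (Idx d) ℝ) :
    HasMoments (fun ω => oddPart B ω.1 ω.2) (promptLaw d n) :=
  (HasMoments.const_mul _ (HasMoments.sum fun _ _ =>
    (hasMoments_target_prompt _).mul (hasMoments_bilinear_prompt B _ _))).add
    (hasMoments_target_prompt _)

theorem hasMoments_evenPart {d n : ℕ} (a : Idx d → ℝ) (p : ℝ) (G : Matrix (Idx d) (Idx d) ℝ)
    (b : Idx d → ℝ) : HasMoments (fun ω => evenPart a p G b ω.1 ω.2) (promptLaw d n) :=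
  HasMoments.const_mul _ (HasMoments.sum fun _ _ =>
    ((hasMoments_dotProduct_prompt _ _).mul (hasMoments_bilinear_prompt _ _ _)).add
      ((((hasMoments_target_prompt _).pow 2).const_mul _).mul (hasMoments_dotProduct_prompt _ _)))

theorem measurePreserving_neg_coeff (d n : ℕ) :
    MeasurePreserving (fun ω : (Col n → Fin d → ℝ) × (Idx d → ℝ) => (ω.1, -ω.2))
      (promptLaw d n) (promptLaw d n) := by
  have h1 : MeasurePreserving (fun t : ℝ => -t) stdG stdG :=
    ⟨measurable_neg, by rw [gaussianReal_map_neg, neg_zero]⟩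
  exact (MeasurePreserving.id _).prod (measurePreserving_pi (fun _ : Idx d => stdG) _ fun _ => h1)

/-- The reflection `w ↦ -w` preserves the law and reverses the sign of the integrand. -/
theorem integral_oddPart_mul_evenPart {d n : ℕ} (B : Matrix (Idx d) (Idx d) ℝ) (a : Idx d → ℝ)
    (p : ℝ) (G : Matrix (Idx d) (Idx d) ℝ) (b : Idx d → ℝ) :
    ∫ ω, oddPart (n := n) B ω.1 ω.2 * evenPart a p G b ω.1 ω.2 ∂promptLaw d n = 0 := by
  have hm := (hasMoments_oddPart (n := n) B).mul (hasMoments_evenPart (n := n) a p G b)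
  have hφ := measurePreserving_neg_coeff d n
  have h := integral_map hφ.measurable.aemeasurable (hφ.map_eq.symm ▸ hm.1)
  rw [hφ.map_eq] at h
  simp only [oddPart_neg, evenPart_neg, neg_mul, integral_neg] at h
  linarith

/-- The loss splits into the population loss and the mean square of the even part. -/
theorem loss_eq {d n : ℕ} (hn : 0 < n) {W₀ W₁ M : Matrix (Idx d) (Idx d) ℝ}
    (hM : ∀ x, bilinFeature W₀ W₁ x = M *ᵥ basisFeature x) (P Q : Matrix (Row d) (Row d) ℝ) :
    loss d n W₀ W₁ P Q = popLoss d n (effective M P Q) +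
      ∫ ω, evenPart (n := n) (labelRow P ᵥ* M) (P (Sum.inr ()) (Sum.inr ()))
          (Mᵀ * Q.toBlocks₁₁ * M) (labelRow Q ᵥ* M) ω.1 ω.2 ^ 2 ∂promptLaw d n := by
  unfold loss
  simp only [prediction_add_target hM]
  generalize labelRow P ᵥ* M = a, P (Sum.inr ()) (Sum.inr ()) = p, Mᵀ * Q.toBlocks₁₁ * M = G,
    labelRow Q ᵥ* M = b, effective M P Q = B
  have ho := hasMoments_oddPart (n := n) B
  have he := hasMoments_evenPart (n := n) a p G b
  have e : ∀ ω : (Col n → Fin d → ℝ) × (Idx d → ℝ),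
      (oddPart B ω.1 ω.2 + evenPart a p G b ω.1 ω.2) ^ 2
      = oddPart B ω.1 ω.2 ^ 2 + (2 * (oddPart B ω.1 ω.2 * evenPart a p G b ω.1 ω.2)
        + evenPart a p G b ω.1 ω.2 ^ 2) := fun ω => by ring
  simp only [e]
  rw [integral_add (ho.pow 2).integrable (((ho.mul he).const_mul 2).add (he.pow 2)).integrable,
    integral_add ((ho.mul he).const_mul 2).integrable (he.pow 2).integrable, integral_const_mul,
    integral_oddPart_mul_evenPart, integral_oddPart_sq hn]
  ring

theorem integrable_prediction_add_target_sq {d n : ℕ} {W₀ W₁ M : Matrix (Idx d) (Idx d) ℝ}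
    (hM : ∀ x, bilinFeature W₀ W₁ x = M *ᵥ basisFeature x) (P Q : Matrix (Row d) (Row d) ℝ) :
    Integrable (fun ω => (prediction W₀ W₁ P Q (prompt ω.1 ω.2)
      + target ω.2 (ω.1 (Sum.inr ()))) ^ 2) (promptLaw d n) := by
  simp only [prediction_add_target hM]
  exact (((hasMoments_oddPart _).add (hasMoments_evenPart _ _ _ _)).pow 2).integrable

/-- The loss with the initial attention weights. -/
theorem loss_init {d n : ℕ} (hn : 0 < n) {W₀ W₁ M : Matrix (Idx d) (Idx d) ℝ}
    (hM : ∀ x, bilinFeature W₀ W₁ x = M *ᵥ basisFeature x) (γ : Idx d → ℝ) :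
    loss d n W₀ W₁ (initP d) (initQ γ) = popLoss d n (Mᵀ * diagonal γ * M) := by
  have h1 : labelRow (initP d) = 0 := rfl
  have h2 : labelRow (initQ γ) = 0 := rfl
  have h3 : initP d (Sum.inr ()) (Sum.inr ()) = 1 := rfl
  have h4 : (initQ γ).toBlocks₁₁ = diagonal γ := by simp [initQ]
  rw [loss_eq hn hM, effective, h1, h2, h3, h4]
  simp [evenPart]

/-! ### Vanishing of the even part -/

theorem continuous_herm (k : ℕ) : Continuous (herm k) := by
  unfold herm
  split_ifs <;> fun_prop

theorem continuous_basisFeature {d : ℕ} (p : Idx d) :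
    Continuous fun x : Fin d → ℝ => basisFeature x p := by
  simp only [basisFeature_eq_prod]
  exact continuous_finsetProd _ fun c _ => (continuous_herm _).comp (continuous_apply c)

theorem continuous_mono {d : ℕ} (p : Idx d) : Continuous fun x : Fin d → ℝ => mono x p := by
  simp only [mono_eq_prod]
  fun_prop

theorem continuous_evenPart {d n : ℕ} (a : Idx d → ℝ) (p : ℝ) (G : Matrix (Idx d) (Idx d) ℝ)
    (b : Idx d → ℝ) : Continuous fun ω : (Col n → Fin d → ℝ) × (Idx d → ℝ) =>
      evenPart a p G b ω.1 ω.2 := by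
  have hf : ∀ (c : Col n) (q : Idx d), Continuous fun ω : (Col n → Fin d → ℝ) × (Idx d → ℝ) =>
      basisFeature (ω.1 c) q := fun c q => (continuous_basisFeature q).comp (by fun_prop)
  have ht : ∀ c : Col n, Continuous fun ω : (Col n → Fin d → ℝ) × (Idx d → ℝ) =>
      target ω.2 (ω.1 c) := fun c => continuous_finsetSum _ fun q _ =>
    Continuous.mul (by fun_prop) ((continuous_mono q).comp (by fun_prop))
  unfold evenPart
  simp only [dotProduct, Matrix.mulVec]
  fun_prop

instance instIsOpenPosMeasureStdG : stdG.IsOpenPosMeasure :=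
  (gaussianReal_absolutelyContinuous' 0 one_ne_zero).isOpenPosMeasure

/-- The even part is continuous and the Gaussian law charges every nonempty open set, so vanishing
almost everywhere upgrades to vanishing everywhere. -/
theorem evenPart_eq_zero {d n : ℕ} {a : Idx d → ℝ} {p : ℝ} {G : Matrix (Idx d) (Idx d) ℝ}
    {b : Idx d → ℝ}
    (h : ∫ ω, evenPart (n := n) a p G b ω.1 ω.2 ^ 2 ∂promptLaw d n = 0)
    (x : Col n → Fin d → ℝ) (w : Idx d → ℝ) : evenPart a p G b x w = 0 := by
  have hz := (integral_eq_zero_iff_of_nonneg (fun ω => sq_nonneg _)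
    ((hasMoments_evenPart (n := n) a p G b).pow 2).integrable).1 h
  have h1 : (inputLaw d).IsOpenPosMeasure := inferInstance
  have h2 : (coeffLaw d).IsOpenPosMeasure := inferInstance
  have h3 : (colLaw d n).IsOpenPosMeasure := inferInstance
  have h4 : (promptLaw d n).IsOpenPosMeasure :=
    inferInstanceAs ((colLaw d n).prod (coeffLaw d)).IsOpenPosMeasure
  have hc : Continuous fun ω : (Col n → Fin d → ℝ) × (Idx d → ℝ) =>
      evenPart a p G b ω.1 ω.2 ^ 2 := (continuous_evenPart a p G b).pow 2
  have := congrFun (Measure.eq_of_ae_eq hz hc continuous_zero) (x, w)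
  simpa using this

theorem eq_zero_of_dotProduct_basisFeature {d : ℕ} {z : Idx d → ℝ}
    (h : ∀ x, z ⬝ᵥ basisFeature x = 0) : z = 0 := by
  funext q
  have h1 : ∫ x, (∑ p, z p * basisFeature x p) * basisFeature x q ∂inputLaw d = z q := by
    simp only [Finset.sum_mul, mul_assoc]
    rw [integral_finsetSum _ fun p _ => (((hasMoments_basisFeature p).mul
      (hasMoments_basisFeature q)).const_mul _).integrable]
    simp [integral_const_mul, integral_basisFeature]
  rw [← h1]
  have : ∀ x : Fin d → ℝ, ∑ p, z p * basisFeature x p = 0 := h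
  simp [this]

theorem basisFeature_ne_zero {d : ℕ} (x : Fin d → ℝ) : basisFeature x ≠ 0 := by
  intro h
  have := congrFun h (origin d)
  simp [basisFeature, origin, homog] at this

theorem target_single_origin {d : ℕ} (x : Fin d → ℝ) :
    target (Pi.single (origin d) 1) x = 1 := by
  unfold target
  rw [Finset.sum_eq_single (origin d)]
  · simp [origin, homog]
  · intro p _ hp; simp [hp]
  · simp

/-- If the even part vanishes identically, then only the linear attention coefficients remain. -/
theorem eq_zero_of_evenPart {d n : ℕ} (hn : 0 < n) {a : Idx d → ℝ} {p : ℝ}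
    {G : Matrix (Idx d) (Idx d) ℝ} {b : Idx d → ℝ}
    (h : ∀ (x : Col n → Fin d → ℝ) (w : Idx d → ℝ), evenPart a p G b x w = 0) :
    (p = 0 ∨ b = 0) ∧ (IsUnit G → a = 0) := by
  have hn' : (n : ℝ) ≠ 0 := by positivity
  -- Zero coefficients and equal examples isolate the term of degree `0` in the labels.
  have h0 : ∀ y z : Fin d → ℝ, (a ⬝ᵥ basisFeature y) * (basisFeature y ⬝ᵥ G *ᵥ basisFeature z) = 0 := by
    intro y z
    have := h (Sum.elim (fun _ => y) fun _ => z) 0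
    simpa [evenPart, target, hn'] using this
  -- Labels identically `1`; the degree `0` term is already known to vanish.
  have h1 : ∀ z : Fin d → ℝ, p * (b ⬝ᵥ basisFeature z) = 0 := by
    intro z
    have := h (Sum.elim (fun _ => z) fun _ => z) (Pi.single (origin d) 1)
    simpa [evenPart, target_single_origin, hn', h0] using this
  constructor
  · by_cases hp : p = 0
    · exact Or.inl hp
    · right
      apply eq_zero_of_dotProduct_basisFeature
      intro z
      exact (mul_eq_zero.1 (h1 z)).resolve_left hp
  · intro hG
    apply eq_zero_of_dotProduct_basisFeature
    intro y
    by_contra hy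
    have h2 : basisFeature y ᵥ* G = 0 := by
      apply eq_zero_of_dotProduct_basisFeature
      intro z
      rw [← dotProduct_mulVec]
      exact (mul_eq_zero.1 (h0 y z)).resolve_left hy
    have h3 : Function.Injective G.vecMul := Matrix.vecMul_injective_of_isUnit hG
    exact basisFeature_ne_zero y (h3 (by simpa using h2))

/-! ### Entries of the quadratic form of the population loss -/

/-- The Gram matrix of the change of basis. -/
def monoGram (d : ℕ) : Matrix (Idx d) (Idx d) ℝ := (monoMat d)ᵀ * monoMat d

/-- The matrix of the quadratic part of the population loss. -/
def hess (d n : ℕ) : Matrix (Idx d) (Idx d) ℝ := monoGram d + excess d n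

/-- The bound for the entries of `excess d n`. -/
def theta (d n : ℕ) : ℝ := 4 * momentBound ^ 6 * (d : ℝ) ^ 2 / n

theorem theta_nonneg (d n : ℕ) : 0 ≤ theta d n := by
  have := one_le_momentBound
  unfold theta
  positivity

/-- The index pairs `(i, i)`, `0 ≤ i`. -/
def block (d : ℕ) : Finset (Idx d) := Finset.univ.filter fun p => p.1.1 = p.1.2

theorem mem_block {d : ℕ} {p : Idx d} : p ∈ block d ↔ p.1.1 = p.1.2 := by simp [block]

theorem origin_mem_block (d : ℕ) : origin d ∈ block d := mem_block.2 rfl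

theorem IsDiag.mem_block {d : ℕ} {p : Idx d} (h : IsDiag p) : p ∈ block d := QuadICL.mem_block.2 h.1

theorem isDiag_of_mem_block {d : ℕ} {p : Idx d} (h : p ∈ block d) (h0 : p ≠ origin d) :
    IsDiag p := by
  refine ⟨mem_block.1 h, fun h1 => h0 ?_⟩
  ext1
  exact Prod.ext h1 ((mem_block.1 h).symm.trans h1)

theorem card_block_le {d : ℕ} (hd : 1 ≤ d) : ((block d).card : ℝ) ≤ 2 * d := by
  have h := Finset.card_le_card_of_injOn (s := block d) (t := (Finset.univ : Finset (Fin (d + 1))))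
    (fun r => r.1.1) (fun _ _ => Finset.mem_univ _) (by
      intro p hp q hq h
      have hp' := mem_block.1 hp
      have hq' := mem_block.1 hq
      ext1
      exact Prod.ext h (by rw [← hp', ← hq']; exact h))
  simp only [Finset.card_univ, Fintype.card_fin] at h
  have : (block d).card ≤ 2 * d := by omega
  exact_mod_cast this

theorem monoMat_apply_of_ne {d : ℕ} {q : Idx d} (hq : q ≠ origin d) (r : Idx d) :
    monoMat d r q = if r = q then (if IsDiag q then √2 else 1) else 0 := by
  simp only [monoMat, Matrix.of_apply, hq, if_false, add_zero]
  by_cases h : r = q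
  · subst h; simp
  · have : ¬ q = r := fun e => h e.symm
    simp [h, this]

theorem monoGram_comm {d : ℕ} (p q : Idx d) : monoGram d p q = monoGram d q p := by
  simp [monoGram, Matrix.mul_apply, mul_comm]

theorem monoGram_apply_of_ne {d : ℕ} {p : Idx d} (hp : p ≠ origin d) (q : Idx d) :
    monoGram d p q = (if IsDiag p then √2 else 1) * monoMat d p q := by
  simp [monoGram, Matrix.mul_apply, monoMat_apply_of_ne hp]

theorem one_le_monoGram_self {d : ℕ} (q : Idx d) : 1 ≤ monoGram d q q := by
  have h : monoMat d q q ^ 2 ≤ monoGram d q q := by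
    simp only [monoGram, Matrix.mul_apply, Matrix.transpose_apply, ← sq]
    exact Finset.single_le_sum (f := fun r => monoMat d r q ^ 2) (fun _ _ => sq_nonneg _)
      (Finset.mem_univ q)
  refine le_trans ?_ h
  by_cases hq : IsDiag q
  · have h0 : q ≠ origin d := fun h => not_isDiag_origin d (h ▸ hq)
    simp [monoMat, hq, h0]
  · simp [monoMat, hq]

/-- The off-diagonal entries of the Gram matrix. -/
theorem monoGram_of_ne {d : ℕ} {p q : Idx d} (h : p ≠ q) :
    monoGram d p q = if (IsDiag p ∧ q = origin d) ∨ (p = origin d ∧ IsDiag q) then √2 else 0 := by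
  by_cases hp : p = origin d
  · have hq : q ≠ origin d := fun e => h (hp.trans e.symm)
    rw [monoGram_comm, monoGram_apply_of_ne hq]
    by_cases hD : IsDiag q
    · simp [monoMat, hD, hp, hq.symm]
    · simp [monoMat, hD, hp, hq, hq.symm]
  · rw [monoGram_apply_of_ne hp]
    by_cases hD : IsDiag p
    · simp [monoMat, hD, hp, h.symm]
    · simp [monoMat, hD, hp, h.symm]

theorem excess_apply {d : ℕ} (n : ℕ) (p q : Idx d) :
    excess d n p q = (weightedMoment d p q - monoGram d p q) / n := by
  rw [excess, Matrix.smul_apply, Matrix.sub_apply, smul_eq_mul, monoGram]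
  ring

theorem excess_self_nonneg {d : ℕ} (n : ℕ) (q : Idx d) : 0 ≤ excess d n q q := by
  have h := dotProduct_excess_mulVec_nonneg n (Pi.single q (1 : ℝ))
  simpa using h

theorem excess_self_le {d : ℕ} (hd : 1 ≤ d) (n : ℕ) (q : Idx d) :
    excess d n q q ≤ theta d n := by
  rw [excess_apply, theta]
  have h1 := (le_abs_self _).trans (abs_weightedMoment_le hd q q)
  have h2 := one_le_monoGram_self q
  have h3 : 0 ≤ momentBound ^ 6 * (d : ℝ) ^ 2 := by
    have := one_le_momentBound
    positivity
  gcongr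
  linarith

/-- The weighted moment contributes `2d` and the Gram entry at most `2`, in units of `momentBound ^
6`; this is where the `4` in `theta` is used. -/
theorem abs_excess_le_of_mem_block {d : ℕ} (hd : 1 ≤ d) (n : ℕ) {p q : Idx d} (h : p ≠ q)
    (hp : p ∈ block d) (hq : q ∈ block d) : |excess d n p q| ≤ theta d n / d := by
  have hd' : (1 : ℝ) ≤ d := by exact_mod_cast hd
  have hm : 1 ≤ momentBound ^ 6 := one_le_pow₀ one_le_momentBound
  have hK : |weightedMoment d p q| ≤ 2 * momentBound ^ 6 * (d : ℝ) := by
    by_cases h0 : p = origin d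
    · have hq0 : q ≠ origin d := fun e => h (h0.trans e.symm)
      rw [weightedMoment_comm]
      exact abs_weightedMoment_le_of_isDiag hd h.symm (isDiag_of_mem_block hq hq0) (mem_block.1 hp)
    · exact abs_weightedMoment_le_of_isDiag hd h (isDiag_of_mem_block hp h0) (mem_block.1 hq)
  have hS : |monoGram d p q| ≤ 2 := by
    rw [monoGram_of_ne h]
    split_ifs
    · rw [abs_of_nonneg (Real.sqrt_nonneg _)]
      exact Real.sqrt_le_iff.2 ⟨by norm_num, by norm_num⟩
    · simp
  have e : theta d n / d = 4 * momentBound ^ 6 * (d : ℝ) / n := by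
    unfold theta; field_simp
  rw [excess_apply, e, abs_div, Nat.abs_cast]
  gcongr
  have h4 : |weightedMoment d p q - monoGram d p q| ≤ 2 * momentBound ^ 6 * (d : ℝ) + 2 :=
    (abs_sub _ _).trans (add_le_add hK hS)
  nlinarith [mul_le_mul hm hd' zero_le_one (zero_le_one.trans hm)]

/-- Parity: an index `(i, j)` with `i < j` decouples from every other index. -/
theorem excess_eq_zero {d : ℕ} (n : ℕ) {p q : Idx d} (h : p ≠ q)
    (hp : p ∉ block d) : excess d n p q = 0 := by
  have hp' : ¬ p.1.1 = p.1.2 := fun e => hp (mem_block.2 e)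
  have h1 : monoGram d p q = 0 := by
    rw [monoGram_of_ne h, if_neg]
    rintro (⟨h1, _⟩ | ⟨h1, _⟩)
    · exact hp h1.mem_block
    · exact hp (h1 ▸ origin_mem_block d)
  rw [excess_apply, weightedMoment_eq_zero h hp', h1]
  simp

theorem excess_eq_zero' {d : ℕ} (n : ℕ) {p q : Idx d} (h : p ≠ q)
    (hq : q ∉ block d) : excess d n p q = 0 := by
  rw [excess_comm]; exact excess_eq_zero n h.symm hq

/-- The block has at most `2d` indices with entries at most `θ / d`, so the off-diagonal part of a
column weighs no more than a constant times its diagonal entry. -/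
theorem sum_abs_excess_le {d : ℕ} (hd : 1 ≤ d) (n : ℕ) (q : Idx d) :
    ∑ p ∈ Finset.univ.erase q, |excess d n p q| ≤ if q ∈ block d then 2 * theta d n else 0 := by
  have hd' : (0 : ℝ) < d := by exact_mod_cast hd
  split_ifs with hq
  · calc ∑ p ∈ Finset.univ.erase q, |excess d n p q|
        ≤ ∑ p ∈ Finset.univ.erase q, if p ∈ block d then theta d n / d else 0 := by
          refine Finset.sum_le_sum fun p hp => ?_
          have hne := Finset.ne_of_mem_erase hp
          split_ifs with hpb
          · exact abs_excess_le_of_mem_block hd n hne hpb hq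
          · rw [excess_eq_zero n hne hpb, abs_zero]
      _ ≤ ∑ p : Idx d, if p ∈ block d then theta d n / d else 0 := by
          refine Finset.sum_le_sum_of_subset_of_nonneg (Finset.subset_univ _) fun p _ _ => ?_
          have := theta_nonneg d n
          split_ifs <;> positivity
      _ = (block d).card * (theta d n / d) := by
          rw [Finset.sum_ite_mem, Finset.univ_inter]; simp
      _ ≤ (2 * d) * (theta d n / d) := by
          have := theta_nonneg d n
          gcongr
          exact card_block_le hd
      _ = 2 * theta d n := by field_simp
  · refine le_of_eq (Finset.sum_eq_zero fun p hp => ?_)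
    rw [excess_eq_zero' n (Finset.ne_of_mem_erase hp) hq, abs_zero]

/-! ### Coercivity of the change of basis -/

/-- Completing the square in `z (origin d)` leaves exactly `z p ^ 2` after minimisation. -/
theorem sq_le_of_isDiag {d : ℕ} {p : Idx d} (hp : IsDiag p) (z : Idx d → ℝ) :
    z p ^ 2 ≤ (monoMat d *ᵥ z) p ^ 2 + (monoMat d *ᵥ z) (origin d) ^ 2 := by
  rw [monoMat_mulVec_of_isDiag hp, monoMat_mulVec_of_not_isDiag (not_isDiag_origin d)]
  have h2 : √2 * √2 = (2 : ℝ) := Real.mul_self_sqrt (by norm_num)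
  have e : (√2 * z p + z (origin d)) ^ 2 + z (origin d) ^ 2
      = z p ^ 2 + 2 * (z (origin d) + √2 / 2 * z p) ^ 2 := by
    linear_combination (z p ^ 2 - 1 / 2 * z p ^ 2) * h2
  rw [e]
  nlinarith [sq_nonneg (z (origin d) + √2 / 2 * z p)]

/-- A single entry of `z` is controlled without loss in the dimension. The sharp columnwise
estimates use this in place of `sum_sq_le`. -/
theorem sq_le_sum_sq_monoMat {d : ℕ} (z : Idx d → ℝ) (p : Idx d) :
    z p ^ 2 ≤ ∑ r, (monoMat d *ᵥ z) r ^ 2 := by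
  by_cases hp : IsDiag p
  · refine (sq_le_of_isDiag hp z).trans ?_
    have hne : p ≠ origin d := fun h => not_isDiag_origin d (h ▸ hp)
    rw [← Finset.sum_pair (f := fun r => (monoMat d *ᵥ z) r ^ 2) hne]
    exact Finset.sum_le_sum_of_subset_of_nonneg (Finset.subset_univ _) fun _ _ _ => sq_nonneg _
  · rw [← monoMat_mulVec_of_not_isDiag hp z]
    exact Finset.single_le_sum (f := fun r => (monoMat d *ᵥ z) r ^ 2) (fun _ _ => sq_nonneg _)
      (Finset.mem_univ p)

/-- The row of `origin d` is charged once for each index of the block. A loss of order `d` is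
unavoidable: take `1` at the origin and `-1/√2` at the diagonal pairs. -/
theorem sum_sq_le {d : ℕ} (hd : 1 ≤ d) (z : Idx d → ℝ) :
    ∑ p, z p ^ 2 ≤ 3 * d * ∑ r, (monoMat d *ᵥ z) r ^ 2 := by
  set f := monoMat d *ᵥ z with hf
  have hd' : (1 : ℝ) ≤ d := by exact_mod_cast hd
  have h1 : ∀ p, z p ^ 2 ≤ f p ^ 2 + if p ∈ block d then f (origin d) ^ 2 else 0 := by
    intro p
    by_cases hp : IsDiag p
    · rw [if_pos hp.mem_block]; exact sq_le_of_isDiag hp z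
    · have : f p = z p := monoMat_mulVec_of_not_isDiag hp z
      rw [this]
      have : 0 ≤ if p ∈ block d then f (origin d) ^ 2 else 0 := by split_ifs <;> positivity
      linarith
  have h0 : f (origin d) ^ 2 ≤ ∑ r, f r ^ 2 :=
    Finset.single_le_sum (f := fun r => f r ^ 2) (fun _ _ => sq_nonneg _) (Finset.mem_univ _)
  calc ∑ p, z p ^ 2 ≤ ∑ p, (f p ^ 2 + if p ∈ block d then f (origin d) ^ 2 else 0) :=
        Finset.sum_le_sum fun p _ => h1 p
    _ = ∑ p, f p ^ 2 + (block d).card * f (origin d) ^ 2 := by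
        rw [Finset.sum_add_distrib, Finset.sum_ite_mem, Finset.univ_inter]; simp
    _ ≤ ∑ p, f p ^ 2 + (2 * d) * ∑ r, f r ^ 2 := by
        gcongr
        exact card_block_le hd
    _ ≤ 3 * d * ∑ r, f r ^ 2 := by
        have : 0 ≤ ∑ r, f r ^ 2 := Finset.sum_nonneg fun _ _ => sq_nonneg _
        nlinarith

theorem monoMat_mulVec_injective {d : ℕ} {z : Idx d → ℝ} (h : monoMat d *ᵥ z = 0) : z = 0 := by
  funext p
  have := sq_le_sum_sq_monoMat z p
  simp only [h, Pi.zero_apply, ne_eq, OfNat.ofNat_ne_zero, not_false_eq_true, zero_pow,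
    Finset.sum_const_zero] at this
  simpa using pow_eq_zero_iff (two_ne_zero) |>.1 (le_antisymm this (sq_nonneg _))

theorem sum_sq_monoMat_le_hess {d : ℕ} (n : ℕ) (z : Idx d → ℝ) :
    ∑ p, (monoMat d *ᵥ z) p ^ 2 ≤ z ⬝ᵥ hess d n *ᵥ z := by
  rw [hess, add_mulVec, dotProduct_add, monoGram, dotProduct_transpose_mul_mulVec]
  linarith [dotProduct_excess_mulVec_nonneg n z]

theorem hess_mulVec_injective {d : ℕ} (n : ℕ) {z : Idx d → ℝ} (h : hess d n *ᵥ z = 0) : z = 0 := by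
  funext p
  have h1 := sum_sq_monoMat_le_hess n z
  rw [h, dotProduct_zero] at h1
  have h2 := (sq_le_sum_sq_monoMat z p).trans h1
  simpa using pow_eq_zero_iff (two_ne_zero) |>.1 (le_antisymm h2 (sq_nonneg _))

theorem isUnit_of_mulVec_injective {ι : Type*} [Fintype ι] [DecidableEq ι] {A : Matrix ι ι ℝ}
    (h : ∀ z, A *ᵥ z = 0 → z = 0) : IsUnit A := by
  rw [← Matrix.mulVec_injective_iff_isUnit]
  intro u v huv
  have := h (u - v) (by rw [mulVec_sub]; exact sub_eq_zero.2 huv)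
  exact sub_eq_zero.1 this

theorem isUnit_hess (d n : ℕ) : IsUnit (hess d n) :=
  isUnit_of_mulVec_injective fun _ => hess_mulVec_injective n

theorem isUnit_monoMat (d : ℕ) : IsUnit (monoMat d) :=
  isUnit_of_mulVec_injective fun _ => monoMat_mulVec_injective

/-! ### Second order expansion of the population loss -/

theorem frobSq_eq_trace {ι : Type*} [Fintype ι] (X : Matrix ι ι ℝ) : frobSq X = trace (Xᵀ * X) := by
  rw [frobSq, Finset.sum_comm]
  refine Finset.sum_congr rfl fun q _ => ?_
  rw [diag_apply, Matrix.mul_apply]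
  exact Finset.sum_congr rfl fun p _ => sq _

theorem frobSq_nonneg {ι : Type*} [Fintype ι] (X : Matrix ι ι ℝ) : 0 ≤ frobSq X :=
  Finset.sum_nonneg fun _ _ => Finset.sum_nonneg fun _ _ => sq_nonneg _

theorem transpose_hess (d n : ℕ) : (hess d n)ᵀ = hess d n := by
  ext p q
  simp [hess, monoGram_comm p q, excess_comm n p q]

theorem popLoss_eq {d n : ℕ} (B : Matrix (Idx d) (Idx d) ℝ) :
    popLoss d n B = trace (Bᵀ * hess d n * B) + 2 * trace (Bᵀ * monoGram d)
      + trace (monoGram d) := by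
  have hs : (monoGram d)ᵀ = monoGram d := by
    ext p q; exact monoGram_comm _ _
  have e : trace (monoGram d * B) = trace (Bᵀ * monoGram d) := by
    rw [← trace_transpose, transpose_mul, hs]
  rw [popLoss, frobSq_eq_trace, transpose_mul, Matrix.mul_assoc, ← Matrix.mul_assoc (monoMat d)ᵀ,
    ← monoGram, hess]
  simp only [transpose_add, transpose_one, mul_add, add_mul, mul_one, one_mul, trace_add, e,
    ← Matrix.mul_assoc]
  ring

theorem popLoss_add {d n : ℕ} (B E : Matrix (Idx d) (Idx d) ℝ) :
    popLoss d n (B + E) = popLoss d n B + 2 * trace (Eᵀ * (hess d n * B + monoGram d))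
      + trace (Eᵀ * hess d n * E) := by
  have e : trace (Bᵀ * hess d n * E) = trace (Eᵀ * hess d n * B) := by
    rw [← trace_transpose]
    simp [transpose_mul, transpose_hess, Matrix.mul_assoc]
  simp only [popLoss_eq, transpose_add, mul_add, add_mul, trace_add, e, ← Matrix.mul_assoc]
  ring

theorem frobSq_monoMat_mul_le {d : ℕ} (n : ℕ) (E : Matrix (Idx d) (Idx d) ℝ) :
    frobSq (monoMat d * E) ≤ trace (Eᵀ * hess d n * E) := by
  rw [trace_transpose_mul_mul, frobSq, Finset.sum_comm]
  exact Finset.sum_le_sum fun q _ => sum_sq_monoMat_le_hess n (Eᵀ q)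

/-! ### The unconstrained minimiser -/

/-- The minimiser of the population loss. -/
def optimum (d n : ℕ) : Matrix (Idx d) (Idx d) ℝ := -((hess d n)⁻¹ * monoGram d)

theorem hess_mul_optimum (d n : ℕ) : hess d n * optimum d n = -monoGram d := by
  rw [optimum, mul_neg, ← Matrix.mul_assoc,
    Matrix.mul_nonsing_inv _ ((Matrix.isUnit_iff_isUnit_det _).1 (isUnit_hess d n)), one_mul]

theorem popLoss_optimum_add {d n : ℕ} (E : Matrix (Idx d) (Idx d) ℝ) :
    popLoss d n (optimum d n + E) = popLoss d n (optimum d n) + trace (Eᵀ * hess d n * E) := by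
  rw [popLoss_add, hess_mul_optimum]
  simp

theorem popLoss_optimum_le {d n : ℕ} (B : Matrix (Idx d) (Idx d) ℝ) :
    popLoss d n (optimum d n) ≤ popLoss d n B := by
  have h := popLoss_optimum_add (n := n) (B - optimum d n)
  rw [add_sub_cancel] at h
  rw [h]
  linarith [frobSq_monoMat_mul_le n (B - optimum d n), frobSq_nonneg (monoMat d * (B - optimum d n))]

theorem eq_optimum {d n : ℕ} {B : Matrix (Idx d) (Idx d) ℝ}
    (hB : popLoss d n B ≤ popLoss d n (optimum d n)) : B = optimum d n := by
  have h := popLoss_optimum_add (n := n) (B - optimum d n)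
  rw [add_sub_cancel] at h
  have h1 := frobSq_monoMat_mul_le n (B - optimum d n)
  have h2 : frobSq (monoMat d * (B - optimum d n)) ≤ 0 := by linarith
  ext p q
  have h3 := sq_le_sum_sq_monoMat ((B - optimum d n)ᵀ q) p
  have h4 : ∑ r, (monoMat d *ᵥ (B - optimum d n)ᵀ q) r ^ 2
      ≤ frobSq (monoMat d * (B - optimum d n)) := by
    rw [frobSq, Finset.sum_comm]
    exact Finset.single_le_sum (f := fun q => ∑ r, ((monoMat d * (B - optimum d n)) r q) ^ 2)
      (fun _ _ => Finset.sum_nonneg fun _ _ => sq_nonneg _) (Finset.mem_univ q)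
  have h5 : ((B - optimum d n)ᵀ q p) ^ 2 = 0 := le_antisymm (by linarith) (sq_nonneg _)
  have h6 := pow_eq_zero_iff (two_ne_zero) |>.1 h5
  simp only [transpose_apply, Matrix.sub_apply] at h6
  linarith

theorem isUnit_optimum (d n : ℕ) : IsUnit (optimum d n) := by
  refine isUnit_of_mulVec_injective fun z hz => ?_
  have h : (hess d n * optimum d n) *ᵥ z = 0 := by rw [← mulVec_mulVec, hz, mulVec_zero]
  rw [hess_mul_optimum, neg_mulVec, neg_eq_zero, monoGram, ← mulVec_mulVec] at h
  apply monoMat_mulVec_injective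
  have hT : IsUnit (monoMat d)ᵀ := (Matrix.isUnit_transpose _).2 (isUnit_monoMat d)
  exact (Matrix.mulVec_injective_iff_isUnit.2 hT) (by rw [h, mulVec_zero])

theorem hess_mul_optimum_add_one (d n : ℕ) : hess d n * (optimum d n + 1) = excess d n := by
  rw [mul_add, hess_mul_optimum, mul_one, hess]
  abel

theorem hess_apply_eq_zero {d : ℕ} (n : ℕ) {p q : Idx d} (h : p ≠ q) (hq : q ∉ block d) :
    hess d n p q = 0 := by
  rw [hess, Matrix.add_apply, excess_eq_zero' n h hq, monoGram_of_ne h, if_neg, add_zero]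
  rintro (⟨_, h1⟩ | ⟨_, h1⟩)
  · exact hq (h1 ▸ origin_mem_block d)
  · exact hq h1.mem_block

theorem one_le_hess_self {d : ℕ} (n : ℕ) (q : Idx d) : 1 ≤ hess d n q q := by
  rw [hess, Matrix.add_apply]
  linarith [one_le_monoGram_self q, excess_self_nonneg n q]

/-- Energy estimate: with `s = |Az|²`, one has `s ≤ zᵀHz = ⟨z, T_q⟩ ≤ max |z| · ‖T_q‖₁ ≤ √s · 3θ`.
The pairing of maximum and `ℓ¹` norms postpones the loss of `3d` to the last step, where it occurs
once. -/
theorem sum_sq_column_le {d : ℕ} (hd : 1 ≤ d) (n : ℕ) (q : Idx d) {z : Idx d → ℝ}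
    (hz : hess d n *ᵥ z = (excess d n)ᵀ q) : ∑ p, z p ^ 2 ≤ 27 * d * theta d n ^ 2 := by
  have hθ := theta_nonneg d n
  set s := ∑ r, (monoMat d *ᵥ z) r ^ 2 with hs
  have hs0 : 0 ≤ s := Finset.sum_nonneg fun _ _ => sq_nonneg _
  have h1 : s ≤ z ⬝ᵥ (excess d n)ᵀ q := hz ▸ sum_sq_monoMat_le_hess n z
  have hz1 : ∀ p, |z p| ≤ √s := fun p => Real.abs_le_sqrt (sq_le_sum_sq_monoMat z p)
  have h2 : z ⬝ᵥ (excess d n)ᵀ q ≤ √s * (3 * theta d n) := by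
    calc z ⬝ᵥ (excess d n)ᵀ q ≤ ∑ p, √s * |excess d n p q| := by
          refine Finset.sum_le_sum fun p _ => ?_
          refine (le_abs_self _).trans ?_
          rw [abs_mul]
          exact mul_le_mul_of_nonneg_right (hz1 p) (abs_nonneg _)
      _ = √s * ∑ p, |excess d n p q| := by rw [Finset.mul_sum]
      _ ≤ √s * (3 * theta d n) := by
          gcongr
          rw [← Finset.add_sum_erase _ _ (Finset.mem_univ q), abs_of_nonneg (excess_self_nonneg n q)]
          have a1 := excess_self_le hd n q
          have a2 := sum_abs_excess_le hd n q
          split_ifs at a2 <;> linarith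
  have h3 : √s ≤ 3 * theta d n := by
    by_contra! hlt
    have hpos : 0 < √s := lt_of_le_of_lt (by positivity) hlt
    have h4 := h1.trans h2
    rw [← Real.mul_self_sqrt hs0] at h4
    nlinarith [mul_lt_mul_of_pos_left hlt hpos, Real.mul_self_sqrt hs0]
  have h4 : s ≤ 9 * theta d n ^ 2 := by
    rw [← Real.sq_sqrt hs0]
    nlinarith [Real.sqrt_nonneg s]
  calc ∑ p, z p ^ 2 ≤ 3 * d * s := sum_sq_le hd z
    _ ≤ 3 * d * (9 * theta d n ^ 2) := by gcongr
    _ = _ := by ring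

/-- Off the block the column of `hess` is diagonal, so the linear system is a scalar equation and no
factor `d` is lost. -/
theorem sum_sq_column_le_of_notMem {d : ℕ} (hd : 1 ≤ d) (n : ℕ) {q : Idx d} (hq : q ∉ block d)
    {z : Idx d → ℝ} (hz : hess d n *ᵥ z = (excess d n)ᵀ q) : ∑ p, z p ^ 2 ≤ theta d n ^ 2 := by
  have hT := one_le_hess_self n q
  have h1 : z = Pi.single q (excess d n q q / hess d n q q) := by
    rw [← sub_eq_zero]
    apply hess_mulVec_injective n
    rw [mulVec_sub, hz, sub_eq_zero]
    funext p
    rw [transpose_apply, mulVec_single]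
    simp only [Matrix.col_apply, Pi.smul_apply, MulOpposite.smul_eq_mul_unop, MulOpposite.unop_op]
    by_cases hp : p = q
    · subst hp; field_simp
    · rw [excess_eq_zero' n hp hq, hess_apply_eq_zero n hp hq, zero_mul]
  have h2 : ∑ p, z p ^ 2 = (excess d n q q / hess d n q q) ^ 2 := by
    rw [h1, Finset.sum_eq_single q]
    · simp
    · intro p _ hp; simp [hp]
    · simp
  rw [h2]
  have h3 := excess_self_nonneg n q
  gcongr
  exact (div_le_self h3 hT).trans (excess_self_le hd n q)

/-- The unconstrained minimiser is close to `-1`. -/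
theorem frobSq_optimum_add_one_le {d : ℕ} (hd : 1 ≤ d) (n : ℕ) :
    frobSq (optimum d n + 1) ≤ (8 * d * theta d n) ^ 2 := by
  have hcol : ∀ q, hess d n *ᵥ (optimum d n + 1)ᵀ q = (excess d n)ᵀ q := by
    intro q
    rw [← hess_mul_optimum_add_one]
    rfl
  have hd' : (1 : ℝ) ≤ d := by exact_mod_cast hd
  calc frobSq (optimum d n + 1) = ∑ q, ∑ p, (optimum d n + 1)ᵀ q p ^ 2 := by
        rw [frobSq, Finset.sum_comm]; rfl
    _ ≤ ∑ q, (theta d n ^ 2 + if q ∈ block d then 27 * d * theta d n ^ 2 else 0) := by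
        refine Finset.sum_le_sum fun q _ => ?_
        split_ifs with hq
        · have := sum_sq_column_le hd n q (hcol q)
          nlinarith [sq_nonneg (theta d n)]
        · simpa using sum_sq_column_le_of_notMem hd n hq (hcol q)
    _ = Fintype.card (Idx d) * theta d n ^ 2 + (block d).card * (27 * d * theta d n ^ 2) := by
        rw [Finset.sum_add_distrib, Finset.sum_ite_mem, Finset.univ_inter]; simp
    _ ≤ (3 * d ^ 2) * theta d n ^ 2 + (2 * d) * (27 * d * theta d n ^ 2) := by
        gcongr
        · exact card_Idx_le hd
        · exact card_block_le hd
    -- `3 + 2 · 27 = 57 ≤ 64`.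
    _ ≤ (8 * d * theta d n) ^ 2 := by nlinarith [sq_nonneg (d * theta d n)]

/-! ### Symmetric competitors of the optimal diagonal matrix -/

/-- The optimal diagonal entries. -/
def diagOpt (d n : ℕ) : Idx d → ℝ := fun q => monoGram d q q / hess d n q q

theorem diagOpt_le_one {d : ℕ} (n : ℕ) (q : Idx d) : diagOpt d n q ≤ 1 := by
  have h := one_le_hess_self n q
  rw [diagOpt, div_le_one (by linarith), hess, Matrix.add_apply]
  linarith [excess_self_nonneg n q]

theorem diagOpt_pos {d : ℕ} (n : ℕ) (q : Idx d) : 0 < diagOpt d n q :=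
  div_pos (by linarith [one_le_monoGram_self q]) (by linarith [one_le_hess_self n q])

theorem one_sub_diagOpt_le {d : ℕ} (hd : 1 ≤ d) (n : ℕ) (q : Idx d) :
    1 - diagOpt d n q ≤ theta d n := by
  have h := one_le_hess_self n q
  have e : 1 - diagOpt d n q = excess d n q q / hess d n q q := by
    rw [diagOpt, eq_div_iff (by linarith), sub_mul, div_mul_cancel₀ _ (by linarith), hess,
      Matrix.add_apply]
    ring
  rw [e]
  exact (div_le_self (excess_self_nonneg n q) h).trans (excess_self_le hd n q)

theorem monoGram_nonneg_of_ne {d : ℕ} {p q : Idx d} (h : p ≠ q) : 0 ≤ monoGram d p q := by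
  rw [monoGram_of_ne h]; split_ifs <;> positivity

/-- Off the diagonal, `monoGram` lives on the row and column of the origin. Symmetry moves the
column entry `E p 0` to `E 0 p`, so that it is measured by the norm of column `p`; bounding all of
column `0` by its own norm would cost a further `√d`. -/
theorem abs_mul_monoGram_le {d : ℕ} {E : Matrix (Idx d) (Idx d) ℝ} (hE : Eᵀ = E) {p q : Idx d}
    (h : p ≠ q) : |E p q| * monoGram d p q
      ≤ (if q = origin d then if p ∈ block d then 3 / 2 * |E (origin d) p| else 0 else 0)
        + (if p = origin d then if q ∈ block d then 3 / 2 * |E (origin d) q| else 0 else 0) := by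
  have h2 : √2 ≤ 3 / 2 := Real.sqrt_le_iff.2 ⟨by norm_num, by norm_num⟩
  have hs : ∀ r : Idx d, |E r (origin d)| = |E (origin d) r| := fun r => by
    conv_lhs => rw [← hE, transpose_apply]
  rw [monoGram_of_ne h]
  by_cases hq : q = origin d
  · subst hq
    have hp : p ≠ origin d := h
    simp only [if_true, hp, if_false, add_zero, and_true, false_and, or_false, hs]
    by_cases hD : IsDiag p
    · simp only [hD, if_true, hD.mem_block]
      rw [mul_comm]
      gcongr
    · simp only [hD, if_false, mul_zero]
      split_ifs <;> positivity
  · by_cases hp : p = origin d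
    · subst hp
      simp only [if_true, hq, if_false, zero_add, and_false, true_and, false_or]
      by_cases hD : IsDiag q
      · simp only [hD, if_true, hD.mem_block]
        rw [mul_comm]
        gcongr
      · simp only [hD, if_false, mul_zero]
        split_ifs <;> positivity
    · simp [hp, hq]

/-- With `S = monoGram`, the residual `S - H h` is `S (1 - h) - T h` entrywise, where `0 ≤ 1 - h ≤
θ` and `h ≤ 1`. -/
theorem entry_pairing_le {d : ℕ} (hd : 1 ≤ d) (n : ℕ) {E : Matrix (Idx d) (Idx d) ℝ}
    (hE : Eᵀ = E) {p q : Idx d} (h : p ≠ q) :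
    E p q * (monoGram d p q - hess d n p q * diagOpt d n q)
      ≤ |E p q| * |excess d n p q| + theta d n *
        ((if q = origin d then if p ∈ block d then 3 / 2 * |E (origin d) p| else 0 else 0)
        + (if p = origin d then if q ∈ block d then 3 / 2 * |E (origin d) q| else 0 else 0)) := by
  have hθ := theta_nonneg d n
  have a2 : monoGram d p q - hess d n p q * diagOpt d n q
      = monoGram d p q * (1 - diagOpt d n q) - excess d n p q * diagOpt d n q := by
    rw [hess, Matrix.add_apply]; ring
  have a3 := one_sub_diagOpt_le hd n q
  have a4 := diagOpt_le_one n q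
  have a5 := diagOpt_pos n q
  have a6 := monoGram_nonneg_of_ne h
  calc E p q * (monoGram d p q - hess d n p q * diagOpt d n q)
      ≤ |E p q| * |monoGram d p q * (1 - diagOpt d n q) - excess d n p q * diagOpt d n q| := by
        rw [a2, ← abs_mul]; exact le_abs_self _
    _ ≤ |E p q| * (monoGram d p q * theta d n + |excess d n p q|) := by
        refine mul_le_mul_of_nonneg_left ?_ (abs_nonneg _)
        refine (abs_sub _ _).trans (add_le_add ?_ ?_)
        · rw [abs_mul, abs_of_nonneg a6, abs_of_nonneg (by linarith : 0 ≤ 1 - diagOpt d n q)]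
          exact mul_le_mul_of_nonneg_left a3 a6
        · rw [abs_mul, abs_of_nonneg a5.le]
          exact mul_le_of_le_one_right (abs_nonneg _) a4
    _ = |E p q| * |excess d n p q| + theta d n * (|E p q| * monoGram d p q) := by ring
    _ ≤ _ := by
        exact add_le_add le_rfl (mul_le_mul_of_nonneg_left (abs_mul_monoGram_le hE h) hθ)

theorem column_pairing_le {d : ℕ} (hd : 1 ≤ d) (n : ℕ) {E : Matrix (Idx d) (Idx d) ℝ}
    (hE : Eᵀ = E) {φ : Idx d → ℝ} (hφ : ∀ p q, |E p q| ≤ φ q) (q : Idx d) :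
    ∑ p, E p q * (monoGram d p q - hess d n p q * diagOpt d n q)
      ≤ (if q ∈ block d then 2 * theta d n * φ q else 0) + theta d n *
        ((if q = origin d then 3 / 2 * ∑ r ∈ block d, φ r else 0)
          + if q ∈ block d then 3 / 2 * φ q else 0) := by
  have hθ := theta_nonneg d n
  have hφ0 : ∀ q, 0 ≤ φ q := fun q => (abs_nonneg _).trans (hφ q q)
  -- Stationarity of `diagOpt` in each diagonal direction.
  have hdiag : E q q * (monoGram d q q - hess d n q q * diagOpt d n q) = 0 := by
    have : hess d n q q * diagOpt d n q = monoGram d q q := by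
      rw [diagOpt, mul_div_cancel₀ _ (by linarith [one_le_hess_self n q])]
    rw [this]; ring
  rw [← Finset.add_sum_erase _ _ (Finset.mem_univ q), hdiag, zero_add]
  refine (Finset.sum_le_sum fun p hp => entry_pairing_le hd n hE (Finset.ne_of_mem_erase hp)).trans ?_
  rw [Finset.sum_add_distrib, ← Finset.mul_sum]
  refine add_le_add ?_ (mul_le_mul_of_nonneg_left ?_ hθ)
  · have h1 := mul_le_mul_of_nonneg_left (sum_abs_excess_le hd n q) (hφ0 q)
    rw [Finset.mul_sum] at h1
    refine ((Finset.sum_le_sum fun p _ =>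
      mul_le_mul_of_nonneg_right (hφ p q) (abs_nonneg _)).trans h1).trans (le_of_eq ?_)
    split_ifs <;> ring
  · refine (Finset.sum_le_sum_of_subset_of_nonneg (Finset.subset_univ _) fun p _ _ => ?_).trans ?_
    · refine add_nonneg ?_ ?_ <;> split_ifs <;> positivity
    rw [Finset.sum_add_distrib]
    refine add_le_add ?_ ?_
    · split_ifs
      · rw [Finset.sum_ite_mem, Finset.univ_inter, ← Finset.mul_sum]
        exact mul_le_mul_of_nonneg_left (Finset.sum_le_sum fun r _ => hφ _ _) (by norm_num)
      · simp
    · rw [Finset.sum_ite_eq' Finset.univ (origin d), if_pos (Finset.mem_univ _)]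
      split_ifs
      · exact mul_le_mul_of_nonneg_left (hφ _ _) (by norm_num)
      · exact le_rfl

theorem sum_pairing_le {d : ℕ} (hd : 1 ≤ d) (n : ℕ) {E : Matrix (Idx d) (Idx d) ℝ}
    (hE : Eᵀ = E) {φ : Idx d → ℝ} (hφ : ∀ p q, |E p q| ≤ φ q) :
    ∑ q, ∑ p, E p q * (monoGram d p q - hess d n p q * diagOpt d n q)
      ≤ 5 * theta d n * ∑ q ∈ block d, φ q := by
  refine (Finset.sum_le_sum fun q _ => column_pairing_le hd n hE hφ q).trans (le_of_eq ?_)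
  rw [Finset.sum_add_distrib, ← Finset.mul_sum, Finset.sum_add_distrib, Finset.sum_ite_mem,
    Finset.sum_ite_mem, Finset.univ_inter, ← Finset.mul_sum, ← Finset.mul_sum,
    Finset.sum_ite_eq' Finset.univ (origin d), if_pos (Finset.mem_univ _)]
  ring

/-- The first order optimality gap of a symmetric competitor of the optimal diagonal matrix. -/
theorem frobSq_monoMat_mul_sub_diagOpt_le {d n : ℕ} {H : Matrix (Idx d) (Idx d) ℝ}
    (hle : popLoss d n (-H) ≤ popLoss d n (-diagonal (diagOpt d n))) :
    frobSq (monoMat d * (H - diagonal (diagOpt d n))) ≤ 2 * ∑ q, ∑ p,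
      (H - diagonal (diagOpt d n)) p q * (monoGram d p q - hess d n p q * diagOpt d n q) := by
  set h := diagOpt d n with hh
  set E := H - diagonal h with hE
  have hexp := popLoss_add (n := n) (-diagonal h) (-E)
  have e0 : -diagonal h + -E = -H := by rw [hE]; abel
  rw [e0] at hexp
  have e1 : trace ((-E)ᵀ * (hess d n * -diagonal h + monoGram d))
      = -∑ q, ∑ p, E p q * (monoGram d p q - hess d n p q * h q) := by
    simp only [trace, diag_apply, Matrix.mul_apply, transpose_apply, Matrix.neg_apply, mul_neg,
      neg_mul, Finset.sum_neg_distrib, Matrix.add_apply]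
    congr 1
    refine Finset.sum_congr rfl fun q _ => Finset.sum_congr rfl fun p _ => ?_
    have : ∑ r, hess d n p r * diagonal h r q = hess d n p q * h q := by
      simp [diagonal_apply]
    rw [this]; ring
  have e2 : trace ((-E)ᵀ * hess d n * -E) = trace (Eᵀ * hess d n * E) := by
    simp
  rw [e1, e2] at hexp
  have := frobSq_monoMat_mul_le n E
  linarith

/-- A symmetric matrix that does at least as well as the optimal diagonal one is close to it. -/
theorem frobSq_sub_diagOpt_le {d : ℕ} (hd : 1 ≤ d) (n : ℕ) {H : Matrix (Idx d) (Idx d) ℝ}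
    (hH : Hᵀ = H) (hle : popLoss d n (-H) ≤ popLoss d n (-diagonal (diagOpt d n))) :
    frobSq (H - diagonal (diagOpt d n)) ≤ (25 * d * theta d n) ^ 2 := by
  have hd' : (1 : ℝ) ≤ d := by exact_mod_cast hd
  have hθ := theta_nonneg d n
  have h1 := frobSq_monoMat_mul_sub_diagOpt_le hle
  have hEs : (H - diagonal (diagOpt d n))ᵀ = H - diagonal (diagOpt d n) := by
    rw [transpose_sub, hH, diagonal_transpose]
  generalize H - diagonal (diagOpt d n) = E at h1 hEs ⊢
  obtain ⟨F, hF⟩ : ∃ F, F = monoMat d * E := ⟨_, rfl⟩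
  rw [← hF] at h1
  have hcol0 : ∀ q, 0 ≤ ∑ p, F p q ^ 2 := fun q => Finset.sum_nonneg fun _ _ => sq_nonneg _
  -- Column norms of `F = A E`, which dominate every entry of the corresponding column of `E`.
  obtain ⟨φ, hφd⟩ : ∃ φ : Idx d → ℝ, ∀ q, φ q = √(∑ p, F p q ^ 2) := ⟨_, fun _ => rfl⟩
  have hφ0 : ∀ q, 0 ≤ φ q := fun q => hφd q ▸ Real.sqrt_nonneg _
  have hφ : ∀ p q, |E p q| ≤ φ q := by
    intro p q
    rw [hφd, hF]
    exact Real.abs_le_sqrt (sq_le_sum_sq_monoMat (Eᵀ q) p)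
  have hFφ : frobSq F = ∑ q, φ q ^ 2 := by
    rw [frobSq, Finset.sum_comm]
    exact Finset.sum_congr rfl fun q _ => by rw [hφd, Real.sq_sqrt (hcol0 q)]
  have h2 := sum_pairing_le hd n hEs hφ
  have h3 : (∑ q ∈ block d, φ q) ^ 2 ≤ 2 * d * frobSq F := by
    calc (∑ q ∈ block d, φ q) ^ 2 ≤ (block d).card * ∑ q ∈ block d, φ q ^ 2 :=
          sq_sum_le_card_mul_sum_sq
      _ ≤ 2 * d * ∑ q, φ q ^ 2 := by
          refine mul_le_mul (card_block_le hd) ?_ (Finset.sum_nonneg fun _ _ => sq_nonneg _)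
            (by positivity)
          exact Finset.sum_le_sum_of_subset_of_nonneg (Finset.subset_univ _)
            fun _ _ _ => sq_nonneg _
      _ = _ := by rw [hFφ]
  have hΦ0 : 0 ≤ ∑ q ∈ block d, φ q := Finset.sum_nonneg fun q _ => hφ0 q
  generalize ∑ q ∈ block d, φ q = Φ at h2 h3 hΦ0
  have h5 : frobSq F ≤ 10 * theta d n * Φ := by linarith
  -- Self-improvement: Cauchy–Schwarz bounds `Φ²` by `2d ‖F‖²`, while the first-order gap bounds
  -- `‖F‖²` by `10θΦ`.
  have h4 : Φ ≤ 20 * d * theta d n := by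
    by_contra! hlt
    have hpos : 0 < Φ := lt_of_le_of_lt (by positivity) hlt
    have : Φ ^ 2 ≤ 2 * d * (10 * theta d n * Φ) :=
      h3.trans (mul_le_mul_of_nonneg_left h5 (by positivity))
    nlinarith [mul_lt_mul_of_pos_right hlt hpos]
  calc frobSq E = ∑ q, ∑ p, Eᵀ q p ^ 2 := by rw [frobSq, Finset.sum_comm]; rfl
    _ ≤ ∑ q, 3 * d * ∑ p, F p q ^ 2 := by
        rw [hF]
        exact Finset.sum_le_sum fun q _ => sum_sq_le hd (Eᵀ q)
    _ = 3 * d * frobSq F := by rw [← Finset.mul_sum, frobSq, Finset.sum_comm]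
    _ ≤ 3 * d * (10 * theta d n * (20 * d * theta d n)) :=
        mul_le_mul_of_nonneg_left (h5.trans (mul_le_mul_of_nonneg_left h4 (by positivity)))
          (by positivity)
    _ ≤ (25 * d * theta d n) ^ 2 := by nlinarith [sq_nonneg (d * theta d n)]

theorem sum_sq_mulVec_le {ι : Type*} [Fintype ι] (X : Matrix ι ι ℝ) (z : ι → ℝ) :
    ∑ p, (X *ᵥ z) p ^ 2 ≤ frobSq X * ∑ p, z p ^ 2 := by
  rw [frobSq, Finset.sum_mul]
  exact Finset.sum_le_sum fun p _ => Finset.sum_mul_sq_le_sq_mul_sq _ _ _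

theorem abs_dotProduct_mulVec_le {ι : Type*} [Fintype ι] {X : Matrix ι ι ℝ} {c : ℝ} (hc : 0 ≤ c)
    (hX : frobSq X ≤ c ^ 2) (z : ι → ℝ) : |z ⬝ᵥ X *ᵥ z| ≤ c * ∑ p, z p ^ 2 := by
  have hs : 0 ≤ ∑ p, z p ^ 2 := Finset.sum_nonneg fun _ _ => sq_nonneg _
  refine abs_le_of_sq_le_sq ?_ (by positivity)
  calc (z ⬝ᵥ X *ᵥ z) ^ 2 ≤ (∑ p, z p ^ 2) * ∑ p, (X *ᵥ z) p ^ 2 :=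
        Finset.sum_mul_sq_le_sq_mul_sq _ _ _
    _ ≤ (∑ p, z p ^ 2) * (frobSq X * ∑ p, z p ^ 2) := by
        gcongr; exact sum_sq_mulVec_le X z
    _ ≤ (∑ p, z p ^ 2) * (c ^ 2 * ∑ p, z p ^ 2) := by gcongr
    _ = _ := by ring

/-- A symmetric matrix that does at least as well as the optimal diagonal one is coercive. -/
theorem half_sum_sq_le {d : ℕ} (hd : 1 ≤ d) (n : ℕ) (hθ : 52 * d * theta d n ≤ 1)
    {H : Matrix (Idx d) (Idx d) ℝ} (hH : Hᵀ = H)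
    (hle : popLoss d n (-H) ≤ popLoss d n (-diagonal (diagOpt d n))) (z : Idx d → ℝ) :
    1 / 2 * ∑ p, z p ^ 2 ≤ z ⬝ᵥ H *ᵥ z := by
  have hd' : (1 : ℝ) ≤ d := by exact_mod_cast hd
  have h0 := theta_nonneg d n
  have h1 := abs_dotProduct_mulVec_le (by positivity) (frobSq_sub_diagOpt_le hd n hH hle) z
  rw [sub_mulVec, dotProduct_sub] at h1
  have h2 : (1 - theta d n) * ∑ p, z p ^ 2 ≤ z ⬝ᵥ diagonal (diagOpt d n) *ᵥ z := by
    rw [Finset.mul_sum]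
    refine Finset.sum_le_sum fun p _ => ?_
    rw [mulVec_diagonal]
    have := one_sub_diagOpt_le hd n p
    nlinarith [sq_nonneg (z p)]
  have h3 := neg_le_of_abs_le h1
  have hs : 0 ≤ ∑ p, z p ^ 2 := Finset.sum_nonneg fun _ _ => sq_nonneg _
  have h4 : theta d n ≤ d * theta d n := le_mul_of_one_le_left h0 hd'
  -- `1 - θ - 25dθ ≥ 1 - 26dθ ≥ 1/2`, which explains the `52` in the hypothesis.
  nlinarith

/-! ### Frobenius norms under a change of coordinates -/

theorem frobSq_transpose {ι : Type*} [Fintype ι] (X : Matrix ι ι ℝ) : frobSq Xᵀ = frobSq X := by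
  rw [frobSq, Finset.sum_comm]; rfl

/-- The coercivity hypothesis bounds the squared operator norm of `M⁻¹` by `c`. The rows of `X` meet
the transpose of `M⁻¹`, and `key` passes the bound to it by duality. -/
theorem frobSq_mul_inv_le {ι : Type*} [Fintype ι] [DecidableEq ι] {M : Matrix ι ι ℝ} {c : ℝ}
    (hc : 0 ≤ c) (hM : IsUnit M) (h : ∀ z : ι → ℝ, ∑ p, z p ^ 2 ≤ c * ∑ p, (M *ᵥ z) p ^ 2)
    (X : Matrix ι ι ℝ) : frobSq (X * M⁻¹) ≤ c * frobSq X := by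
  have hdet := (Matrix.isUnit_iff_isUnit_det _).1 hM
  have key : ∀ y : ι → ℝ, ∑ p, (y ᵥ* M⁻¹) p ^ 2 ≤ c * ∑ p, y p ^ 2 := by
    intro y
    set u := y ᵥ* M⁻¹ with hu
    set s := ∑ p, u p ^ 2 with hs
    have hs0 : 0 ≤ s := Finset.sum_nonneg fun _ _ => sq_nonneg _
    have hy0 : 0 ≤ ∑ p, y p ^ 2 := Finset.sum_nonneg fun _ _ => sq_nonneg _
    have h1 : s = y ⬝ᵥ M⁻¹ *ᵥ u := by
      rw [dotProduct_mulVec, ← hu]; simp [dotProduct, sq, hs]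
    have h2 : ∑ p, (M⁻¹ *ᵥ u) p ^ 2 ≤ c * s := by
      refine (h (M⁻¹ *ᵥ u)).trans (le_of_eq ?_)
      rw [mulVec_mulVec, Matrix.mul_nonsing_inv _ hdet, one_mulVec]
    have h3 : s ^ 2 ≤ (∑ p, y p ^ 2) * (c * s) := by
      calc s ^ 2 = (y ⬝ᵥ M⁻¹ *ᵥ u) ^ 2 := by rw [← h1]
        _ ≤ (∑ p, y p ^ 2) * ∑ p, (M⁻¹ *ᵥ u) p ^ 2 := Finset.sum_mul_sq_le_sq_mul_sq _ _ _
        _ ≤ _ := by gcongr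
    by_contra! hlt
    have hpos : 0 < s := lt_of_le_of_lt (by positivity) hlt
    nlinarith [mul_lt_mul_of_pos_right hlt hpos]
  rw [frobSq, frobSq, Finset.mul_sum]
  exact Finset.sum_le_sum fun p _ => key (X p)

theorem frobSq_congr_inv_le {ι : Type*} [Fintype ι] [DecidableEq ι] {M : Matrix ι ι ℝ} {c : ℝ}
    (hc : 0 ≤ c) (hM : IsUnit M) (h : ∀ z : ι → ℝ, ∑ p, z p ^ 2 ≤ c * ∑ p, (M *ᵥ z) p ^ 2)
    (X : Matrix ι ι ℝ) : frobSq ((M⁻¹)ᵀ * X * M⁻¹) ≤ c ^ 2 * frobSq X := by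
  refine (frobSq_mul_inv_le hc hM h _).trans ?_
  have h1 := frobSq_mul_inv_le hc hM h Xᵀ
  rw [← frobSq_transpose, transpose_mul, transpose_transpose, frobSq_transpose] at h1
  rw [sq, mul_assoc]
  gcongr

/-! ### The feature matrix of the bilinear layer -/

/-- The index pair `(0, j)`. -/
def zeroIdx {d : ℕ} (j : Fin (d + 1)) : Idx d := ⟨(0, j), Fin.zero_le j⟩

/-- The coefficients of the product of two linear forms in the monomials. -/
def prodCoeff {d : ℕ} (a b : Fin (d + 1) → ℝ) (q : Idx d) : ℝ :=
  if q.1.1 = q.1.2 then a q.1.1 * b q.1.1 else a q.1.1 * b q.1.2 + a q.1.2 * b q.1.1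

theorem sum_Idx {d : ℕ} (f : Fin (d + 1) × Fin (d + 1) → ℝ) :
    ∑ p, f p = ∑ q : Idx d, if q.1.1 = q.1.2 then f q.1 else f q.1 + f q.1.swap := by
  have h1 : ∑ q : Idx d, (if q.1.1 = q.1.2 then f q.1 else f q.1 + f q.1.swap)
      = ∑ q ∈ Finset.univ.filter (fun p : Fin (d + 1) × Fin (d + 1) => p.1 ≤ p.2),
          (if q.1 = q.2 then f q else f q + f q.swap) :=
    (Finset.sum_subtype _ (by simp)
      (fun q : Fin (d + 1) × Fin (d + 1) => if q.1 = q.2 then f q else f q + f q.swap)).symm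
  have h2 : ∑ q ∈ Finset.univ.filter (fun p : Fin (d + 1) × Fin (d + 1) => ¬ p.1 ≤ p.2), f q
      = ∑ q : Fin (d + 1) × Fin (d + 1), if q.1 < q.2 then f q.swap else 0 := by
    rw [Finset.sum_filter, ← (Equiv.prodComm (Fin (d + 1)) (Fin (d + 1))).sum_comp]
    simp
  rw [h1, ← Finset.sum_filter_add_sum_filter_not Finset.univ
    (fun p : Fin (d + 1) × Fin (d + 1) => p.1 ≤ p.2), h2, Finset.sum_filter, Finset.sum_filter,
    ← Finset.sum_add_distrib]
  refine Finset.sum_congr rfl fun q _ => ?_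
  rcases lt_trichotomy q.1 q.2 with h | h | h
  · simp [h, h.le, h.ne]
  · simp [h]
  · simp [h.not_ge, h.not_gt]

theorem linear_mul_linear {d : ℕ} (a b : Fin (d + 1) → ℝ) (x : Fin d → ℝ) :
    (∑ j, a j * homog x j) * (∑ j, b j * homog x j) = ∑ q, prodCoeff a b q * mono x q := by
  rw [Finset.sum_mul_sum, ← Finset.sum_product', Finset.univ_product_univ, sum_Idx]
  refine Finset.sum_congr rfl fun q _ => ?_
  simp only [prodCoeff, mono]
  split_ifs with h
  · rw [← h]; ring
  · simp only [Prod.fst_swap, Prod.snd_swap]; ring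

theorem mulVec_embed {d : ℕ} (W : Matrix (Idx d) (Idx d) ℝ) (x : Fin d → ℝ) (p : Idx d) :
    (W *ᵥ embed x) p = ∑ j, W p (zeroIdx j) * homog x j := by
  have h : ∑ j : Fin (d + 1), W p (zeroIdx j) * homog x j
      = ∑ q ∈ Finset.univ.image (zeroIdx (d := d)), W p q * embed x q := by
    rw [Finset.sum_image (fun i _ j _ hij => by simpa [zeroIdx] using hij)]
    exact Finset.sum_congr rfl fun j _ => by simp [embed, zeroIdx]
  rw [h]
  refine (Finset.sum_subset (Finset.subset_univ _) fun q _ hq => ?_).symm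
  have : q.1.1 ≠ 0 := by
    intro h0
    apply hq
    refine Finset.mem_image.2 ⟨q.1.2, Finset.mem_univ _, ?_⟩
    ext1
    exact Prod.ext h0.symm rfl
  simp [embed, this]

/-- The coefficients of the features of the bilinear layer in the monomials. -/
def featureCoeff {d : ℕ} (W₀ W₁ : Matrix (Idx d) (Idx d) ℝ) : Matrix (Idx d) (Idx d) ℝ :=
  Matrix.of fun p q => (if p = q ∧ p.1.1 = 0 then 1 else 0)
    + prodCoeff (fun j => W₀ p (zeroIdx j)) (fun j => W₁ p (zeroIdx j)) q

/-- The matrix of the features of the bilinear layer in the orthonormal features. -/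
def featureMat {d : ℕ} (W₀ W₁ : Matrix (Idx d) (Idx d) ℝ) : Matrix (Idx d) (Idx d) ℝ :=
  featureCoeff W₀ W₁ * monoMat d

theorem bilinFeature_eq {d : ℕ} (W₀ W₁ : Matrix (Idx d) (Idx d) ℝ) (x : Fin d → ℝ) :
    bilinFeature W₀ W₁ x = featureMat W₀ W₁ *ᵥ basisFeature x := by
  rw [featureMat, ← mulVec_mulVec, monoMat_mulVec_basisFeature]
  funext p
  simp only [bilinFeature, mulVec_embed, linear_mul_linear]
  simp only [featureCoeff, Matrix.mulVec, dotProduct, Matrix.of_apply, add_mul,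
    Finset.sum_add_distrib]
  congr 1
  rw [Finset.sum_eq_single p]
  · by_cases h : p.1.1 = 0 <;> simp [embed, mono, h, homog]
  · intro q _ hq
    have : ¬ p = q := fun h => hq h.symm
    simp [this]
  · simp

/-- Every diagonal feature matrix is implemented by some bilinear layer. -/
theorem exists_bilinFeature_diagonal {d : ℕ} (m : Idx d → ℝ) :
    ∃ W₀ W₁ : Matrix (Idx d) (Idx d) ℝ,
      ∀ x, bilinFeature W₀ W₁ x = diagonal m *ᵥ basisFeature x := by
  -- The residual connection already supplies `1` and `x[j]` in the rows `(0, j)`, so the product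
  -- adds `m p - 1` times that entry. For `(i, i)` the factors are `m p / √2 * (x[i] - 1)` and `x[i]
  -- + 1`; for `i < j` they are `m p * x[i]` and `x[j]`.
  let a : Idx d → Fin (d + 1) → ℝ := fun p j =>
    if p.1.1 = 0 then (if j = 0 then 1 else 0) else if p.1.1 = p.1.2 then
      m p / √2 * ((if j = p.1.1 then 1 else 0) - (if j = 0 then 1 else 0))
      else m p * (if j = p.1.1 then 1 else 0)
  let b : Idx d → Fin (d + 1) → ℝ := fun p j =>
    if p.1.1 = 0 then (m p - 1) * (if j = p.1.2 then 1 else 0) else if p.1.1 = p.1.2 then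
      (if j = p.1.1 then 1 else 0) + (if j = 0 then 1 else 0)
      else (if j = p.1.2 then 1 else 0)
  refine ⟨Matrix.of fun p q => a p q.1.2, Matrix.of fun p q => b p q.1.2, fun x => ?_⟩
  funext p
  rw [mulVec_diagonal]
  simp only [bilinFeature, mulVec_embed, Matrix.of_apply, zeroIdx]
  have h0 : homog x 0 = 1 := rfl
  by_cases hp : p.1.1 = 0
  · simp only [a, b, hp, if_true, mul_ite, ite_mul, mul_one, mul_zero, zero_mul,
      Finset.sum_ite_eq', Finset.mem_univ, h0, basisFeature, embed, one_mul]
    simp only [ne_eq, not_true_eq_false, and_false, if_false]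
    ring
  · by_cases hq : p.1.1 = p.1.2
    · have hD : p.1.1 = p.1.2 ∧ p.1.1 ≠ 0 := ⟨hq, hp⟩
      simp only [a, b, hp, if_false, if_pos hq, basisFeature, if_pos hD, embed, zero_add]
      simp only [mul_assoc, sub_mul, add_mul, ite_mul, one_mul, zero_mul, ← Finset.mul_sum,
        Finset.sum_sub_distrib, Finset.sum_add_distrib, Finset.sum_ite_eq', Finset.mem_univ,
        if_true, h0]
      ring
    · have hD : ¬ (p.1.1 = p.1.2 ∧ p.1.1 ≠ 0) := fun h => hq h.1
      simp only [a, b, hp, if_false, if_neg hq, basisFeature, if_neg hD, embed, zero_add]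
      simp only [mul_assoc, ite_mul, one_mul, zero_mul, ← Finset.mul_sum,
        Finset.sum_ite_eq', Finset.mem_univ, if_true]

/-! ### Existence of minimisers of the first stage -/

/-- The symmetrised products satisfy `∑ (aᵢbⱼ + aⱼbᵢ)² = 2|a|²|b|² + 2⟨a, b⟩²`, so no cancellation
can hide large factors behind a small quadratic form. -/
theorem sum_sq_mul_sum_sq_le {d : ℕ} {a b : Fin (d + 1) → ℝ} {R : ℝ}
    (h : ∀ q : Idx d, |prodCoeff a b q| ≤ R) :
    (∑ i, a i ^ 2) * (∑ j, b j ^ 2) ≤ 2 * ((d : ℝ) + 1) ^ 2 * R ^ 2 := by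
  have hR : 0 ≤ R := (abs_nonneg _).trans (h (origin d))
  have h1 : ∀ i j : Fin (d + 1), (a i * b j + a j * b i) ^ 2 ≤ (2 * R) ^ 2 := by
    have key : ∀ i j : Fin (d + 1), i ≤ j → (a i * b j + a j * b i) ^ 2 ≤ (2 * R) ^ 2 := by
      intro i j hij
      have h2 := h ⟨(i, j), hij⟩
      rw [sq_le_sq, abs_of_nonneg (by positivity : 0 ≤ 2 * R)]
      simp only [prodCoeff] at h2
      split_ifs at h2 with he
      · rw [← he, ← two_mul, abs_mul, abs_two]
        linarith
      · linarith
    intro i j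
    rcases le_total i j with hij | hij
    · exact key i j hij
    · rw [add_comm]; exact key j i hij
  have h2 : ∑ i, ∑ j, (a i * b j + a j * b i) ^ 2
      = 2 * ((∑ i, a i ^ 2) * (∑ j, b j ^ 2)) + 2 * (∑ i, a i * b i) ^ 2 := by
    have e : ∀ i j : Fin (d + 1), (a i * b j + a j * b i) ^ 2
        = a i ^ 2 * b j ^ 2 + (b i ^ 2 * a j ^ 2 + 2 * ((a i * b i) * (a j * b j))) := by
      intro i j; ring
    simp only [e, Finset.sum_add_distrib, ← Finset.mul_sum, ← Finset.sum_mul]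
    ring
  have h3 : ∑ i, ∑ j, (a i * b j + a j * b i) ^ 2
      ≤ ∑ _i : Fin (d + 1), ∑ _j : Fin (d + 1), (2 * R) ^ 2 :=
    Finset.sum_le_sum fun i _ => Finset.sum_le_sum fun j _ => h1 i j
  simp only [Finset.sum_const, Finset.card_univ, Fintype.card_fin, nsmul_eq_mul, Nat.cast_add,
    Nat.cast_one] at h3
  nlinarith [sq_nonneg (∑ i, a i * b i)]

/-- Rescaling two vectors to the same length without changing their products. -/
theorem exists_balanced {ι : Type*} [Fintype ι] {a b : ι → ℝ} {R : ℝ} (hR : 0 ≤ R)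
    (h : (∑ i, a i ^ 2) * (∑ j, b j ^ 2) ≤ R ^ 4) :
    ∃ a' b' : ι → ℝ, (∀ i j, a' i * b' j = a i * b j) ∧ (∀ i, |a' i| ≤ R) ∧ ∀ i, |b' i| ≤ R := by
  have hA0 : 0 ≤ ∑ i, a i ^ 2 := Finset.sum_nonneg fun _ _ => sq_nonneg _
  have hB0 : 0 ≤ ∑ i, b i ^ 2 := Finset.sum_nonneg fun _ _ => sq_nonneg _
  by_cases hz : (∑ i, a i ^ 2) * (∑ j, b j ^ 2) = 0
  · refine ⟨0, 0, fun i j => ?_, by simpa using fun _ => hR, by simpa using fun _ => hR⟩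
    rcases mul_eq_zero.1 hz with h0 | h0
    · have := (Finset.sum_eq_zero_iff_of_nonneg fun _ _ => sq_nonneg _).1 h0 i (Finset.mem_univ i)
      simp [pow_eq_zero_iff (two_ne_zero) |>.1 this]
    · have := (Finset.sum_eq_zero_iff_of_nonneg fun _ _ => sq_nonneg _).1 h0 j (Finset.mem_univ j)
      simp [pow_eq_zero_iff (two_ne_zero) |>.1 this]
  · have hA : 0 < √(∑ i, a i ^ 2) :=
      Real.sqrt_pos.2 (lt_of_le_of_ne hA0 fun e => hz (by rw [← e, zero_mul]))
    have hB : 0 < √(∑ i, b i ^ 2) :=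
      Real.sqrt_pos.2 (lt_of_le_of_ne hB0 fun e => hz (by rw [← e, mul_zero]))
    have hA2 := Real.sq_sqrt hA0
    have hB2 := Real.sq_sqrt hB0
    set α := √(∑ i, a i ^ 2)
    set β := √(∑ i, b i ^ 2)
    have hai : ∀ i, a i ^ 2 ≤ α ^ 2 := fun i => hA2 ▸
      Finset.single_le_sum (f := fun i => a i ^ 2) (fun _ _ => sq_nonneg _) (Finset.mem_univ i)
    have hbi : ∀ i, b i ^ 2 ≤ β ^ 2 := fun i => hB2 ▸
      Finset.single_le_sum (f := fun i => b i ^ 2) (fun _ _ => sq_nonneg _) (Finset.mem_univ i)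
    have hαβ : α * β ≤ R ^ 2 := by
      refine abs_le_of_sq_le_sq' ?_ (by positivity) |>.2
      rw [mul_pow, hA2, hB2, ← pow_mul]
      exact h
    have ht : √(β / α) ^ 2 = β / α := Real.sq_sqrt (by positivity)
    have ht0 : 0 < √(β / α) := Real.sqrt_pos.2 (by positivity)
    -- Both rescaled vectors have length `√(αβ) ≤ R`.
    refine ⟨fun i => √(β / α) * a i, fun i => (√(β / α))⁻¹ * b i, fun i j => ?_, fun i => ?_,
      fun i => ?_⟩
    · field_simp
    · refine abs_le_of_sq_le_sq ?_ hR
      rw [mul_pow, ht]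
      calc β / α * a i ^ 2 ≤ β / α * α ^ 2 := mul_le_mul_of_nonneg_left (hai i) (by positivity)
        _ = α * β := by field_simp
        _ ≤ R ^ 2 := hαβ
    · refine abs_le_of_sq_le_sq ?_ hR
      rw [mul_pow, inv_pow, ht]
      calc (β / α)⁻¹ * b i ^ 2 ≤ (β / α)⁻¹ * β ^ 2 := mul_le_mul_of_nonneg_left (hbi i) (by positivity)
        _ = α * β := by field_simp
        _ ≤ R ^ 2 := hαβ

/-- Bilinear layers with bounded features can be implemented with bounded weights. -/
theorem exists_bounded_weights (d : ℕ) (R : ℝ) : ∃ R' : ℝ, 0 ≤ R' ∧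
    ∀ W₀ W₁ : Matrix (Idx d) (Idx d) ℝ, (∀ p q, |featureCoeff W₀ W₁ p q| ≤ R) →
      ∃ V₀ V₁ : Matrix (Idx d) (Idx d) ℝ, featureCoeff V₀ V₁ = featureCoeff W₀ W₁ ∧
        (∀ p q, |V₀ p q| ≤ R') ∧ ∀ p q, |V₁ p q| ≤ R' := by
  set T : ℝ := 2 * ((d : ℝ) + 1) ^ 2 * (R + 1) ^ 2 with hT
  have hT0 : 0 ≤ T := by positivity
  refine ⟨1 + T, by positivity, fun W₀ W₁ hW => ?_⟩
  have h : ∀ p : Idx d, ∃ a' b' : Fin (d + 1) → ℝ,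
      (∀ i j, a' i * b' j = W₀ p (zeroIdx i) * W₁ p (zeroIdx j)) ∧
      (∀ i, |a' i| ≤ 1 + T) ∧ ∀ i, |b' i| ≤ 1 + T := by
    intro p
    apply exists_balanced (by positivity)
    -- The extra `1` pays for the residual connection.
    refine (sum_sq_mul_sum_sq_le (R := R + 1) fun q => ?_).trans ?_
    · have h1 := hW p q
      simp only [featureCoeff, Matrix.of_apply] at h1
      rw [abs_le] at h1 ⊢
      split_ifs at h1 <;> constructor <;> linarith
    · rw [← hT]
      calc T ≤ 1 + T := by linarith
        _ ≤ (1 + T) ^ 4 := le_self_pow₀ (by linarith) (by norm_num)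
  choose a b hab ha hb using h
  -- Only the columns `(0, j)` act on embedded inputs; the others are filled with bounded values.
  refine ⟨Matrix.of fun p q => a p q.1.2, Matrix.of fun p q => b p q.1.2, ?_, fun p q => ha _ _,
    fun p q => hb _ _⟩
  ext p q
  simp only [featureCoeff, Matrix.of_apply, prodCoeff, zeroIdx] at hab ⊢
  simp only [hab]

theorem sq_add_one_le_of_popLoss_le {d n : ℕ} {B : Matrix (Idx d) (Idx d) ℝ} {J : ℝ}
    (h : popLoss d n B ≤ J) (p q : Idx d) : (B p q + (1 : Matrix (Idx d) (Idx d) ℝ) p q) ^ 2 ≤ J := by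
  have h1 : 0 ≤ trace (Bᵀ * excess d n * B) := by
    rw [trace_transpose_mul_mul]
    exact Finset.sum_nonneg fun q _ => dotProduct_excess_mulVec_nonneg n _
  have h2 : frobSq (monoMat d * (B + 1)) ≤ J := by
    rw [popLoss] at h; linarith
  have h3 := sq_le_sum_sq_monoMat ((B + 1)ᵀ q) p
  have h4 : ∑ r, (monoMat d *ᵥ (B + 1)ᵀ q) r ^ 2 ≤ frobSq (monoMat d * (B + 1)) := by
    rw [frobSq, Finset.sum_comm]
    exact Finset.single_le_sum (f := fun q => ∑ r, ((monoMat d * (B + 1)) r q) ^ 2)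
      (fun _ _ => Finset.sum_nonneg fun _ _ => sq_nonneg _) (Finset.mem_univ q)
  exact (h3.trans h4).trans h2

theorem transpose_mul_diagonal_mul_self {ι : Type*} [Fintype ι] [DecidableEq ι] (M : Matrix ι ι ℝ)
    (γ : ι → ℝ) (q : ι) : (Mᵀ * diagonal γ * M) q q = ∑ p, γ p * M p q ^ 2 := by
  rw [Matrix.mul_apply]
  refine Finset.sum_congr rfl fun p _ => ?_
  rw [mul_diagonal, transpose_apply]; ring

/-- The diagonal entries of `Mᵀ diag(γ) M` are sums of terms of the same strict sign, so a bound on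
them bounds every entry of `M`. -/
theorem exists_featureMat_bound {d n : ℕ} {γ : Idx d → ℝ} (hγ : ∀ p, γ p < 0) (J : ℝ) :
    ∃ R : ℝ, ∀ M : Matrix (Idx d) (Idx d) ℝ, popLoss d n (Mᵀ * diagonal γ * M) ≤ J →
      ∀ p q, |M p q| ≤ R := by
  refine ⟨√(∑ r, (1 + √J) / (-γ r)), fun M hM p q => Real.abs_le_sqrt ?_⟩
  have h1 := sq_add_one_le_of_popLoss_le hM q q
  rw [Matrix.one_apply_eq, transpose_mul_diagonal_mul_self] at h1
  have h2 := (abs_le.1 (Real.abs_le_sqrt h1)).1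
  have h3 : -γ p * M p q ^ 2 ≤ ∑ r, -γ r * M r q ^ 2 :=
    Finset.single_le_sum (f := fun r => -γ r * M r q ^ 2)
      (fun r _ => mul_nonneg (by linarith [hγ r]) (sq_nonneg _)) (Finset.mem_univ p)
  have h4 : ∑ r, -γ r * M r q ^ 2 = -∑ r, γ r * M r q ^ 2 := by simp
  have hp : 0 < -γ p := by linarith [hγ p]
  have h5 : M p q ^ 2 ≤ (1 + √J) / (-γ p) := by
    rw [le_div_iff₀ hp]; linarith
  refine h5.trans ?_
  exact Finset.single_le_sum (f := fun r => (1 + √J) / (-γ r))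
    (fun r _ => div_nonneg (by positivity) (by linarith [hγ r])) (Finset.mem_univ p)

theorem continuous_popLoss (d n : ℕ) : Continuous (popLoss d n) := by
  have : popLoss d n = fun B => trace (Bᵀ * hess d n * B) + 2 * trace (Bᵀ * monoGram d)
      + trace (monoGram d) := funext popLoss_eq
  rw [this]
  fun_prop

theorem continuous_featureMat (d : ℕ) : Continuous fun V : (Idx d → Idx d → ℝ) × (Idx d → Idx d → ℝ) =>
    featureMat (Matrix.of V.1) (Matrix.of V.2) := by
  unfold featureMat
  refine Continuous.matrix_mul (continuous_matrix fun p q => ?_) continuous_const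
  simp only [featureCoeff, prodCoeff, Matrix.of_apply]
  split_ifs <;> fun_prop

theorem abs_featureCoeff_le {d : ℕ} {W₀ W₁ : Matrix (Idx d) (Idx d) ℝ} {R : ℝ}
    (h : ∀ p q, |featureMat W₀ W₁ p q| ≤ R) (p q : Idx d) :
    |featureCoeff W₀ W₁ p q| ≤ ∑ r, ∑ q, R * |(monoMat d)⁻¹ r q| := by
  have hAu := (Matrix.isUnit_iff_isUnit_det _).1 (isUnit_monoMat d)
  have h1 : featureCoeff W₀ W₁ = featureMat W₀ W₁ * (monoMat d)⁻¹ := by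
    rw [featureMat, Matrix.mul_assoc, Matrix.mul_nonsing_inv _ hAu, mul_one]
  have hR0 : 0 ≤ R := (abs_nonneg _).trans (h p q)
  rw [h1, Matrix.mul_apply]
  refine (Finset.abs_sum_le_sum_abs _ _).trans (Finset.sum_le_sum fun r _ => ?_)
  rw [abs_mul]
  refine (mul_le_mul_of_nonneg_right (h p r) (abs_nonneg _)).trans ?_
  exact Finset.single_le_sum (f := fun q => R * |(monoMat d)⁻¹ r q|)
    (fun _ _ => mul_nonneg hR0 (abs_nonneg _)) (Finset.mem_univ q)

/-- A continuous function has a minimiser among the weights with bounded entries. -/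
theorem exists_min_bounded_weights {d : ℕ}
    {F : (Idx d → Idx d → ℝ) × (Idx d → Idx d → ℝ) → ℝ} (hF : Continuous F) {R : ℝ} (hR : 0 ≤ R) :
    ∃ V, ∀ U : (Idx d → Idx d → ℝ) × (Idx d → Idx d → ℝ),
      (∀ p q, |U.1 p q| ≤ R) → (∀ p q, |U.2 p q| ≤ R) → F V ≤ F U := by
  obtain ⟨V, -, hV⟩ := (isCompact_closedBall
    (0 : (Idx d → Idx d → ℝ) × (Idx d → Idx d → ℝ)) R).exists_isMinOn
    ⟨0, Metric.mem_closedBall_self hR⟩ hF.continuousOn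
  refine ⟨V, fun U h0 h1 => hV ?_⟩
  rw [mem_closedBall_zero_iff, Prod.norm_def, max_le_iff]
  simp only [pi_norm_le_iff_of_nonneg hR, Real.norm_eq_abs]
  exact ⟨h0, h1⟩

/-- The first stage has a minimiser. -/
theorem exists_isStageOne {d n : ℕ} (hn : 0 < n) {γ : Idx d → ℝ} (hγ : ∀ p, γ p < 0) :
    ∃ W₀ W₁ : Matrix (Idx d) (Idx d) ℝ, IsStageOne d n γ W₀ W₁ := by
  obtain ⟨f, hfd⟩ : ∃ f : Matrix (Idx d) (Idx d) ℝ → ℝ,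
      ∀ M, f M = popLoss d n (Mᵀ * diagonal γ * M) := ⟨_, fun _ => rfl⟩
  have hc : Continuous f := by
    rw [funext hfd]
    exact (continuous_popLoss d n).comp (by fun_prop)
  have hf : ∀ W₀ W₁ : Matrix (Idx d) (Idx d) ℝ,
      loss d n W₀ W₁ (initP d) (initQ γ) = f (featureMat W₀ W₁) := fun W₀ W₁ =>
    (loss_init hn (bilinFeature_eq W₀ W₁) γ).trans (hfd _).symm
  obtain ⟨R, hR⟩ := exists_featureMat_bound (n := n) hγ (f (featureMat 0 0))
  simp only [← hfd] at hR
  obtain ⟨R', hR'0, hR'⟩ := exists_bounded_weights d (∑ r, ∑ q, R * |(monoMat d)⁻¹ r q|)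
  obtain ⟨V, hV⟩ := exists_min_bounded_weights (hc.comp (continuous_featureMat d)) hR'0
  refine ⟨Matrix.of V.1, Matrix.of V.2, fun U₀ U₁ => ?_⟩
  rw [hf, hf]
  have h00 : f (featureMat (Matrix.of V.1) (Matrix.of V.2)) ≤ f (featureMat 0 0) :=
    hV (0, 0) (fun p q => by simpa using hR'0) (fun p q => by simpa using hR'0)
  -- Weights in the sublevel set of the zero weights can be replaced by bounded ones with the same
  -- features; all others lose to the zero weights.
  by_cases hle : f (featureMat U₀ U₁) ≤ f (featureMat 0 0)
  · obtain ⟨T₀, T₁, hT, hT0, hT1⟩ := hR' U₀ U₁ (abs_featureCoeff_le (hR _ hle))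
    have h1 : featureMat T₀ T₁ = featureMat U₀ U₁ := by rw [featureMat, hT]; rfl
    rw [← h1]
    exact hV (T₀, T₁) hT0 hT1
  · exact h00.trans (not_le.1 hle).le

/-! ### Zero sets of functions that are polynomial in every coordinate -/

/-- If every section in a single coordinate vanishes identically or almost nowhere, then so does
the function. -/
theorem ae_ne_zero_pi_fin {X : Type*} [MeasurableSpace X] {μ : Measure X} [IsProbabilityMeasure μ]
    {S : Set (X → ℝ)} (hS : ∀ g ∈ S, (∃ t, g t ≠ 0) → ∀ᵐ t ∂μ, g t ≠ 0) :
    ∀ {n : ℕ} {f : (Fin n → X) → ℝ}, Measurable f →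
      (∀ x i, (fun t => f (Function.update x i t)) ∈ S) → (∃ x, f x ≠ 0) →
      ∀ᵐ x ∂(Measure.pi fun _ => μ), f x ≠ 0 := by
  intro n
  induction n with
  | zero =>
    rintro f - - ⟨x, hx⟩
    exact ae_of_all _ fun y => by rwa [Subsingleton.elim y x]
  | succ n ih =>
    rintro f hf hfS ⟨x, hx⟩
    have hmp := measurePreserving_piFinSuccAbove (fun _ : Fin (n + 1) => μ) 0
    have hcons : Measurable fun z : X × (Fin n → X) => (Fin.cons z.1 z.2 : Fin (n + 1) → X) := by
      refine measurable_pi_lambda _ fun i => ?_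
      refine Fin.cases ?_ (fun k => ?_) i
      · exact measurable_fst
      · exact (measurable_pi_apply k).comp measurable_snd
    have hg : Measurable fun z : X × (Fin n → X) => f (Fin.cons z.1 z.2) := hf.comp hcons
    -- With the remaining coordinates frozen at the given nonzero point, almost every first
    -- coordinate keeps `f` nonzero; the induction hypothesis then applies to its section.
    have hsec : ∀ᵐ t ∂μ, f (Fin.cons t (Fin.tail x)) ≠ 0 := by
      have h := hS _ (hfS x 0) ⟨x 0, by simpa using hx⟩
      filter_upwards [h] with t ht
      rwa [← Fin.cons_self_tail x, Fin.update_cons_zero] at ht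
    have hprod : ∀ᵐ z ∂μ.prod (Measure.pi fun _ : Fin n => μ), f (Fin.cons z.1 z.2) ≠ 0 := by
      have hset : MeasurableSet {z : X × (Fin n → X) | f (Fin.cons z.1 z.2) ≠ 0} :=
        hg (measurableSet_singleton 0).compl
      rw [Measure.ae_prod_iff_ae_ae hset]
      filter_upwards [hsec] with t ht
      refine ih (hf.comp (hcons.comp measurable_prodMk_left)) (fun y i => ?_) ⟨_, ht⟩
      have := hfS (Fin.cons t y) i.succ
      simpa only [← Fin.cons_update] using this
    have h2 := hmp.quasiMeasurePreserving.ae hprod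
    filter_upwards [h2] with y hy
    have e : (Fin.cons (MeasurableEquiv.piFinSuccAbove (fun _ : Fin (n + 1) => X) 0 y).1
        (MeasurableEquiv.piFinSuccAbove (fun _ : Fin (n + 1) => X) 0 y).2 : Fin (n + 1) → X) = y := by
      funext i
      refine Fin.cases ?_ (fun k => ?_) i <;> simp [MeasurableEquiv.piFinSuccAbove, Fin.tail]
    rwa [e] at hy

theorem ae_ne_zero_pi {X ι : Type*} [Fintype ι] [DecidableEq ι] [MeasurableSpace X] {μ : Measure X}
    [IsProbabilityMeasure μ] {S : Set (X → ℝ)}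
    (hS : ∀ g ∈ S, (∃ t, g t ≠ 0) → ∀ᵐ t ∂μ, g t ≠ 0) {f : (ι → X) → ℝ} (hf : Measurable f)
    (hfS : ∀ x i, (fun t => f (Function.update x i t)) ∈ S) (hx : ∃ x, f x ≠ 0) :
    ∀ᵐ x ∂(Measure.pi fun _ => μ), f x ≠ 0 := by
  obtain ⟨x, hx⟩ := hx
  let e := Fintype.equivFin ι
  have hmp : MeasurePreserving (fun y : ι → X => fun i => y (e.symm i))
      (Measure.pi fun _ => μ) (Measure.pi fun _ => μ) := by
    have h := (measurePreserving_piCongrLeft (fun _ : ι => μ) e.symm).symm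
    exact h
  have hm : Measurable fun (y : Fin (Fintype.card ι) → X) (i : ι) => y (e i) := by fun_prop
  have h := ae_ne_zero_pi_fin hS (f := fun y => f fun i => y (e i)) (hf.comp hm) ?_
    ⟨fun i => x (e.symm i), by simpa using hx⟩
  · have h2 := hmp.quasiMeasurePreserving.ae h
    filter_upwards [h2] with y hy
    simpa using hy
  · intro y i
    have := hfS (fun j => y (e j)) (e.symm i)
    convert this using 2 with t
    congr 1
    funext j
    by_cases hj : e j = i
    · subst hj; simp
    · have : j ≠ e.symm i := fun h => hj (by simp [h])
      simp [Function.update_of_ne, hj, this]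

/-- Real polynomial functions. -/
def IsPolyFun (g : ℝ → ℝ) : Prop := ∃ P : Polynomial ℝ, ∀ t, g t = P.eval t

namespace IsPolyFun

variable {f g : ℝ → ℝ}

theorem const (c : ℝ) : IsPolyFun fun _ => c := ⟨Polynomial.C c, by simp⟩

theorem id : IsPolyFun fun t => t := ⟨Polynomial.X, by simp⟩

theorem add (hf : IsPolyFun f) (hg : IsPolyFun g) : IsPolyFun fun t => f t + g t := by
  obtain ⟨P, hP⟩ := hf
  obtain ⟨Q, hQ⟩ := hg
  exact ⟨P + Q, by simp [hP, hQ]⟩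

theorem mul (hf : IsPolyFun f) (hg : IsPolyFun g) : IsPolyFun fun t => f t * g t := by
  obtain ⟨P, hP⟩ := hf
  obtain ⟨Q, hQ⟩ := hg
  exact ⟨P * Q, by simp [hP, hQ]⟩

theorem sum {ι : Type*} {s : Finset ι} {F : ι → ℝ → ℝ} (h : ∀ i ∈ s, IsPolyFun (F i)) :
    IsPolyFun fun t => ∑ i ∈ s, F i t := by
  choose! P hP using h
  exact ⟨∑ i ∈ s, P i, fun t => by
    rw [Polynomial.eval_finsetSum]; exact Finset.sum_congr rfl fun i hi => hP i hi t⟩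

theorem prod {ι : Type*} {s : Finset ι} {F : ι → ℝ → ℝ} (h : ∀ i ∈ s, IsPolyFun (F i)) :
    IsPolyFun fun t => ∏ i ∈ s, F i t := by
  choose! P hP using h
  exact ⟨∏ i ∈ s, P i, fun t => by
    rw [Polynomial.eval_prod]; exact Finset.prod_congr rfl fun i hi => hP i hi t⟩

theorem herm_comp (k : ℕ) (hf : IsPolyFun f) : IsPolyFun fun t => herm k (f t) := by
  unfold herm
  split_ifs
  · exact const 1
  · exact hf
  · have := ((hf.mul hf).add (const (-1))).mul (const (√2)⁻¹)
    simpa [div_eq_mul_inv, sub_eq_add_neg, sq] using this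

theorem ae_ne_zero (hf : IsPolyFun f) (h : ∃ t, f t ≠ 0) : ∀ᵐ t ∂stdG, f t ≠ 0 := by
  obtain ⟨P, hP⟩ := hf
  obtain ⟨t, ht⟩ := h
  have hP0 : P ≠ 0 := by
    rintro rfl
    exact ht (by simp [hP])
  have hfin : {t | ¬ f t ≠ 0}.Finite := by
    refine (P.roots.toFinset.finite_toSet).subset fun s hs => ?_
    have hs' : f s = 0 := by simpa using hs
    simpa [hP0, Polynomial.IsRoot] using (hP s).symm.trans hs'
  have := nullSingletonClass_gaussianReal (μ := 0) (v := 1) one_ne_zero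
  exact hfin.measure_zero _

end IsPolyFun

/-! ### Almost sure invertibility of the Gram matrix -/

theorem continuous_det_gram {d n : ℕ} :
    Continuous fun x : Col n → Fin d → ℝ => (gram basisFeature x).det := by
  refine Continuous.matrix_det (continuous_matrix fun p q => ?_)
  have hf : ∀ (c : Col n) (q : Idx d), Continuous fun x : Col n → Fin d → ℝ =>
      basisFeature (x c) q := fun c q => (continuous_basisFeature q).comp (continuous_apply c)
  simp only [gram, Matrix.sum_apply, vecMulVec_apply]
  fun_prop

theorem isPolyFun_det_gram {d n : ℕ} (x : Col n → Fin d → ℝ) (c : Col n) (y : Fin d → ℝ)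
    (j : Fin d) : IsPolyFun fun t =>
      (gram basisFeature (Function.update x c (Function.update y j t))).det := by
  have h1 : ∀ (c' : Col n) (k : Fin d), IsPolyFun fun t =>
      Function.update x c (Function.update y j t) c' k := by
    intro c' k
    by_cases hc : c' = c
    · subst hc
      simp only [Function.update_self]
      by_cases hk : k = j
      · subst hk; simpa using IsPolyFun.id
      · simpa [hk] using IsPolyFun.const _
    · simpa [hc] using IsPolyFun.const _
  have h2 : ∀ (c' : Col n) (p : Idx d), IsPolyFun fun t =>
      basisFeature (Function.update x c (Function.update y j t) c') p := by
    intro c' p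
    simp only [basisFeature_eq_prod]
    exact IsPolyFun.prod fun k _ => (h1 c' k).herm_comp _
  simp only [Matrix.det_apply', gram, Matrix.sum_apply, vecMulVec_apply]
  exact IsPolyFun.sum fun σ _ => (IsPolyFun.const _).mul (IsPolyFun.prod fun p _ =>
    IsPolyFun.sum fun i _ => (h2 _ _).mul (h2 _ _))

/-- A functional annihilating all features is a vector orthogonal to them, which vanishes by
orthonormality. -/
theorem span_basisFeature (d : ℕ) :
    Submodule.span ℝ (Set.range fun x : Fin d → ℝ => basisFeature x) = ⊤ := by
  by_contra hne
  obtain ⟨f, hf0, hf⟩ := Submodule.exists_le_ker_of_lt_top _ (lt_top_iff_ne_top.2 hne)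
  apply hf0
  have h1 : ∀ v : Idx d → ℝ, f v = (fun p => f (Pi.single p 1)) ⬝ᵥ v := by
    intro v
    rw [LinearMap.pi_apply_eq_sum_univ f v, dotProduct]
    refine Finset.sum_congr rfl fun p _ => ?_
    rw [smul_eq_mul, mul_comm]
    congr 2
    funext q
    simp [Pi.single_apply, eq_comm]
  have h2 : (fun p => f (Pi.single p 1)) = 0 := by
    apply eq_zero_of_dotProduct_basisFeature
    intro x
    rw [← h1]
    exact LinearMap.mem_ker.1 (hf (Submodule.subset_span ⟨x, rfl⟩))
  refine LinearMap.ext fun v => ?_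
  rw [h1, h2, zero_dotProduct, LinearMap.zero_apply]

theorem dotProduct_gram_mulVec {d n : ℕ} (x : Col n → Fin d → ℝ) (z : Idx d → ℝ) :
    z ⬝ᵥ gram basisFeature x *ᵥ z = ∑ i : Fin n, (basisFeature (x (Sum.inl i)) ⬝ᵥ z) ^ 2 := by
  rw [gram, sum_mulVec, dotProduct_sum]
  refine Finset.sum_congr rfl fun i _ => ?_
  rw [vecMulVec_mulVec, dotProduct_smul, dotProduct_comm z]
  simp [sq]

theorem exists_det_gram_ne_zero {d n : ℕ} (hn : Fintype.card (Idx d) ≤ n) :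
    ∃ x : Col n → Fin d → ℝ, (gram basisFeature x).det ≠ 0 := by
  obtain ⟨κ, a, -, hspan, hli⟩ := exists_linearIndependent' ℝ (fun x : Fin d → ℝ => basisFeature x)
  rw [span_basisFeature] at hspan
  have : Finite κ := hli.finite
  have : Fintype κ := Fintype.ofFinite κ
  have hcard : Fintype.card κ ≤ Fintype.card (Fin n) := by
    have := hli.fintype_card_le_finrank
    simp only [Module.finrank_fintype_fun_eq_card] at this
    simpa using this.trans hn
  obtain ⟨e⟩ := Function.Embedding.nonempty_of_card_le hcard
  -- Some examples realise a basis of features; the rest are set to `0` and only add positive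
  -- semidefinite terms.
  refine ⟨Sum.elim (Function.extend e a 0) 0, ?_⟩
  have hu : IsUnit (gram basisFeature (Sum.elim (Function.extend e a 0) 0 : Col n → Fin d → ℝ)) := by
    refine isUnit_of_mulVec_injective fun z hz => ?_
    have h1 := dotProduct_gram_mulVec (Sum.elim (Function.extend e a 0) 0 : Col n → Fin d → ℝ) z
    rw [hz, dotProduct_zero] at h1
    have h2 := (Finset.sum_eq_zero_iff_of_nonneg fun _ _ => sq_nonneg _).1 h1.symm
    have h3 : ∀ k, basisFeature (a k) ⬝ᵥ z = 0 := by
      intro k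
      have := h2 (e k) (Finset.mem_univ _)
      simpa [e.injective.extend_apply] using this
    have h4 : ∀ v : Idx d → ℝ, v ⬝ᵥ z = 0 := by
      intro v
      have hv : v ∈ Submodule.span ℝ (Set.range ((fun x : Fin d → ℝ => basisFeature x) ∘ a)) := by
        rw [hspan]; trivial
      induction hv using Submodule.span_induction with
      | mem v hv => obtain ⟨k, rfl⟩ := hv; exact h3 k
      | zero => simp
      | add u v _ _ hu hv => rw [add_dotProduct, hu, hv, add_zero]
      | smul c v _ hv => rw [smul_dotProduct, hv, smul_zero]
    exact dotProduct_self_eq_zero.1 (h4 z)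
  exact ((Matrix.isUnit_iff_isUnit_det _).1 hu).ne_zero

theorem ae_isUnit_gram_basisFeature {d n : ℕ} (hn : Fintype.card (Idx d) ≤ n) :
    ∀ᵐ x ∂colLaw d n, IsUnit (gram basisFeature x) := by
  -- `ae_ne_zero_pi` is used at two levels: over the coordinates of one input here, and over the
  -- columns of the prompt below.
  have hS : ∀ g ∈ {g : (Fin d → ℝ) → ℝ | Measurable g ∧
      ∀ y j, IsPolyFun fun t => g (Function.update y j t)}, (∃ y, g y ≠ 0) →
      ∀ᵐ y ∂inputLaw d, g y ≠ 0 := by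
    rintro g ⟨hg, hg'⟩ hne
    exact ae_ne_zero_pi (S := {g | IsPolyFun g}) (fun g hg => hg.ae_ne_zero) hg hg' hne
  have h := ae_ne_zero_pi hS (f := fun x : Col n → Fin d → ℝ => (gram basisFeature x).det)
    continuous_det_gram.measurable (fun x c => ⟨?_, fun y j => isPolyFun_det_gram x c y j⟩)
    (exists_det_gram_ne_zero hn)
  · filter_upwards [h] with x hx
    exact (Matrix.isUnit_iff_isUnit_det _).2 (isUnit_iff_ne_zero.2 hx)
  · exact continuous_det_gram.measurable.comp (measurable_update x)

theorem gram_eq {d n : ℕ} {φ : (Fin d → ℝ) → Idx d → ℝ} {M : Matrix (Idx d) (Idx d) ℝ}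
    (hM : ∀ x, φ x = M *ᵥ basisFeature x) (x : Col n → Fin d → ℝ) :
    gram φ x = M * gram basisFeature x * Mᵀ := by
  simp only [gram, hM, Matrix.mul_sum, Matrix.sum_mul]
  refine Finset.sum_congr rfl fun i _ => ?_
  rw [mul_vecMulVec, vecMulVec_mul, vecMul_transpose]

/-- The Gram matrix is almost surely invertible. -/
theorem ae_isUnit_gram {d n : ℕ} (hn : Fintype.card (Idx d) ≤ n) {φ : (Fin d → ℝ) → Idx d → ℝ}
    {M : Matrix (Idx d) (Idx d) ℝ} (hMu : IsUnit M) (hM : ∀ x, φ x = M *ᵥ basisFeature x) :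
    ∀ᵐ ω ∂promptLaw d n, IsUnit (gram φ ω.1) := by
  have h := (measurePreserving_fst (μ := colLaw d n) (ν := coeffLaw d)).quasiMeasurePreserving.ae
    (ae_isUnit_gram_basisFeature hn)
  filter_upwards [h] with ω hω
  rw [gram_eq hM]
  exact (hMu.mul hω).mul ((Matrix.isUnit_transpose _).2 hMu)

/-- Where the Gram matrix is invertible, least squares recovers the label of the query. -/
theorem olsPrediction_eq {d n : ℕ} {φ : (Fin d → ℝ) → Idx d → ℝ} {M : Matrix (Idx d) (Idx d) ℝ}
    (hMu : IsUnit M) (hM : ∀ x, φ x = M *ᵥ basisFeature x) {x : Col n → Fin d → ℝ} (w : Idx d → ℝ)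
    (hx : IsUnit (gram φ x)) : olsPrediction φ x w = target w (x (Sum.inr ())) := by
  have hdet := (Matrix.isUnit_iff_isUnit_det _).1 hMu
  have hv : ∀ y, basisFeature y = M⁻¹ *ᵥ φ y := by
    intro y
    rw [hM, mulVec_mulVec, Matrix.nonsing_inv_mul _ hdet, one_mulVec]
  -- Invertibility of `M` makes the noiseless target exactly linear in the features.
  obtain ⟨u, hu⟩ : ∃ u : Idx d → ℝ, ∀ y, target w y = φ y ⬝ᵥ u := by
    refine ⟨w ᵥ* monoMat d ᵥ* M⁻¹, fun y => ?_⟩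
    rw [dotProduct_comm, ← dotProduct_mulVec, ← hv, ← dotProduct_mulVec,
      monoMat_mulVec_basisFeature]
    rfl
  have h1 : ∑ i : Fin n, target w (x (Sum.inl i)) • φ (x (Sum.inl i)) = gram φ x *ᵥ u := by
    rw [gram, sum_mulVec]
    refine Finset.sum_congr rfl fun i _ => ?_
    rw [vecMulVec_mulVec, hu]
    simp
  rw [olsPrediction, olsCoeff, h1, mulVec_mulVec,
    Matrix.nonsing_inv_mul _ ((Matrix.isUnit_iff_isUnit_det _).1 hx), one_mulVec, hu, dotProduct_comm]

/-! ### The two stages -/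

theorem dotProduct_diagonal_form {ι : Type*} [Fintype ι] [DecidableEq ι] (M : Matrix ι ι ℝ)
    (γ z : ι → ℝ) : z ⬝ᵥ (Mᵀ * diagonal γ * M) *ᵥ z = ∑ p, γ p * (M *ᵥ z) p ^ 2 := by
  rw [← mulVec_mulVec, ← mulVec_mulVec, dotProduct_mulVec, vecMul_transpose]
  refine Finset.sum_congr rfl fun p _ => ?_
  rw [mulVec_diagonal]; ring

/-- The features found by the first stage are coercive. -/
theorem IsStageOne.sum_sq_le {d n : ℕ} (hd : 1 ≤ d) (hn : 0 < n) (hθ : 52 * d * theta d n ≤ 1)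
    {γ : Idx d → ℝ} (hγ : ∀ p, γ p < 0) {W₀ W₁ : Matrix (Idx d) (Idx d) ℝ}
    (h : IsStageOne d n γ W₀ W₁) (z : Idx d → ℝ) :
    1 / 2 * ∑ p, z p ^ 2 ≤ ∑ p, -γ p * (featureMat W₀ W₁ *ᵥ z) p ^ 2 := by
  set M := featureMat W₀ W₁ with hM
  have hγ' : ∀ p, 0 ≤ diagOpt d n p / (-γ p) := fun p =>
    div_nonneg (diagOpt_pos n p).le (by linarith [hγ p])
  -- These diagonal features turn `Γ₀` into `-diag(diagOpt)`; strict negativity of `γ` makes the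
  -- square roots available.
  obtain ⟨V₀, V₁, hV⟩ := exists_bilinFeature_diagonal fun p => √(diagOpt d n p / (-γ p))
  have h1 := h V₀ V₁
  rw [loss_init hn (bilinFeature_eq W₀ W₁), loss_init hn hV, ← hM] at h1
  have e1 : (diagonal fun p => √(diagOpt d n p / (-γ p)))ᵀ * diagonal γ *
      (diagonal fun p => √(diagOpt d n p / (-γ p))) = -diagonal (diagOpt d n) := by
    rw [diagonal_transpose, diagonal_mul_diagonal, diagonal_mul_diagonal, diagonal_neg]
    congr 1
    funext p
    have hs := Real.mul_self_sqrt (hγ' p)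
    have : γ p ≠ 0 := (hγ p).ne
    calc √(diagOpt d n p / (-γ p)) * γ p * √(diagOpt d n p / (-γ p))
        = (√(diagOpt d n p / (-γ p)) * √(diagOpt d n p / (-γ p))) * γ p := by ring
      _ = -diagOpt d n p := by rw [hs]; field_simp
  rw [e1] at h1
  have hs : (-(Mᵀ * diagonal γ * M))ᵀ = -(Mᵀ * diagonal γ * M) := by
    simp [transpose_mul, Matrix.mul_assoc]
  have h2 := half_sum_sq_le hd n hθ hs (by rwa [neg_neg]) z
  rw [neg_mulVec, dotProduct_neg, dotProduct_diagonal_form] at h2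
  simpa using h2

theorem IsStageOne.isUnit {d n : ℕ} (hd : 1 ≤ d) (hn : 0 < n) (hθ : 52 * d * theta d n ≤ 1)
    {γ : Idx d → ℝ} (hγ : ∀ p, γ p < 0) {W₀ W₁ : Matrix (Idx d) (Idx d) ℝ}
    (h : IsStageOne d n γ W₀ W₁) : IsUnit (featureMat W₀ W₁) := by
  refine isUnit_of_mulVec_injective fun z hz => ?_
  have h1 := h.sum_sq_le hd hn hθ hγ z
  simp only [hz, Pi.zero_apply, ne_eq, OfNat.ofNat_ne_zero, not_false_eq_true, zero_pow, mul_zero,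
    Finset.sum_const_zero] at h1
  have h2 : ∑ p, z p ^ 2 = 0 :=
    le_antisymm (by linarith) (Finset.sum_nonneg fun _ _ => sq_nonneg _)
  funext p
  have h3 := (Finset.sum_eq_zero_iff_of_nonneg fun _ _ => sq_nonneg _).1 h2 p (Finset.mem_univ p)
  simpa using h3

theorem popLoss_optimum_le_loss {d n : ℕ} (hn : 0 < n) {W₀ W₁ M : Matrix (Idx d) (Idx d) ℝ}
    (hM : ∀ x, bilinFeature W₀ W₁ x = M *ᵥ basisFeature x) (P Q : Matrix (Row d) (Row d) ℝ) :
    popLoss d n (optimum d n) ≤ loss d n W₀ W₁ P Q := by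
  rw [loss_eq hn hM]
  have h1 := popLoss_optimum_le (n := n) (effective M P Q)
  have h2 := integral_nonneg (μ := promptLaw d n) (f := fun ω =>
    evenPart (n := n) (labelRow P ᵥ* M) (P (Sum.inr ()) (Sum.inr ()))
      (Mᵀ * Q.toBlocks₁₁ * M) (labelRow Q ᵥ* M) ω.1 ω.2 ^ 2) fun _ => sq_nonneg _
  linarith

/-- The second stage attains the minimum of the population loss. -/
theorem exists_loss_eq_optimum {d n : ℕ} (hn : 0 < n) {W₀ W₁ M : Matrix (Idx d) (Idx d) ℝ}
    (hMu : IsUnit M) (hM : ∀ x, bilinFeature W₀ W₁ x = M *ᵥ basisFeature x) :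
    ∃ P Q : Matrix (Row d) (Row d) ℝ, loss d n W₀ W₁ P Q = popLoss d n (optimum d n) := by
  have hdet := (Matrix.isUnit_iff_isUnit_det _).1 hMu
  have hdetT : IsUnit Mᵀ.det := by rwa [det_transpose]
  set Γ := (Mᵀ)⁻¹ * optimum d n * M⁻¹ with hΓ
  refine ⟨initP d, fromBlocks Γ 0 0 0, ?_⟩
  have h1 : labelRow (initP d) = 0 := rfl
  have h2 : labelRow (fromBlocks Γ 0 0 0 : Matrix (Row d) (Row d) ℝ) = 0 := rfl
  have h3 : initP d (Sum.inr ()) (Sum.inr ()) = 1 := rfl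
  have h4 : Mᵀ * Γ * M = optimum d n := by
    rw [hΓ, Matrix.mul_assoc, Matrix.mul_assoc, Matrix.nonsing_inv_mul _ hdet, mul_one,
      ← Matrix.mul_assoc, Matrix.mul_nonsing_inv _ hdetT, one_mul]
  rw [loss_eq hn hM, effective, h1, h2, h3, toBlocks_fromBlocks₁₁, h4]
  simp [evenPart]

theorem two_le_card_Idx {d : ℕ} (hd : 1 ≤ d) : 2 ≤ Fintype.card (Idx d) := by
  rw [card_Idx]
  calc 2 ≤ Nat.choose 3 2 := by decide
    _ ≤ (d + 2).choose 2 := Nat.choose_le_choose 2 (by omega)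

/-- A rank-one matrix is singular in dimension at least two. This excludes second-stage minimisers
with `p = 0`, whose effective matrix is only the rank-one term. -/
theorem vecMulVec_ne_of_isUnit {d : ℕ} (hd : 1 ≤ d) {B : Matrix (Idx d) (Idx d) ℝ} (hB : IsUnit B)
    (a b : Idx d → ℝ) : vecMulVec a b ≠ B := by
  rintro rfl
  have h1 := Matrix.rank_of_isUnit _ hB
  have h2 := Matrix.rank_vecMulVec_le a b
  have := two_le_card_Idx hd
  omega

/-- The structure of the minimisers of the second stage. -/
theorem IsStageTwo.structure {d n : ℕ} (hd : 1 ≤ d) (hn : 0 < n)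
    {W₀ W₁ M : Matrix (Idx d) (Idx d) ℝ} (hMu : IsUnit M)
    (hM : ∀ x, bilinFeature W₀ W₁ x = M *ᵥ basisFeature x) {P Q : Matrix (Row d) (Row d) ℝ}
    (h : IsStageTwo d n W₀ W₁ P Q) :
    P (Sum.inr ()) (Sum.inr ()) ≠ 0 ∧ labelRow P = 0 ∧ labelRow Q = 0 ∧
      Mᵀ * (P (Sum.inr ()) (Sum.inr ()) • Q.toBlocks₁₁) * M = optimum d n ∧
      loss d n W₀ W₁ P Q = popLoss d n (optimum d n) := by
  obtain ⟨P', Q', hPQ⟩ := exists_loss_eq_optimum hn hMu hM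
  have h1 := h P' Q'
  rw [hPQ] at h1
  have hloss : loss d n W₀ W₁ P Q = popLoss d n (optimum d n) :=
    le_antisymm h1 (popLoss_optimum_le_loss hn hM P Q)
  rw [loss_eq hn hM] at h1
  have h2 := popLoss_optimum_le (n := n) (effective M P Q)
  have h3 := integral_nonneg (μ := promptLaw d n) (f := fun ω =>
    evenPart (n := n) (labelRow P ᵥ* M) (P (Sum.inr ()) (Sum.inr ()))
      (Mᵀ * Q.toBlocks₁₁ * M) (labelRow Q ᵥ* M) ω.1 ω.2 ^ 2) fun _ => sq_nonneg _
  -- Both summands of the loss are bounded below by their values at the attained minimum, so each is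
  -- minimal separately.
  have h4 : effective M P Q = optimum d n := eq_optimum (n := n) (by linarith)
  have h5 := eq_zero_of_evenPart hn (evenPart_eq_zero (le_antisymm (by linarith) h3))
  have hinj : ∀ u : Idx d → ℝ, u ᵥ* M = 0 → u = 0 := fun u hu =>
    Matrix.vecMul_injective_of_isUnit hMu (by simpa using hu)
  have hp : P (Sum.inr ()) (Sum.inr ()) ≠ 0 := by
    intro hp
    rw [effective, hp, zero_smul, zero_add] at h4
    exact vecMulVec_ne_of_isUnit hd (isUnit_optimum d n) _ _ h4
  have hb := h5.1.resolve_left hp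
  have h6 : P (Sum.inr ()) (Sum.inr ()) • (Mᵀ * Q.toBlocks₁₁ * M) = optimum d n := by
    rw [effective, hb] at h4
    simpa using h4
  have hG : IsUnit (Mᵀ * Q.toBlocks₁₁ * M) := by
    have := isUnit_optimum d n
    rw [← h6, Matrix.isUnit_iff_isUnit_det, det_smul] at this
    exact (Matrix.isUnit_iff_isUnit_det _).2 (isUnit_of_mul_isUnit_right this)
  refine ⟨hp, hinj _ (h5.2 hG), hinj _ hb, ?_, hloss⟩
  rw [← h6]
  simp

theorem secondMoment_eq {d : ℕ} {φ : (Fin d → ℝ) → Idx d → ℝ} {M : Matrix (Idx d) (Idx d) ℝ}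
    (hM : ∀ x, φ x = M *ᵥ basisFeature x) : secondMoment φ = M * Mᵀ := by
  ext p q
  have e : ∀ x, φ x p * φ x q
      = ∑ r, ∑ s, (M p r * M q s) * (basisFeature x r * basisFeature x s) := by
    intro x
    simp only [hM, Matrix.mulVec, dotProduct, Finset.sum_mul_sum]
    exact Finset.sum_congr rfl fun r _ => Finset.sum_congr rfl fun s _ => by ring
  have hi : ∀ r s, Integrable (fun x : Fin d → ℝ =>
      (M p r * M q s) * (basisFeature x r * basisFeature x s)) (inputLaw d) := fun r s =>
    (((hasMoments_basisFeature r).mul (hasMoments_basisFeature s)).const_mul _).integrable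
  change ∫ x, φ x p * φ x q ∂inputLaw d = _
  simp only [e]
  rw [integral_finsetSum _ fun r _ => integrable_finsetSum _ fun s _ => hi r s, Matrix.mul_apply]
  refine Finset.sum_congr rfl fun r _ => ?_
  rw [integral_finsetSum _ fun s _ => hi r s]
  simp [integral_const_mul, integral_basisFeature]

theorem frob_le_of_frobSq_le {d : ℕ} {X : Matrix (Idx d) (Idx d) ℝ} {c : ℝ} (hc : 0 ≤ c)
    (h : frobSq X ≤ c ^ 2) : frob X ≤ c :=
  Real.sqrt_le_iff.2 ⟨hc, h⟩

/-- At `B = -1` the bias vanishes and only the variance remains. -/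
theorem popLoss_optimum_le_div (d n : ℕ) :
    popLoss d n (optimum d n) ≤ trace (weightedMoment d - monoGram d) / n := by
  refine (popLoss_optimum_le (-1)).trans (le_of_eq ?_)
  rw [popLoss]
  simp only [neg_add_cancel, mul_zero, transpose_neg, transpose_one, neg_mul, one_mul, mul_neg,
    mul_one, neg_neg, excess, trace_smul, smul_eq_mul]
  simp [frobSq, monoGram]
  ring

/-- With `r = d^{3/2}/√n`, the left side is `4 * momentBound ^ 6 * r ^ 2`, and `r ^ 2 ≤ r` because
`r ≤ 1`. -/
theorem rate_bound {d n : ℕ} (hn : 0 < n) (h : (d : ℝ) ^ 3 ≤ n) :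
    (d : ℝ) * theta d n ≤ 4 * momentBound ^ 6 * ((d : ℝ) ^ (3 / 2 : ℝ) / √(n : ℝ)) := by
  have hn' : (0 : ℝ) < n := by exact_mod_cast hn
  have hm := one_le_momentBound
  set r := (d : ℝ) ^ (3 / 2 : ℝ) / √(n : ℝ) with hr
  have hr0 : 0 ≤ r := by positivity
  have hr2 : r ^ 2 = (d : ℝ) ^ 3 / n := by
    rw [hr, div_pow, Real.sq_sqrt hn'.le, ← Real.rpow_natCast, ← Real.rpow_mul (by positivity)]
    norm_num
  have hr1 : r ≤ 1 := by
    have : r ^ 2 ≤ 1 := by rw [hr2, div_le_one hn']; exact h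
    nlinarith
  have e : (d : ℝ) * theta d n = 4 * momentBound ^ 6 * r ^ 2 := by
    rw [hr2, theta]; ring
  rw [e]
  gcongr
  nlinarith

/-- The preconditioner in the coordinates of the features. -/
theorem smul_add_inv_secondMoment {ι : Type*} [Fintype ι] [DecidableEq ι] {M Γ B : Matrix ι ι ℝ}
    (hM : IsUnit M) (h : Mᵀ * Γ * M = B) : Γ + (M * Mᵀ)⁻¹ = (M⁻¹)ᵀ * (B + 1) * M⁻¹ := by
  have hdet := (Matrix.isUnit_iff_isUnit_det _).1 hM
  have hdetT : IsUnit Mᵀ.det := by rwa [det_transpose]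
  rw [← h, mul_add, add_mul, mul_one, transpose_nonsing_inv, Matrix.mul_inv_rev]
  congr 1
  rw [Matrix.mul_assoc, Matrix.mul_assoc, Matrix.mul_nonsing_inv _ hdet, mul_one,
    ← Matrix.mul_assoc, Matrix.nonsing_inv_mul _ hdetT, one_mul]

end

end QuadICL

/-! ### Proof of the main theorem -/

open Matrix QuadICL in
theorem mainTheorem5 :
    ∃ (C : ℝ) (K : ℕ → ℝ), 0 < C ∧
      ∀ (d n : ℕ), 1 ≤ d → C * (d : ℝ) ^ 3 ≤ (n : ℝ) →
      ∀ γ : QuadICL.Idx d → ℝ, (∀ p, γ p < 0) →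
        -- the first stage has a solution
        (∃ W₀ W₁ : Matrix (QuadICL.Idx d) (QuadICL.Idx d) ℝ, QuadICL.IsStageOne d n γ W₀ W₁) ∧
        ∀ W₀ W₁ : Matrix (QuadICL.Idx d) (QuadICL.Idx d) ℝ, QuadICL.IsStageOne d n γ W₀ W₁ →
          -- the bilinear layer implements `x ↦ M v` with `M` invertible
          (∃ M : Matrix (QuadICL.Idx d) (QuadICL.Idx d) ℝ, IsUnit M ∧
            (∀ x : Fin d → ℝ,
              QuadICL.bilinFeature W₀ W₁ x = M.mulVec (QuadICL.basisFeature x)) ∧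
            -- the second stage has a solution
            (∃ P Q : Matrix (QuadICL.Row d) (QuadICL.Row d) ℝ,
              QuadICL.IsStageTwo d n W₀ W₁ P Q) ∧
            ∀ P Q : Matrix (QuadICL.Row d) (QuadICL.Row d) ℝ,
              QuadICL.IsStageTwo d n W₀ W₁ P Q →
              -- the entries of `P` and `Q` that enter the prediction have the sparsity pattern
              -- of one preconditioned least squares step with preconditioner `p Γ`, and
              -- `p Γ` is close to `-𝔼[x̃ x̃ᵀ]⁻¹`, also in the coordinates where `x̃` becomes `v`
              (∃ (p : ℝ) (Γ : Matrix (QuadICL.Idx d) (QuadICL.Idx d) ℝ), p ≠ 0 ∧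
                (∀ k, P (Sum.inr ()) (Sum.inl k) = 0) ∧ P (Sum.inr ()) (Sum.inr ()) = p ∧
                (∀ k l, Q (Sum.inl k) (Sum.inl l) = Γ k l) ∧
                (∀ l, Q (Sum.inr ()) (Sum.inl l) = 0) ∧
                IsUnit (QuadICL.secondMoment (QuadICL.bilinFeature W₀ W₁)) ∧
                (∀ g : ℝ, (∀ k, |γ k| ≤ g) →
                  QuadICL.frob (p • Γ + (QuadICL.secondMoment (QuadICL.bilinFeature W₀ W₁))⁻¹)
                    ≤ C * g * ((d : ℝ) ^ (3 / 2 : ℝ) / √(n : ℝ))) ∧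
                QuadICL.frob (M.transpose * (p • Γ) * M + 1)
                  ≤ C * ((d : ℝ) ^ (3 / 2 : ℝ) / √(n : ℝ))) ∧
              -- the prediction is close to minus the ordinary least squares prediction on `x̃`
              (∀ᵐ ω ∂QuadICL.promptLaw d n,
                IsUnit (QuadICL.gram (QuadICL.bilinFeature W₀ W₁) ω.1)) ∧
              MeasureTheory.Integrable (fun ω =>
                (QuadICL.prediction W₀ W₁ P Q (QuadICL.prompt ω.1 ω.2)
                  + QuadICL.olsPrediction (QuadICL.bilinFeature W₀ W₁) ω.1 ω.2) ^ 2)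
                (QuadICL.promptLaw d n) ∧
              ∫ ω, (QuadICL.prediction W₀ W₁ P Q (QuadICL.prompt ω.1 ω.2)
                  + QuadICL.olsPrediction (QuadICL.bilinFeature W₀ W₁) ω.1 ω.2) ^ 2
                ∂QuadICL.promptLaw d n ≤ K d / (n : ℝ) ∧
              -- the in-context learning loss
              QuadICL.loss d n W₀ W₁ P Q ≤ K d / (n : ℝ)) := by
  have hm : 1 ≤ momentBound ^ 6 := one_le_pow₀ one_le_momentBound
  -- With `208 = 4 · 52`, the condition `C d³ ≤ n` is exactly `52dθ ≤ 1`. The two Frobenius bounds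
  -- need only `64` and `32` in place of `208`.
  refine ⟨208 * momentBound ^ 6, fun d => trace (weightedMoment d - monoGram d), by positivity,
    fun d n hd hCn γ hγ => ?_⟩
  have hd' : (1 : ℝ) ≤ d := by exact_mod_cast hd
  have hd3 : (1 : ℝ) ≤ (d : ℝ) ^ 3 := one_le_pow₀ hd'
  have hnd : 208 * (d : ℝ) ^ 3 ≤ n := by nlinarith
  have hn' : (0 : ℝ) < n := by linarith
  have hn : 0 < n := by exact_mod_cast hn'
  have hθ : 52 * d * theta d n ≤ 1 := by
    have e : 52 * d * theta d n = 208 * momentBound ^ 6 * (d : ℝ) ^ 3 / n := by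
      rw [theta]; ring
    rw [e, div_le_one hn']
    exact hCn
  have hcard : Fintype.card (Idx d) ≤ n := by
    have h1 := card_Idx_le hd
    have h2 : (d : ℝ) ^ 2 ≤ (d : ℝ) ^ 3 := pow_le_pow_right₀ hd' (by norm_num)
    have : (Fintype.card (Idx d) : ℝ) ≤ n := by linarith
    exact_mod_cast this
  have hrate := rate_bound hn (by linarith : (d : ℝ) ^ 3 ≤ n)
  have hr0 : 0 ≤ (d : ℝ) ^ (3 / 2 : ℝ) / √(n : ℝ) := by positivity
  have hθ0 := theta_nonneg d n
  refine ⟨exists_isStageOne hn hγ, fun W₀ W₁ hW => ?_⟩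
  have hMu := hW.isUnit hd hn hθ hγ
  have hM := bilinFeature_eq W₀ W₁
  have hcoer := hW.sum_sq_le hd hn hθ hγ
  generalize featureMat W₀ W₁ = M at hMu hM hcoer
  refine ⟨M, hMu, hM, ?_, fun P Q hPQ => ?_⟩
  · obtain ⟨P, Q, h⟩ := exists_loss_eq_optimum hn hMu hM
    exact ⟨P, Q, fun P' Q' => h ▸ popLoss_optimum_le_loss hn hM P' Q'⟩
  obtain ⟨hp, hP, hQ, hB, hloss⟩ := hPQ.structure hd hn hMu hM
  have hle : loss d n W₀ W₁ P Q ≤ trace (weightedMoment d - monoGram d) / n :=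
    hloss ▸ popLoss_optimum_le_div d n
  have hgram := ae_isUnit_gram (n := n) hcard hMu hM
  have hopt := frobSq_optimum_add_one_le hd n
  -- Least squares agrees almost surely with the query label, so this integral is the loss.
  have hae : (fun ω => (prediction W₀ W₁ P Q (prompt ω.1 ω.2)
        + olsPrediction (bilinFeature W₀ W₁) ω.1 ω.2) ^ 2) =ᵐ[promptLaw d n]
      fun ω => (prediction W₀ W₁ P Q (prompt ω.1 ω.2) + target ω.2 (ω.1 (Sum.inr ()))) ^ 2 := by
    filter_upwards [hgram] with ω hω
    rw [olsPrediction_eq hMu hM ω.2 hω]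
  refine ⟨⟨P (Sum.inr ()) (Sum.inr ()), Q.toBlocks₁₁, hp, congrFun hP, rfl, fun _ _ => rfl,
    congrFun hQ, ?_, fun g hg => ?_, ?_⟩, hgram, ?_, ?_, hle⟩
  · rw [secondMoment_eq hM]
    exact hMu.mul ((Matrix.isUnit_transpose _).2 hMu)
  · have hg0 : 0 ≤ g := (abs_nonneg _).trans (hg (origin d))
    -- First-stage coercivity with every `-γ p` replaced by its bound `g`; this is how `‖Γ₀‖` enters
    -- the estimate.
    have hc : ∀ z : Idx d → ℝ, ∑ p, z p ^ 2 ≤ 2 * g * ∑ p, (M *ᵥ z) p ^ 2 := by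
      intro z
      have h1 := hcoer z
      have h2 : ∑ p, -γ p * (M *ᵥ z) p ^ 2 ≤ ∑ p, g * (M *ᵥ z) p ^ 2 :=
        Finset.sum_le_sum fun p _ =>
          mul_le_mul_of_nonneg_right ((neg_le_abs _).trans (hg p)) (sq_nonneg _)
      rw [← Finset.mul_sum] at h2
      linarith
    rw [secondMoment_eq hM, smul_add_inv_secondMoment hMu hB]
    have h1 : frob ((M⁻¹)ᵀ * (optimum d n + 1) * M⁻¹) ≤ 2 * g * (8 * d * theta d n) := by
      refine frob_le_of_frobSq_le (by positivity) ?_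
      refine (frobSq_congr_inv_le (by positivity) hMu hc _).trans ?_
      rw [mul_pow (2 * g)]
      gcongr
    have h2 := mul_le_mul_of_nonneg_left hrate hg0
    have h3 : 0 ≤ g * (momentBound ^ 6 * ((d : ℝ) ^ (3 / 2 : ℝ) / √(n : ℝ))) := by positivity
    linarith
  · rw [hB]
    have h1 := frob_le_of_frobSq_le (by positivity) hopt
    have h3 : 0 ≤ momentBound ^ 6 * ((d : ℝ) ^ (3 / 2 : ℝ) / √(n : ℝ)) := by positivity
    linarith
  · exact (integrable_congr hae).2 (integrable_prediction_add_target_sq hM P Q)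
  · rw [integral_congr_ae hae]
    exact hle
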